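/- Let $r,\hbar,m,\alpha>0$ and let $l$ be an integer or half-integer (of either sign). Let $V=V_{|l|}$ be the irreducible unitary representation of $\mathrm{SU}(2)$ of spin $|l|$, with operators $\sigma_1,\sigma_2,\sigma_3$ satisfying $[\sigma_1,\sigma_2]=i\hbar\sigma_3$ (and cyclically), the largest eigenvalue of $\sigma_3$ being $\hbar|l|$. Let $S^2\subset\mathbb{R}^3$ be the sphere of radius $r$ with surface-area measure, and $S^2_{\mathbb{C}}=\{a\in\mathbb{C}^3: a_1^2+a_2^2+a_3^2=r^2\}$. For $a\in\mathbb{C}^3$ let $E_a=\{v\in V:(\sigma\cdot a)v=r\hbar l\,v\}$. The quantum Hilbert space $H$ of a particle on $S^2$ in a constant magnetic field $B=-\hbar l/r$ is the space of those $\psi\in L^2(S^2;V)$ with $\psi(x)\in E_x$ for almost every $x$ (the position representation of the irreducible unitary representation of $\mathrm{SU}(2)\ltimes\mathbb{R}^3$ with parameters $r,l$). On it, $X_j$ is multiplication by $x_j$; $\hat J_1=-i\hbar(x_2\partial_3-x_3\partial_2)+\sigma_1$ (and cyclically); $\hat J^2=\hat J_1^2+\hat J_2^2+\hat J_3^2$;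 and $\exp(t\hat J^2)$, $t\in\mathbb{R}$, is defined through the decomposition into eigenspaces of $\hat J^2$ (on its natural domain). The annihilation operators are $$A_j=\exp\Big(-\frac{\hat J^2}{2m\alpha r^2\hbar}\Big)\,X_j\,\exp\Big(\frac{\hat J^2}{2m\alpha r^2\hbar}\Big),$$ meaning the closure of this product on its natural domain. Generalized vectors are conjugate-linear functionals $\delta:f\mapsto\langle f,\delta\rangle$ on the smooth sections $f$ (the smooth functions $f:S^2\to V$ with $f(x)\in E_x$ for all $x$); $\psi\in H$ gives $f\mapsto\langle f,\psi\rangle$, and such $\delta$ are called normalizable. For $x\in S^2$, $v\in V$ let $\delta_{x,v}$ be given by $\langle f,\delta_{x,v}\rangle=\langle f(x),v\rangle$. $X_j$ and $\exp(-t\hat J^2)$, $t>0$, act on generalized vectors by duality: $\langle f,X_j\delta\rangle=\langle X_jf,\delta\rangle$, and $\chi=\exp(-t\hat J^2)\delta$ with $\chi\in H$ means that for every $\psi\in H$ the vector $\exp(-t\hat J^2)\psi$ is defined and is a smooth section, and $\langle\psi,\chi\rangle=\langle\exp(-t\hat J^2)\psi,\delta\rangle$. **Theorem.** (1) For each $a\in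 S^2_{\mathbb{C}}$ there is a nonzero vector $\chi_a\in H$ such that, for $j=1,2,3$, $\chi_a$ lies in the domain of $A_j$ and $A_j\chi_a=a_j\chi_a$. (2) These vectors are given on $S^2$ by the bundle heat kernel, and on $S^2_{\mathbb{C}}$ by its analytic continuation. Precisely, there are linear maps $K_a:V\to H$, $a\in S^2_{\mathbb{C}}$, such that - $a\mapsto K_av$ is holomorphic from $S^2_{\mathbb{C}}$ to $H$ for each $v\in V$; - $K_xv=\exp\big(-\hat J^2/(2m\alpha r^2\hbar)\big)\delta_{x,v}$ for all $x\in S^2$, $v\in V$; - for $x\in S^2$ and $0\neq v\in E_x$, the generalized vector $\delta_{x,v}$ is nonzero and non-normalizable, and $X_j\delta_{x,v}=x_j\delta_{x,v}$ for all $j$; - for every $a\in S^2_{\mathbb{C}}$, $E_a\neq0$, and for every nonzero $v\in E_a$ the vector $\chi_a=K_av$ is nonzero, lies in the domain of each $A_j$, and satisfies $A_j\chi_a=a_j\chi_a$. -/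

import Mathlib

open MeasureTheory Metric
open scoped ContDiff InnerProductSpace ENNReal

noncomputable section

namespace MonopoleSphere

/-- Euclidean three-space. -/
abbrev E3 : Type := EuclideanSpace ℝ (Fin 3)

/-- The parameters of the system: the radius `r` of the sphere, Planck's constant `hbar`, the mass
`m`, the frequency `α` of the complexifier, and the twist `l = twoL / 2`, an arbitrary (positive,
zero or negative) integer or half-integer. -/
structure Params where
  r : ℝ
  hbar : ℝ
  m : ℝ
  α : ℝ
  twoL : ℤ
  r_pos : 0 < r
  hbar_pos : 0 < hbar
  m_pos : 0 < m
  α_pos : 0 < α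

namespace Params

variable (P : Params)

/-- The twist `l`, an integer or half-integer. -/
def l : ℝ := (P.twoL : ℝ) / 2

/-- The number `1 / (2 m α r² ħ)`: the complexifier divided by `ħ` is this number times `Ĵ²`. -/
def s : ℝ := 1 / (2 * P.m * P.α * P.r ^ 2 * P.hbar)

/-- The real sphere `S²` of radius `r`. -/
abbrev Sphere : Type := sphere (0 : E3) P.r

/-- The dilation of the unit sphere onto the sphere of radius `r`. -/
def dilate (u : sphere (0 : E3) 1) : P.Sphere :=
  ⟨P.r • (u : E3), by
    have hu : ‖(u : E3)‖ = 1 := by simp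
    simp [norm_smul, hu, abs_of_pos P.r_pos]⟩

/-- The surface-area measure on the sphere of radius `r`: `r²` times the image of the surface-area
measure on the unit sphere. -/
def area : Measure P.Sphere :=
  ENNReal.ofReal (P.r ^ 2) • (volume : Measure E3).toSphere.map P.dilate

/-- The complex sphere `a₁² + a₂² + a₃² = r²` in `ℂ³`. -/
def sphereC : Set (Fin 3 → ℂ) := {a | ∑ j, a j ^ 2 = (P.r : ℂ) ^ 2}

/-- A point of the real sphere as a point of `ℂ³`. -/
def toC (x : P.Sphere) : Fin 3 → ℂ := fun j => (((x : E3) j : ℝ) : ℂ)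

/-! ### The spin space -/

/-- Twice the spin `|l|`. -/
def spin : ℕ := P.twoL.natAbs

/-- The space `V` of the irreducible representation of `SU(2)` of spin `|l|`, of dimension
`2|l| + 1`, in the orthonormal basis of weight vectors. -/
abbrev V : Type := EuclideanSpace ℂ (Fin (P.spin + 1))

/-- The raising operator divided by `ħ`; the `k`-th basis vector has weight `spin / 2 - k`. -/
def raise : Matrix (Fin (P.spin + 1)) (Fin (P.spin + 1)) ℂ := fun i k =>
  if (k : ℕ) = i + 1 then ((Real.sqrt (((i : ℝ) + 1) * ((P.spin : ℝ) - i)) : ℝ) : ℂ) else 0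

/-- The matrices of the operators `σ_j / ħ`, the spin-`|l|` matrices. -/
def spinMatrix : Fin 3 → Matrix (Fin (P.spin + 1)) (Fin (P.spin + 1)) ℂ :=
  ![(1 / 2 : ℂ) • (P.raise + P.raise.conjTranspose),
    (1 / (2 * Complex.I) : ℂ) • (P.raise - P.raise.conjTranspose),
    Matrix.diagonal fun k => (((P.spin : ℝ) / 2 - (k : ℝ) : ℝ) : ℂ)]

/-- The operators `σ_j` on `V`. -/
def σ (j : Fin 3) : P.V →L[ℂ] P.V := (P.hbar : ℂ) • Matrix.toEuclideanCLM (𝕜 := ℂ) (P.spinMatrix j)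

/-- The operator `σ · a` on `V`, for `a` in `ℂ³`. -/
def σdot (a : Fin 3 → ℂ) : P.V →L[ℂ] P.V := ∑ j, a j • P.σ j

/-- The fibre over `a` of the bundle of twist `l`: the vectors `v` in `V` with
`(σ · a) v = r ħ l v`. -/
def fibre (a : Fin 3 → ℂ) : Submodule ℂ P.V :=
  LinearMap.ker ((P.σdot a - ((P.r * P.hbar * P.l : ℝ) : ℂ) • ContinuousLinearMap.id ℂ P.V :
    P.V →L[ℂ] P.V) : P.V →ₗ[ℂ] P.V)

/-! ### The Hilbert space of square-integrable sections -/

instance : IsFiniteMeasure P.area := by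
  unfold area
  have : IsFiniteMeasure ((volume : Measure E3).toSphere.map P.dilate) := inferInstance
  exact Measure.smul_finite _ ENNReal.ofReal_ne_top

/-- The ambient space `L²(S²; V)`. -/
abbrev L2V : Type := Lp P.V 2 P.area

/-- The quantum Hilbert space `Γ²(S²; l)`: the `V`-valued square-integrable functions on `S²` whose
value at `x` lies in the fibre over `x`. -/
def sections : Submodule ℂ P.L2V where
  carrier := {ψ | ∀ᵐ x ∂P.area, ψ x ∈ P.fibre (P.toC x)}
  zero_mem' := by
    filter_upwards [Lp.coeFn_zero P.V 2 P.area] with x hx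
    rw [hx]; exact Submodule.zero_mem _
  add_mem' := by
    intro f g hf hg
    change ∀ᵐ x ∂P.area, _
    filter_upwards [Lp.coeFn_add f g, hf, hg] with x hx h1 h2
    rw [hx]; exact Submodule.add_mem _ h1 h2
  smul_mem' := by
    intro c f hf
    change ∀ᵐ x ∂P.area, _
    filter_upwards [Lp.coeFn_smul c f, hf] with x hx h1
    rw [hx]; exact Submodule.smul_mem _ c h1

/-- The quantum Hilbert space. -/
abbrev H : Type := P.sections

theorem isClosed_sections : IsClosed (P.sections : Set P.L2V) := by
  refine IsSeqClosed.isClosed fun u ψ hu hlim => ?_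
  obtain ⟨ns, -, hns⟩ := (tendstoInMeasure_of_tendsto_Lp hlim).exists_seq_tendsto_ae
  have hall : ∀ᵐ x ∂P.area, ∀ n, u n x ∈ P.fibre (P.toC x) := ae_all_iff.2 hu
  change ∀ᵐ x ∂P.area, ψ x ∈ P.fibre (P.toC x)
  filter_upwards [hns, hall] with x hx h
  exact (Submodule.closed_of_finiteDimensional (P.fibre (P.toC x))).mem_of_tendsto hx
    (Filter.Eventually.of_forall fun i => h (ns i))

instance : CompleteSpace P.H := P.isClosed_sections.completeSpace_coe

/-- Multiplication by a coordinate function preserves square-integrability. -/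
theorem memLp_coord_smul (j : Fin 3) (ψ : P.L2V) :
    MemLp (fun x : P.Sphere => P.toC x j • ψ x) 2 P.area := by
  refine (Lp.memLp ψ).of_le_mul (c := P.r) ?_ (Filter.Eventually.of_forall fun x => ?_)
  · have hc : Continuous fun x : P.Sphere => P.toC x j := by
      unfold toC
      fun_prop
    exact hc.aestronglyMeasurable.smul (Lp.aestronglyMeasurable ψ)
  · rw [norm_smul]
    gcongr
    have h1 : ‖(x : E3) j‖ ≤ ‖(x : E3)‖ := PiLp.norm_apply_le _ j
    have h2 : ‖(x : E3)‖ = P.r := by simp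
    rw [toC, Complex.norm_real]
    exact h1.trans h2.le

/-- The position operator `X_j`: multiplication by `x_j`. -/
def X (j : Fin 3) : P.H →ₗ[ℂ] P.H where
  toFun ψ := ⟨(P.memLp_coord_smul j ψ).toLp _, by
    change ∀ᵐ x ∂P.area, _
    filter_upwards [(P.memLp_coord_smul j ψ).coeFn_toLp, ψ.2] with x hx h
    rw [hx]; exact Submodule.smul_mem _ _ h⟩
  map_add' f g := by
    refine Subtype.ext (Lp.ext ?_)
    refine (P.memLp_coord_smul j (f + g : P.H)).coeFn_toLp.trans (Filter.EventuallyEq.symm ?_)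
    refine (Lp.coeFn_add _ _).trans ?_
    filter_upwards [(P.memLp_coord_smul j f).coeFn_toLp, (P.memLp_coord_smul j g).coeFn_toLp,
      Lp.coeFn_add (f : P.L2V) (g : P.L2V)] with x h1 h2 h3
    rw [Pi.add_apply]
    refine (congrArg₂ (· + ·) h1 h2).trans ?_
    change _ = P.toC x j • ((f : P.L2V) + (g : P.L2V) : P.L2V) x
    rw [h3, Pi.add_apply, smul_add]
  map_smul' c f := by
    refine Subtype.ext (Lp.ext ?_)
    refine (P.memLp_coord_smul j (c • f : P.H)).coeFn_toLp.trans (Filter.EventuallyEq.symm ?_)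
    refine (Lp.coeFn_smul _ _).trans ?_
    filter_upwards [(P.memLp_coord_smul j f).coeFn_toLp,
      Lp.coeFn_smul c (f : P.L2V)] with x h1 h3
    rw [Pi.smul_apply]
    refine (congrArg (c • ·) h1).trans ?_
    change _ = P.toC x j • (c • (f : P.L2V) : P.L2V) x
    rw [h3, Pi.smul_apply, smul_comm]

/-! ### Angular momentum -/

/-- The partial derivative `∂F/∂x_i`. -/
def partialDeriv (i : Fin 3) (F : E3 → P.V) : E3 → P.V :=
  fun x => fderiv ℝ F x (EuclideanSpace.single i (1 : ℝ))

/-- The angular momentum operator `Ĵ_j = L_j + σ_j`, where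
`L_j = -iħ (x_{j+1} ∂_{j+2} - x_{j+2} ∂_{j+1})` with cyclic indices. It differentiates along the
sphere, so the restriction of `Ĵ_j F` to the sphere depends only on that of `F`. -/
def angMom (j : Fin 3) (F : E3 → P.V) : E3 → P.V := fun x =>
  (-(Complex.I * (P.hbar : ℂ))) •
    (x (j + 1) • P.partialDeriv (j + 2) F x - x (j + 2) • P.partialDeriv (j + 1) F x) +
  P.σ j (F x)

/-- The operator `Ĵ² = Ĵ₁² + Ĵ₂² + Ĵ₃²`. -/
def angMomSq (F : E3 → P.V) : E3 → P.V := fun x => ∑ j, P.angMom j (P.angMom j F) x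

/-- The eigenspace of `Ĵ²` in the Hilbert space for the eigenvalue `c`: the closed linear span of
the smooth sections `ψ` with `Ĵ² ψ = c ψ`. -/
def eigenspace (c : ℝ) : Submodule ℂ P.H :=
  (Submodule.span ℂ {ψ : P.H | ∃ F : E3 → P.V, ContDiff ℝ ∞ F ∧
    (∀ x : P.Sphere, P.angMomSq F x = c • F x) ∧
    ∀ᵐ x ∂P.area, (ψ : P.L2V) x = F x}).topologicalClosure

instance (c : ℝ) : CompleteSpace (P.eigenspace c) :=
  (Submodule.isClosed_topologicalClosure _).completeSpace_coe

/-- The spectral projection of `Ĵ²` at `c`. -/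
def specProj (c : ℝ) : P.H →L[ℂ] P.H := (P.eigenspace c).starProjection

/-- The operator `exp(t Ĵ²)` given by the spectral decomposition of `Ĵ²`, which has pure point
spectrum: `exp(t Ĵ²) ψ = ∑ e^{t c} ψ_c`, where `ψ_c` is the component of `ψ` in the eigenspace for
`c`, on the domain of all `ψ` for which the series converges in the Hilbert space. -/
def expAngMomSq (t : ℝ) : P.H →ₗ.[ℂ] P.H where
  domain :=
    { carrier := {ψ | Summable fun c : ℝ => ((Real.exp (t * c) : ℝ) : ℂ) • P.specProj c ψ}
      zero_mem' := by simp [summable_zero]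
      add_mem' := by
        intro f g hf hg
        simpa [smul_add] using hf.add hg
      smul_mem' := by
        intro z f hf
        simpa [smul_comm z] using hf.const_smul z }
  toFun :=
    { toFun := fun ψ => ∑' c : ℝ, ((Real.exp (t * c) : ℝ) : ℂ) • P.specProj c (ψ : P.H)
      map_add' := by
        intro f g
        simpa [smul_add] using f.2.tsum_add g.2
      map_smul' := by
        intro z f
        simpa [smul_comm z] using f.2.tsum_const_smul z }

/-! ### The annihilation operators -/

/-- The composition of two partially defined operators on its natural domain, the set of the `ψ` in
the domain of `f` for which `f ψ` is in the domain of `g`. -/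
def naturalComp {W : Type*} [AddCommGroup W] [Module ℂ W] (g f : W →ₗ.[ℂ] W) : W →ₗ.[ℂ] W where
  domain := (g.domain.comap f.toFun).map f.domain.subtype
  toFun := g.toFun ∘ₗ LinearMap.codRestrict g.domain
    (f.toFun ∘ₗ Submodule.inclusion (Submodule.map_subtype_le _ _)) (by
      rintro ⟨x, ⟨y, hy, rfl⟩⟩
      exact hy)

/-- The annihilation operator
`A_j = exp(-Ĵ²/(2mαr²ħ)) X_j exp(Ĵ²/(2mαr²ħ))`: the closure of the product on its natural domain. -/
def A (j : Fin 3) : P.H →ₗ.[ℂ] P.H :=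
  (naturalComp (P.expAngMomSq (-P.s)) ((P.X j).compPMap (P.expAngMomSq P.s))).closure

/-- `χ` is a coherent state with label `a`: a nonzero vector of the Hilbert space in the domain of
each `A_j`, with `A_j χ = a_j χ`. -/
def IsCoherentState (a : Fin 3 → ℂ) (χ : P.H) : Prop :=
  χ ≠ 0 ∧ ∀ j, ∃ h : χ ∈ (P.A j).domain, P.A j ⟨χ, h⟩ = a j • χ

/-! ### Smooth sections and generalized vectors -/

/-- The smooth sections of the bundle over `S²`. -/
def smoothSections : Submodule ℂ (P.Sphere → P.V) where
  carrier := {f | (∃ F : E3 → P.V, ContDiff ℝ ∞ F ∧ ∀ x : P.Sphere, f x = F x) ∧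
    ∀ x, f x ∈ P.fibre (P.toC x)}
  zero_mem' := ⟨⟨0, contDiff_const, fun _ => rfl⟩, fun _ => Submodule.zero_mem _⟩
  add_mem' := by
    rintro f g ⟨⟨F, hF, h1⟩, h2⟩ ⟨⟨G, hG, h3⟩, h4⟩
    exact ⟨⟨F + G, hF.add hG, fun x => by simp [h1, h3]⟩,
      fun x => Submodule.add_mem _ (h2 x) (h4 x)⟩
  smul_mem' := by
    rintro c f ⟨⟨F, hF, h1⟩, h2⟩
    exact ⟨⟨c • F, hF.const_smul c, fun x => by simp [h1]⟩,
      fun x => Submodule.smul_mem _ c (h2 x)⟩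

theorem memLp_smooth (f : P.smoothSections) : MemLp (f : P.Sphere → P.V) 2 P.area := by
  obtain ⟨F, hF, h⟩ := f.2.1
  have hc : Continuous (f : P.Sphere → P.V) := by
    have : (f : P.Sphere → P.V) = fun x : P.Sphere => F (x : E3) := funext h
    rw [this]
    exact hF.continuous.comp continuous_subtype_val
  obtain ⟨C, hC⟩ := isCompact_univ.exists_bound_of_continuousOn hc.continuousOn
  exact MemLp.of_bound hc.aestronglyMeasurable C
    (Filter.Eventually.of_forall fun x => hC x (Set.mem_univ x))

/-- A smooth section as a vector of the Hilbert space. -/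
def ofSmooth : P.smoothSections →ₗ[ℂ] P.H where
  toFun f := ⟨(P.memLp_smooth f).toLp _, by
    change ∀ᵐ x ∂P.area, _
    filter_upwards [(P.memLp_smooth f).coeFn_toLp] with x hx
    rw [hx]; exact f.2.2 x⟩
  map_add' _ _ := rfl
  map_smul' _ _ := rfl

/-- Multiplication of a smooth section by the coordinate function `x_j`. -/
def mulCoord (j : Fin 3) (f : P.smoothSections) : P.smoothSections :=
  ⟨fun x => P.toC x j • (f : P.Sphere → P.V) x, by
    obtain ⟨F, hF, h⟩ := f.2.1
    refine ⟨⟨fun x => x j • F x, ?_, fun x => ?_⟩, fun x => Submodule.smul_mem _ _ (f.2.2 x)⟩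
    · have h1 : ContDiff ℝ ∞ fun x : E3 => x j := (EuclideanSpace.proj (𝕜 := ℝ) j).contDiff
      exact h1.smul hF
    · change P.toC x j • (f : P.Sphere → P.V) x = (x : E3) j • F x
      rw [h x]; exact Complex.coe_smul _ _⟩

/-- Generalized vectors `δ`, given by their pairings `⟨f, δ⟩` with the smooth sections `f`; the
pairing is conjugate-linear in `f`. -/
abbrev GenVec : Type := P.smoothSections →ₛₗ[starRingEnd ℂ] ℂ

/-- The delta vector at the point `x` with value `v`: `⟨f, δ⟩ = ⟨f(x), v⟩`. -/
def delta (x : P.Sphere) (v : P.V) : P.GenVec where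
  toFun f := ⟪(f : P.Sphere → P.V) x, v⟫_ℂ
  map_add' f g := by simp
  map_smul' c f := by simp [mul_comm]

/-- `δ` is normalizable: it comes from a vector of the Hilbert space. -/
def IsNormalizable (δ : P.GenVec) : Prop := ∃ ψ : P.H, ∀ f, δ f = ⟪P.ofSmooth f, ψ⟫_ℂ

/-- `X_j δ = a_j δ` for all `j`, where the symmetric operator `X_j` acts on generalized vectors by
`⟨f, X_j δ⟩ = ⟨X_j f, δ⟩`. -/
def IsPositionEigenvector (a : Fin 3 → ℂ) (δ : P.GenVec) : Prop :=
  δ ≠ 0 ∧ ∀ j f, δ (P.mulCoord j f) = a j * δ f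

/-- `χ = exp(-t Ĵ²) δ`, where the symmetric operator `exp(-t Ĵ²)` maps the Hilbert space to the
smooth sections, and acts on generalized vectors by `⟨ψ, exp(-t Ĵ²) δ⟩ = ⟨exp(-t Ĵ²) ψ, δ⟩`. -/
def IsHeatApplied (t : ℝ) (δ : P.GenVec) (χ : P.H) : Prop :=
  ∀ ψ : P.H, ∃ h : ψ ∈ (P.expAngMomSq (-t)).domain, ∃ g : P.smoothSections,
    P.ofSmooth g = P.expAngMomSq (-t) ⟨ψ, h⟩ ∧ ⟪ψ, χ⟫_ℂ = δ g

/-- A map on the complex sphere, which is a complex submanifold of `ℂ³`, is holomorphic: near each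
point of the complex sphere it is the restriction of a holomorphic map on an open subset of `ℂ³`. -/
def IsHolomorphic (f : (Fin 3 → ℂ) → P.H) : Prop :=
  ∀ a ∈ P.sphereC, ∃ U : Set (Fin 3 → ℂ), IsOpen U ∧ a ∈ U ∧
    ∃ F : (Fin 3 → ℂ) → P.H, DifferentiableOn ℂ F U ∧ ∀ b ∈ U ∩ P.sphereC, f b = F b

end Params

end MonopoleSphere

end

noncomputable section

namespace MonopoleSphere

namespace Params
variable (P : Params)

/-! ### The spin algebra -/

/-! The proof diagonalises `Ĵ²` algebraically, on restrictions to the sphere of polynomials on `ℂ³`,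
so that every construction continues to the complex sphere.

Over the real sphere the weights of `σ · x / (r ħ)` are `l - ε k`, `0 ≤ k ≤ 2|l|`, so the projection
`Π_x` onto the fibre is a Lagrange polynomial in this operator (`spinDir_mul_fibreProj`), hence
polynomial in `x`. It is rotation-equivariant, so `Ĵ_j (Π w) = Π (σ_j w)` (`cangMom_lowest`). Let
`level n` be spanned by products of fewer than `n` coordinates with sections `Π w`. On the sphere,
`Ĵ²` acts on `level (n + 1)` modulo `level n` as the scalar `ħ² (|l| + n)(|l| + n + 1)`
(`cangMomSq_level`). Since `Ĵ²` is symmetric, the successive orthogonal complements `band n` consist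
of eigenvectors. By Stone-Weierstrass they span a dense subspace (`eq_zero_of_orthogonal_level`), so
they are all the eigenspaces. Multiplication by `x_j` raises the level by at most one.

Let `κ_n(a) : V → band n` be the reproducing kernel, with `⟨F, κ_n(a) v⟩ = ⟨F(ā), v⟩`; it is
holomorphic in `a`. Put `S_N = ∑_{n < N} κ_n(a) v`, and let `s` be the heat time. Against an `F` of
level `N - 1` the vector `(X_j - a_j) S_N` vanishes, because `X_j F` has level `N` and is still
reproduced by `S_N` (`inner_kernelDefect`). So this defect lives in the two bands `N - 1` and `N`,
where `exp(-s Ĵ²)` is Gaussian-small in `N`. On bounded parts of the complex sphere `S_N` grows at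
most exponentially (`exists_kernelVec_le`). Hence the pairs `(e^{-sĴ²} S_N, e^{-sĴ²} X_j S_N)`,
which lie in the graph of the unclosed product, converge to `(K_a v, a_j K_a v)` with `K_a = ∑ e^{-s
c_n} κ_n(a)`, where `c_n` is the eigenvalue on `band n` (`mem_closure_heatKernel`). The product is
closable because the bands lie in the domain of its adjoint (`isClosable_preA`).

The growth estimate comes from the trace of the kernel, `∑ |F_i(a)|²` over an orthonormal basis of
the band. It is constant on the real sphere. Since `Ĵ` preserves the band with norm at most `√c_n`,
Grönwall along the imaginary direction of a complexified great circle bounds it at `a`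
(`bandKernel_le`).

The eigenvalue equation holds for every `v`; the condition `v ∈ E_a` serves to make `K_a v` nonzero,
by pairing with the section `Π v` (`heatKernel_ne_zero`). Powers of a peak function show that the
delta vectors are not normalizable. -/

theorem raise_mul_conjTranspose : P.raise * P.raise.conjTranspose =
    Matrix.diagonal fun i : Fin (P.spin + 1) => (((i : ℕ) : ℂ) + 1) * ((P.spin : ℂ) - (i : ℕ)) := by
  ext i k
  rw [Matrix.mul_apply, Matrix.diagonal_apply]
  by_cases hi : (i : ℕ) + 1 < P.spin + 1
  · rw [Finset.sum_eq_single ⟨i + 1, hi⟩]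
    · by_cases hik : i = k
      · subst hik
        have h0 : (0 : ℝ) ≤ ((i : ℝ) + 1) * ((P.spin : ℝ) - i) := by
          have : ((i : ℕ) : ℝ) + 1 ≤ P.spin := by exact_mod_cast Nat.lt_succ_iff.1 hi
          have h2 : (0 : ℝ) ≤ (P.spin : ℝ) - i := by linarith
          positivity
        simp only [raise, Matrix.conjTranspose_apply, if_true]
        rw [RCLike.star_def, Complex.conj_ofReal, ← Complex.ofReal_mul, Real.mul_self_sqrt h0]
        push_cast; rfl
      · have : ¬ ((i : ℕ) + 1 = k + 1) := fun h => hik (Fin.ext (by omega))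
        simp only [raise, Matrix.conjTranspose_apply, this, hik, if_false, star_zero, mul_zero]
    · intro b _ hb
      have : ¬ ((b : ℕ) = i + 1) := fun h => hb (Fin.ext h)
      simp [raise, this]
    · simp
  · have hiS : (i : ℕ) = P.spin := by omega
    rw [Finset.sum_eq_zero]
    · split_ifs with h
      · simp [hiS]
      · rfl
    · intro b _
      have : ¬ ((b : ℕ) = i + 1) := by omega
      simp [raise, this]

theorem conjTranspose_mul_raise : P.raise.conjTranspose * P.raise =
    Matrix.diagonal fun i : Fin (P.spin + 1) => ((i : ℕ) : ℂ) * ((P.spin : ℂ) - (i : ℕ) + 1) := by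
  ext i k
  rw [Matrix.mul_apply, Matrix.diagonal_apply]
  by_cases hi : 0 < (i : ℕ)
  · have hlt : (i : ℕ) - 1 < P.spin + 1 := by omega
    rw [Finset.sum_eq_single ⟨i - 1, hlt⟩]
    · have hi1 : (i : ℕ) = (i : ℕ) - 1 + 1 := by omega
      by_cases hik : i = k
      · subst hik
        have hc : (((i : ℕ) - 1 : ℕ) : ℝ) = (i : ℝ) - 1 := by
          rw [Nat.cast_sub hi]; simp
        have h0 : (0 : ℝ) ≤ ((i : ℝ) - 1 + 1) * ((P.spin : ℝ) - (i - 1)) := by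
          have : ((i : ℕ) : ℝ) ≤ P.spin := by exact_mod_cast Nat.lt_succ_iff.1 i.2
          have h2 : (0 : ℝ) ≤ (P.spin : ℝ) - (i - 1) := by linarith
          have h3 : (0 : ℝ) ≤ (i : ℝ) - 1 + 1 := by simp
          positivity
        simp only [raise, Matrix.conjTranspose_apply, ← hi1, if_true]
        rw [RCLike.star_def, Complex.conj_ofReal, ← Complex.ofReal_mul, hc, Real.mul_self_sqrt h0]
        push_cast; ring
      · have : ¬ ((k : ℕ) = (i : ℕ) - 1 + 1) := fun h => hik (Fin.ext (by omega))
        simp [raise, Matrix.conjTranspose_apply, this, hik]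
    · intro b _ hb
      have : ¬ ((i : ℕ) = b + 1) := fun h => hb (Fin.ext (by simp; omega))
      simp [raise, this]
    · simp
  · have hiS : (i : ℕ) = 0 := by omega
    rw [Finset.sum_eq_zero]
    · split_ifs with h
      · simp [hiS]
      · rfl
    · intro b _
      have : ¬ ((i : ℕ) = b + 1) := by omega
      simp [raise, this]

/-- Raising moves the `k`-th weight vector to the `(k - 1)`-st, whose weight is larger by one. -/
theorem spinMatrix_two_mul_raise :
    P.spinMatrix 2 * P.raise = P.raise * P.spinMatrix 2 + P.raise := by
  ext i k
  simp only [spinMatrix, Matrix.cons_val, Matrix.add_apply, Matrix.diagonal_mul,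
    Matrix.mul_diagonal]
  by_cases h : (k : ℕ) = i + 1
  · have hc : ((k : ℕ) : ℝ) = (i : ℝ) + 1 := by rw [h]; simp
    rw [hc]; push_cast; ring
  · simp [raise, h]

theorem spinMatrix_conjTranspose (j : Fin 3) :
    (P.spinMatrix j).conjTranspose = P.spinMatrix j := by
  fin_cases j
  · simp [spinMatrix, Matrix.conjTranspose_smul, add_comm]
  · simp only [spinMatrix, Fin.mk_one, Matrix.cons_val, Matrix.conjTranspose_smul,
      Matrix.conjTranspose_sub, Matrix.conjTranspose_conjTranspose]
    rw [← neg_sub, smul_neg, ← neg_smul]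
    congr 1
    simp
  · simp only [spinMatrix, Fin.reduceFinMk, Matrix.cons_val, Matrix.diagonal_conjTranspose]
    congr 1
    ext k
    simp

theorem conjTranspose_mul_spinMatrix_two :
    P.raise.conjTranspose * P.spinMatrix 2 =
      P.spinMatrix 2 * P.raise.conjTranspose + P.raise.conjTranspose := by
  have h := congrArg Matrix.conjTranspose P.spinMatrix_two_mul_raise
  simpa [Matrix.conjTranspose_mul, spinMatrix_conjTranspose] using h

theorem raise_commutator : P.raise * P.raise.conjTranspose - P.raise.conjTranspose * P.raise =
    (2 : ℂ) • P.spinMatrix 2 := by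
  rw [raise_mul_conjTranspose, conjTranspose_mul_raise, Matrix.diagonal_sub]
  simp only [spinMatrix, Matrix.cons_val]
  rw [← Matrix.diagonal_smul]
  congr 1
  ext k
  simp
  ring

theorem spinMatrix_zero : P.spinMatrix 0 = (1 / 2 : ℂ) • (P.raise + P.raise.conjTranspose) := rfl
theorem spinMatrix_one :
    P.spinMatrix 1 = (1 / (2 * Complex.I) : ℂ) • (P.raise - P.raise.conjTranspose) := rfl

theorem spinMatrix_comm (j : Fin 3) :
    P.spinMatrix j * P.spinMatrix (j + 1) - P.spinMatrix (j + 1) * P.spinMatrix j =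
      Complex.I • P.spinMatrix (j + 2) := by
  have hI : (1 / (2 * Complex.I) : ℂ) = -(Complex.I / 2) := by
    field_simp; simp
  have h1 := P.raise_commutator
  have h2 := P.spinMatrix_two_mul_raise
  have h3 := P.conjTranspose_mul_spinMatrix_two
  fin_cases j
  · simp only [Fin.zero_eta, zero_add, spinMatrix_zero, spinMatrix_one, hI]
    have : P.spinMatrix 2 = (1 / 2 : ℂ) •
        (P.raise * P.raise.conjTranspose - P.raise.conjTranspose * P.raise) := by
      rw [h1, smul_smul]; norm_num
    rw [this]
    simp only [smul_mul_assoc, mul_smul_comm, add_mul, mul_add, sub_mul, mul_sub, smul_sub,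
      smul_add, smul_smul]
    module
  · simp only [Fin.mk_one, show (1 + 1 : Fin 3) = 2 from rfl, show (1 + 2 : Fin 3) = 0 from rfl,
      spinMatrix_zero, spinMatrix_one, hI, smul_mul_assoc, mul_smul_comm, mul_sub, sub_mul, h2, h3]
    rw [smul_smul]
    module
  · simp only [Fin.reduceFinMk, show (2 + 1 : Fin 3) = 0 from rfl,
      show (2 + 2 : Fin 3) = 1 from rfl,
      spinMatrix_zero, spinMatrix_one, hI, smul_mul_assoc, mul_smul_comm, mul_add, add_mul, h2, h3]
    rw [smul_smul, show Complex.I * -(Complex.I / 2) = 1 / 2 by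
      rw [mul_neg, ← mul_div_assoc, Complex.I_mul_I]; norm_num]
    module

theorem spinMatrix_casimir : ∑ j, P.spinMatrix j * P.spinMatrix j =
    ((P.spin : ℂ) / 2 * (P.spin / 2 + 1)) • (1 : Matrix _ _ ℂ) := by
  have hI : (1 / (2 * Complex.I) : ℂ) = -(Complex.I / 2) := by
    field_simp; simp
  have hsum : P.spinMatrix 0 * P.spinMatrix 0 + P.spinMatrix 1 * P.spinMatrix 1 =
      (1 / 2 : ℂ) • (P.raise * P.raise.conjTranspose + P.raise.conjTranspose * P.raise) := by
    simp only [spinMatrix_zero, spinMatrix_one, hI, smul_mul_assoc, mul_smul_comm, add_mul, mul_add,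
      sub_mul, mul_sub, smul_sub, smul_add, smul_smul, neg_mul, mul_neg, neg_smul]
    match_scalars <;> ring_nf <;> rw [Complex.I_sq] <;> norm_num
  rw [Fin.sum_univ_three, hsum, raise_mul_conjTranspose, conjTranspose_mul_raise,
    Matrix.diagonal_add]
  simp only [spinMatrix, Matrix.cons_val]
  rw [Matrix.diagonal_mul_diagonal, ← Matrix.diagonal_smul, Matrix.diagonal_add,
    ← Matrix.diagonal_one, ← Matrix.diagonal_smul]
  congr 1
  ext k
  simp
  ring

/-- The operators `σ_j / ħ`. -/
def spinOp (j : Fin 3) : P.V →L[ℂ] P.V := Matrix.toEuclideanCLM (𝕜 := ℂ) (P.spinMatrix j)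

theorem σ_eq (j : Fin 3) : P.σ j = (P.hbar : ℂ) • P.spinOp j := rfl

theorem spinOp_comm (j : Fin 3) :
    P.spinOp j * P.spinOp (j + 1) - P.spinOp (j + 1) * P.spinOp j =
      Complex.I • P.spinOp (j + 2) := by
  simp only [spinOp]
  rw [← map_mul, ← map_mul, ← map_sub, spinMatrix_comm, map_smul]

theorem spinOp_casimir : ∑ j, P.spinOp j * P.spinOp j =
    ((P.spin : ℂ) / 2 * (P.spin / 2 + 1)) • (1 : P.V →L[ℂ] P.V) := by
  simp only [spinOp]
  simp_rw [← map_mul]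
  rw [← map_sum, spinMatrix_casimir, map_smul, map_one]

theorem spinOp_star (j : Fin 3) : star (P.spinOp j) = P.spinOp j := by
  simp only [spinOp]
  rw [← map_star]
  congr 1
  exact P.spinMatrix_conjTranspose j

theorem inner_spinOp (j : Fin 3) (v w : P.V) : ⟪P.spinOp j v, w⟫_ℂ = ⟪v, P.spinOp j w⟫_ℂ := by
  conv_lhs => rw [← P.spinOp_star j, ContinuousLinearMap.star_eq_adjoint]
  exact ContinuousLinearMap.adjoint_inner_left _ _ _

theorem inner_σ (j : Fin 3) (v w : P.V) : ⟪P.σ j v, w⟫_ℂ = ⟪v, P.σ j w⟫_ℂ := by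
  simp [σ_eq, inner_spinOp]

/-- The sign of the twist. -/
def ε : ℝ := if 0 ≤ P.twoL then 1 else -1

theorem ε_mul_self : P.ε * P.ε = 1 := by
  unfold ε; split_ifs <;> norm_num

/-- The sign `ε` treats both signs of the twist at once: `l` is the extreme weight in the direction
`ε`, and all other weights are reached from it by steps of `-ε`. -/
theorem l_eq : P.l = P.ε * (P.spin / 2) := by
  unfold l ε spin
  split_ifs with h
  · have : ((P.twoL.natAbs : ℤ) : ℝ) = P.twoL := by rw [Int.natAbs_of_nonneg h]
    rw [← this, Int.cast_natCast, one_mul]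
  · have : ((P.twoL.natAbs : ℤ) : ℝ) = -P.twoL := by
      rw [Int.ofNat_natAbs_of_nonpos (by omega)]; simp
    rw [show (P.twoL : ℝ) = -((P.twoL.natAbs : ℤ) : ℝ) by rw [this]; ring, Int.cast_natCast]
    ring

end Params

/-! ### Ladder operators in the direction of a vector -/

section Ladder

variable {A : Type*} [Ring A] [Algebra ℂ A] (s : Fin 3 → A) (n : Fin 3 → ℂ)

/-- The component of the spin `s` along `n`. -/
def spinAlong : A := ∑ k, n k • s k

/-- The components of the cross product `s × n`. -/
def spinCross (k : Fin 3) : A := n (k + 2) • s (k + 1) - n (k + 1) • s (k + 2)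

/-- The components of the spin orthogonal to `n`. -/
def spinPerp (k : Fin 3) : A := s k - n k • spinAlong s n

/-- The raising (`e = 1`) and lowering (`e = -1`) operators for the spin along `n`. -/
def ladder (e : ℂ) (k : Fin 3) : A := spinPerp s n k + (Complex.I * e) • spinCross s n k

/-- Starting the sum at `k` lets the vector identities be proved for a general component through
cyclic symmetry. -/
theorem sum_cyclic {M : Type*} [AddCommMonoid M] (k : Fin 3) (f : Fin 3 → M) :
    ∑ j, f j = f k + f (k + 1) + f (k + 2) := by
  rw [Fin.sum_univ_three]
  fin_cases k
  · rfl
  · change _ = f 1 + f 2 + f 0; abel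
  · change _ = f 2 + f 0 + f 1; abel

theorem fin_three_add_one_add_one (k : Fin 3) : k + 1 + 1 = k + 2 := by fin_cases k <;> rfl
theorem fin_three_add_one_add_two (k : Fin 3) : k + 1 + 2 = k := by fin_cases k <;> rfl
theorem fin_three_add_two_add_one (k : Fin 3) : k + 2 + 1 = k := by fin_cases k <;> rfl
theorem fin_three_add_two_add_two (k : Fin 3) : k + 2 + 2 = k + 1 := by fin_cases k <;> rfl

variable {s n}
variable (hs : ∀ j, s j * s (j + 1) - s (j + 1) * s j = Complex.I • s (j + 2))
include hs

theorem spinAlong_comm (k : Fin 3) : spinAlong s n * s k - s k * spinAlong s n =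
    Complex.I • spinCross s n k := by
  have h1 := hs k
  have h2 := hs (k + 2)
  rw [fin_three_add_two_add_one, fin_three_add_two_add_two] at h2
  simp only [spinAlong, spinCross, sum_cyclic k, add_mul, mul_add, smul_mul_assoc, mul_smul_comm]
  linear_combination (norm := module) (-n (k + 1)) • h1 + n (k + 2) • h2

theorem sum_mul_spinCross : ∑ k, s k * spinCross s n k = Complex.I • spinAlong s n := by
  have h0 := hs 0
  have h1 := hs 1
  have h2 := hs 2
  simp only [spinAlong, spinCross, Fin.sum_univ_three, mul_sub, mul_smul_comm]
  simp only [Fin.isValue, zero_add, show (1 + 1 : Fin 3) = 2 from rfl,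
    show (1 + 2 : Fin 3) = 0 from rfl, show (2 + 1 : Fin 3) = 0 from rfl,
    show (2 + 2 : Fin 3) = 1 from rfl] at h0 h1 h2 ⊢
  linear_combination (norm := module) n 2 • h0 + n 0 • h1 + n 1 • h2

theorem sum_spinCross_mul : ∑ k, spinCross s n k * s k = -(Complex.I • spinAlong s n) := by
  have h0 := hs 0
  have h1 := hs 1
  have h2 := hs 2
  simp only [spinAlong, spinCross, Fin.sum_univ_three, sub_mul, smul_mul_assoc]
  simp only [Fin.isValue, zero_add, show (1 + 1 : Fin 3) = 2 from rfl,
    show (1 + 2 : Fin 3) = 0 from rfl, show (2 + 1 : Fin 3) = 0 from rfl,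
    show (2 + 2 : Fin 3) = 1 from rfl] at h0 h1 h2 ⊢
  linear_combination (norm := module) (-n 2) • h0 - n 0 • h1 - n 1 • h2

omit hs in
theorem sum_smul_spinCross : ∑ k, n k • spinCross s n k = 0 := by
  simp only [spinCross, Fin.sum_univ_three, Fin.isValue, zero_add,
    show (1 + 1 : Fin 3) = 2 from rfl, show (1 + 2 : Fin 3) = 0 from rfl,
    show (2 + 1 : Fin 3) = 0 from rfl, show (2 + 2 : Fin 3) = 1 from rfl]
  module

variable (hn : ∑ k, n k ^ 2 = 1)
include hn

/-- The commutator with `s · n` is `i` times an infinitesimal rotation about `n`; together with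
`spinAlong_comm` it exchanges the orthogonal part of the spin and its cross product with `n`. -/
theorem spinAlong_comm_cross (k : Fin 3) :
    spinAlong s n * spinCross s n k - spinCross s n k * spinAlong s n =
      -(Complex.I • spinPerp s n k) := by
  have h1 := spinAlong_comm (n := n) hs (k + 1)
  have h2 := spinAlong_comm (n := n) hs (k + 2)
  rw [sum_cyclic k] at hn
  -- The unit length of `n` is spent here, to make both sides quadratic in `n`.
  have hk : s k = (n k ^ 2 + n (k + 1) ^ 2 + n (k + 2) ^ 2) • s k := by rw [hn, one_smul]
  have e : spinPerp s n k = (n (k + 1) ^ 2 + n (k + 2) ^ 2) • s k -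
      n k • (n (k + 1) • s (k + 1) + n (k + 2) • s (k + 2)) := by
    conv_lhs => rw [spinPerp, hk, spinAlong, sum_cyclic k]
    module
  rw [e]
  set B := spinAlong s n
  simp only [spinCross, mul_sub, sub_mul, mul_smul_comm, smul_mul_assoc, fin_three_add_one_add_one,
    fin_three_add_one_add_two, fin_three_add_two_add_one, fin_three_add_two_add_two] at h1 h2 ⊢
  linear_combination (norm := module) n (k + 2) • h1 - n (k + 1) • h2

/-- On the pair (orthogonal part, cross product) the commutator with `s · n` is `(p, c) ↦ (i c, -i
p)`; the combinations `p ± i c` are its eigenvectors, with eigenvalues `±1`. -/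
theorem spinAlong_mul_ladder {e : ℂ} (he : e * e = 1) (k : Fin 3) :
    spinAlong s n * ladder s n e k = ladder s n e k * spinAlong s n + e • ladder s n e k := by
  have h1 := spinAlong_comm (n := n) hs k
  have h2 := spinAlong_comm_cross hs hn k
  simp only [ladder, spinPerp, mul_add, mul_sub, add_mul, sub_mul, mul_smul_comm,
    smul_mul_assoc] at *
  have h3 : Complex.I * Complex.I = -1 := Complex.I_mul_I
  have h4 : e • (s k - n k • spinAlong s n + (Complex.I * e) • spinCross s n k) =
      e • (s k - n k • spinAlong s n) + (e * e) • Complex.I • spinCross s n k := by module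
  have h5 : e • (s k - n k • spinAlong s n) =
      -(Complex.I * Complex.I) • e • (s k - n k • spinAlong s n) := by rw [h3]; simp
  rw [h4, h5, he]
  linear_combination (norm := module) h1 + (Complex.I * e) • h2

omit hs in
theorem sum_spinPerp_sq : ∑ k, spinPerp s n k * spinPerp s n k =
    ∑ k, s k * s k - spinAlong s n * spinAlong s n := by
  set B := spinAlong s n with hB
  have h1 : ∑ k, n k • (s k * B) = B * B := by
    change _ = (∑ k, n k • s k) * B
    simp only [Finset.sum_mul, smul_mul_assoc]
  have h2 : ∑ k, n k • (B * s k) = B * B := by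
    change _ = B * ∑ k, n k • s k
    simp only [Finset.mul_sum, mul_smul_comm]
  have h3 : ∑ k, (n k ^ 2) • (B * B) = B * B := by rw [← Finset.sum_smul, hn, one_smul]
  have : ∀ k, spinPerp s n k * spinPerp s n k =
      s k * s k - n k • (s k * B) - n k • (B * s k) + (n k ^ 2) • (B * B) := by
    intro k
    simp only [spinPerp, ← hB, mul_sub, sub_mul, mul_smul_comm, smul_mul_assoc]
    module
  simp only [this, Finset.sum_add_distrib, Finset.sum_sub_distrib, h1, h2, h3]
  abel

omit hs in
theorem sum_spinCross_sq : ∑ k, spinCross s n k * spinCross s n k =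
    ∑ k, s k * s k - spinAlong s n * spinAlong s n := by
  have h : ∑ k, s k * s k = (∑ k, n k ^ 2) • ∑ k, s k * s k := by rw [hn, one_smul]
  rw [h]
  simp only [spinAlong, spinCross, Fin.sum_univ_three, Fin.isValue, zero_add,
    show (1 + 1 : Fin 3) = 2 from rfl, show (1 + 2 : Fin 3) = 0 from rfl,
    show (2 + 1 : Fin 3) = 0 from rfl, show (2 + 2 : Fin 3) = 1 from rfl, mul_sub, sub_mul, mul_add,
    add_mul, mul_smul_comm, smul_mul_assoc]
  module

/-- The coordinate-free form of `J₋ J₊ = J² - J_z² - J_z`. The factor two appears because the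
orthogonal part and the cross product contribute equally. -/
theorem sum_ladder_mul_ladder {e : ℂ} (he : e * e = 1) :
    ∑ k, ladder s n (-e) k * ladder s n e k =
      (2 : ℂ) • (∑ k, s k * s k - spinAlong s n * spinAlong s n - e • spinAlong s n) := by
  have h1 := sum_spinPerp_sq (s := s) hn
  have h2 := sum_spinCross_sq (s := s) hn
  have h3 := sum_mul_spinCross (n := n) hs
  have h4 := sum_spinCross_mul (n := n) hs
  have h5 := sum_smul_spinCross (s := s) (n := n)
  set B := spinAlong s n with hB
  have h6 : ∑ k, spinPerp s n k * spinCross s n k = Complex.I • B := by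
    simp only [spinPerp, ← hB, sub_mul, smul_mul_assoc, Finset.sum_sub_distrib, h3]
    simp only [← mul_smul_comm, ← Finset.mul_sum, h5, mul_zero, sub_zero]
  have h7 : ∑ k, spinCross s n k * spinPerp s n k = -(Complex.I • B) := by
    simp only [spinPerp, ← hB, mul_sub, mul_smul_comm, Finset.sum_sub_distrib, h4]
    simp only [← smul_mul_assoc, ← Finset.sum_mul, h5, zero_mul, sub_zero]
  have : ∀ k, ladder s n (-e) k * ladder s n e k = spinPerp s n k * spinPerp s n k +
      (Complex.I * e) • (spinPerp s n k * spinCross s n k) -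
      (Complex.I * e) • (spinCross s n k * spinPerp s n k) -
      (Complex.I * Complex.I * (e * e)) • (spinCross s n k * spinCross s n k) := by
    intro k
    simp only [ladder, mul_add, add_mul, mul_smul_comm, smul_mul_assoc]
    module
  simp only [this, Finset.sum_add_distrib, Finset.sum_sub_distrib, ← Finset.smul_sum, h1, h2, h6,
    h7, he, Complex.I_mul_I]
  have h8 : (Complex.I * e) • Complex.I • B = -(e • B) := by
    rw [smul_smul, mul_right_comm, Complex.I_mul_I]; module
  rw [smul_neg, h8]
  module

end Ladder

namespace Params
variable (P : Params)

/-! ### The projection onto the fibre -/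

/-- The operator `σ · a / (r ħ)`. -/
def spinDir (a : Fin 3 → ℂ) : P.V →L[ℂ] P.V := spinAlong P.spinOp fun k => a k / P.r

theorem r_ne_zero : (P.r : ℂ) ≠ 0 := by exact_mod_cast P.r_pos.ne'
theorem hbar_ne_zero : (P.hbar : ℂ) ≠ 0 := by exact_mod_cast P.hbar_pos.ne'
theorem ε_ne_zero : (P.ε : ℂ) ≠ 0 := by
  have := P.ε_mul_self
  intro h
  have h' : P.ε = 0 := by exact_mod_cast h
  simp [h'] at this

theorem ε_mul_self_complex : (P.ε : ℂ) * P.ε = 1 := by exact_mod_cast P.ε_mul_self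

theorem σdot_eq (a : Fin 3 → ℂ) : P.σdot a = ((P.r : ℂ) * P.hbar) • P.spinDir a := by
  simp only [σdot, spinDir, spinAlong, σ_eq, Finset.smul_sum, smul_smul]
  refine Finset.sum_congr rfl fun k _ => ?_
  congr 1
  field_simp [P.r_ne_zero]

theorem mem_fibre {a : Fin 3 → ℂ} {v : P.V} : v ∈ P.fibre a ↔ P.spinDir a v = (P.l : ℂ) • v := by
  have h : (P.r : ℂ) * P.hbar ≠ 0 := mul_ne_zero P.r_ne_zero P.hbar_ne_zero
  rw [fibre, LinearMap.mem_ker]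
  simp only [ContinuousLinearMap.coe_coe, sub_apply, σdot_eq,
    smul_apply, ContinuousLinearMap.id_apply]
  rw [sub_eq_zero]
  push_cast
  rw [mul_smul _ (P.l : ℂ), (smul_right_injective P.V h).eq_iff]

/-- The truncated Lagrange interpolation polynomial in an operator `B`, which vanishes at the
weights `l - ε k` for `1 ≤ k ≤ N` and takes the value one at `l`. -/
def lagrange (B : P.V →L[ℂ] P.V) : ℕ → (P.V →L[ℂ] P.V)
  | 0 => 1
  | k + 1 => ((P.ε : ℂ) * (k + 1))⁻¹ •
      ((B - ((P.l : ℂ) - P.ε * (k + 1)) • 1) * lagrange B k)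

theorem lagrange_comm (B : P.V →L[ℂ] P.V) (N : ℕ) : Commute B (P.lagrange B N) := by
  induction N with
  | zero => exact Commute.one_right B
  | succ k ih =>
    rw [lagrange]
    refine Commute.smul_right (Commute.mul_right ?_ ih) _
    exact (Commute.refl B).sub_right ((Commute.one_right B).smul_right _)

theorem lagrange_star (B : P.V →L[ℂ] P.V) (N : ℕ) :
    star (P.lagrange B N) = P.lagrange (star B) N := by
  induction N with
  | zero => exact star_one _
  | succ k ih =>
    have h0 : star (B - ((P.l : ℂ) - P.ε * (k + 1)) • (1 : P.V →L[ℂ] P.V)) =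
        star B - ((P.l : ℂ) - P.ε * (k + 1)) • 1 := by
      have h1 : star (1 : P.V →L[ℂ] P.V) = 1 := star_one _
      rw [ContinuousLinearMap.star_eq_adjoint] at h1 ⊢
      rw [map_sub, map_smulₛₗ, h1, ← ContinuousLinearMap.star_eq_adjoint]
      simp [Complex.conj_ofReal]
    rw [lagrange, star_smul, star_mul, ih, h0, lagrange]
    have h : Commute (star B - ((P.l : ℂ) - P.ε * (k + 1)) • 1) (P.lagrange (star B) k) :=
      (P.lagrange_comm (star B) k).sub_left ((Commute.one_left _).smul_left _)
    rw [h.eq]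
    simp [Complex.conj_ofReal]

theorem lagrange_apply {B : P.V →L[ℂ] P.V} {μ : ℂ} {w : P.V} (h : B w = μ • w) (N : ℕ) :
    P.lagrange B N w =
      (∏ k ∈ Finset.range N, ((P.ε : ℂ) * (k + 1))⁻¹ * (μ - (P.l - P.ε * (k + 1)))) • w := by
  induction N with
  | zero => simp [lagrange]
  | succ k ih =>
    rw [lagrange, Finset.prod_range_succ]
    simp only [smul_apply, mul_apply_eq_comp, ih, map_smul,
      sub_apply, one_apply_eq_self, h]
    rw [← sub_smul, smul_smul, smul_smul]
    congr 1
    ring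

theorem lagrange_apply_of_fix {B : P.V →L[ℂ] P.V} {w : P.V} (h : B w = (P.l : ℂ) • w) (N : ℕ) :
    P.lagrange B N w = w := by
  rw [P.lagrange_apply h, Finset.prod_eq_one, one_smul]
  intro k _
  have h1 := P.ε_ne_zero
  have h2 : (k : ℂ) + 1 ≠ 0 := Nat.cast_add_one_ne_zero k
  rw [sub_sub_cancel]
  exact inv_mul_cancel₀ (mul_ne_zero h1 h2)

/-- The projection onto the fibre over `a`, as a polynomial in `a`. -/
def fibreProj (a : Fin 3 → ℂ) : P.V →L[ℂ] P.V := P.lagrange (P.spinDir a) P.spin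

/-- Each Lagrange factor is one on the eigenvalue `l`, at any complex `a`. That the range lies in
the fibre is proved over the real sphere only, and suffices. -/
theorem fibreProj_of_mem {a : Fin 3 → ℂ} {v : P.V} (hv : v ∈ P.fibre a) :
    P.fibreProj a v = v := P.lagrange_apply_of_fix (P.mem_fibre.1 hv) _

/-! ### Weights over a point of the real sphere. -/

variable (x : P.Sphere)

theorem sum_toC_sq : ∑ k, (P.toC x k / P.r) ^ 2 = 1 := by
  have h : ‖(x : E3)‖ ^ 2 = P.r ^ 2 := by simp
  rw [EuclideanSpace.norm_sq_eq] at h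
  have h2 : ∑ k, (P.toC x k) ^ 2 = (P.r : ℂ) ^ 2 := by
    simp only [toC]
    have : ∑ k, ((x : E3) k) ^ 2 = P.r ^ 2 := by simpa using h
    exact_mod_cast this
  simp only [div_pow]
  rw [← Finset.sum_div, h2, div_self (pow_ne_zero 2 P.r_ne_zero)]

theorem toC_mem_sphereC : P.toC x ∈ P.sphereC := by
  have h := P.sum_toC_sq x
  simp only [div_pow] at h
  rw [← Finset.sum_div, div_eq_one_iff_eq (pow_ne_zero 2 P.r_ne_zero)] at h
  exact h

theorem star_toC (k : Fin 3) : (starRingEnd ℂ) (P.toC x k / P.r) = P.toC x k / P.r := by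
  simp [toC]

theorem star_toC_eq : star (P.toC x) = P.toC x := by
  ext1 k
  exact Complex.conj_ofReal _

omit x in
theorem star_spinDir (a : Fin 3 → ℂ) : star (P.spinDir a) = P.spinDir (star a) := by
  have h := P.spinOp_star
  simp only [ContinuousLinearMap.star_eq_adjoint] at h ⊢
  simp [spinDir, spinAlong, map_sum, map_smulₛₗ, h]

theorem spinDir_star : star (P.spinDir (P.toC x)) = P.spinDir (P.toC x) := by
  rw [star_spinDir, star_toC_eq]

/-- The ladder operators at a point of the sphere. -/
def sphereLadder (e : ℂ) (k : Fin 3) : P.V →L[ℂ] P.V :=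
  ladder P.spinOp (fun k => P.toC x k / P.r) e k

/-- At a real point the spin components are self-adjoint, so the adjoint only conjugates the
coefficient `i e`. -/
theorem sphereLadder_star (e : ℝ) (k : Fin 3) :
    star (P.sphereLadder x e k) = P.sphereLadder x (-e) k := by
  have h := P.spinDir_star x
  have h' := P.spinOp_star
  rw [spinDir] at h
  simp only [ContinuousLinearMap.star_eq_adjoint] at h h' ⊢
  simp only [sphereLadder, ladder, spinPerp, spinCross, map_add, map_sub, map_smulₛₗ, h', h,
    star_toC, map_mul, Complex.conj_I, Complex.conj_ofReal]
  simp

theorem spinDir_sphereLadder {e : ℂ} (he : e * e = 1) (k : Fin 3) {μ : ℂ} {w : P.V}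
    (h : P.spinDir (P.toC x) w = μ • w) :
    P.spinDir (P.toC x) (P.sphereLadder x e k w) = (μ + e) • P.sphereLadder x e k w := by
  have := spinAlong_mul_ladder P.spinOp_comm (P.sum_toC_sq x) he k
  have h2 := congrArg (fun T : P.V →L[ℂ] P.V => T w) this
  simp only [mul_apply_eq_comp, add_apply,
    smul_apply] at h2
  change P.spinDir (P.toC x) (P.sphereLadder x e k w) = P.sphereLadder x e k
    (P.spinDir (P.toC x) w) + e • P.sphereLadder x e k w at h2
  rw [h2, h, map_smul, add_smul]

theorem sum_norm_sphereLadder {e μ : ℝ} (he : e * e = 1) {w : P.V}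
    (h : P.spinDir (P.toC x) w = (μ : ℂ) • w) :
    ∑ k, ‖P.sphereLadder x e k w‖ ^ 2 =
      2 * ((P.spin : ℝ) / 2 * (P.spin / 2 + 1) - μ * μ - e * μ) * ‖w‖ ^ 2 := by
  have he' : (e : ℂ) * e = 1 := by exact_mod_cast he
  have h1 := sum_ladder_mul_ladder P.spinOp_comm (P.sum_toC_sq x) he'
  rw [P.spinOp_casimir] at h1
  change ∑ k, P.sphereLadder x (-e) k * P.sphereLadder x e k = (2 : ℂ) •
    (_ - P.spinDir (P.toC x) * P.spinDir (P.toC x) - (e : ℂ) • P.spinDir (P.toC x)) at h1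
  have h2 := congrArg (fun T : P.V →L[ℂ] P.V => ⟪w, T w⟫_ℂ) h1
  simp only [sum_apply, mul_apply_eq_comp, inner_sum] at h2
  have h3 : ∀ k, ⟪w, P.sphereLadder x (-e) k (P.sphereLadder x e k w)⟫_ℂ =
      ((‖P.sphereLadder x e k w‖ ^ 2 : ℝ) : ℂ) := by
    intro k
    rw [← sphereLadder_star, ContinuousLinearMap.star_eq_adjoint,
      ContinuousLinearMap.adjoint_inner_right, inner_self_eq_norm_sq_to_K]
    push_cast; rfl
  simp only [h3, smul_apply, sub_apply,
    mul_apply_eq_comp, one_apply_eq_self, h, map_smul, inner_smul_right,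
    inner_sub_right, inner_self_eq_norm_sq_to_K] at h2
  have h4 : ((‖w‖ : ℝ) : ℂ) = (RCLike.ofReal ‖w‖ : ℂ) := rfl
  rw [← h4] at h2
  have h5 : ((∑ k, ‖P.sphereLadder x e k w‖ ^ 2 : ℝ) : ℂ) =
      ((2 * ((P.spin : ℝ) / 2 * (P.spin / 2 + 1) - μ * μ - e * μ) * ‖w‖ ^ 2 : ℝ) : ℂ) := by
    push_cast at h2 ⊢
    rw [h2]; ring
  exact_mod_cast h5

theorem casimir_eq : (P.spin : ℝ) / 2 * (P.spin / 2 + 1) = P.l * (P.l + P.ε) := by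
  rw [l_eq]
  have := P.ε_mul_self
  linear_combination (-(P.spin : ℝ) / 2 * (P.spin / 2) - P.spin / 2) * this

/-- With `S = |l|`, the norms of the raised and the lowered vector are nonnegative, so `μ² ± μ ≤ S
(S + 1)`, and this forces `|μ| ≤ S`. -/
theorem weight_bound {μ : ℝ} {w : P.V} (hw : w ≠ 0)
    (h : P.spinDir (P.toC x) w = (μ : ℂ) • w) : |μ| ≤ (P.spin : ℝ) / 2 := by
  have key : ∀ e : ℝ, e * e = 1 →
      0 ≤ (P.spin : ℝ) / 2 * (P.spin / 2 + 1) - μ * μ - e * μ := by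
    intro e he
    have h1 := P.sum_norm_sphereLadder x he h
    have h2 : 0 ≤ ∑ k, ‖P.sphereLadder x e k w‖ ^ 2 := by positivity
    rw [h1] at h2
    have h3 : 0 < ‖w‖ ^ 2 := by positivity
    by_contra hneg
    push Not at hneg
    nlinarith
  have h1 := key 1 (by norm_num)
  have h2 := key (-1) (by norm_num)
  have h0 : (0 : ℝ) ≤ P.spin := by positivity
  rw [abs_le]
  constructor <;> nlinarith

/-- The weight `l` is extreme in the direction `ε`: the norm identity for the ladder vectors has
right side zero there. -/
theorem sphereLadder_of_mem_fibre {w : P.V} (hw : w ∈ P.fibre (P.toC x)) (k : Fin 3) :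
    P.sphereLadder x P.ε k w = 0 := by
  have h := P.sum_norm_sphereLadder x P.ε_mul_self (P.mem_fibre.1 hw)
  rw [casimir_eq, show P.l * (P.l + P.ε) - P.l * P.l - P.ε * P.l = 0 by ring, mul_zero, zero_mul,
    Finset.sum_eq_zero_iff_of_nonneg (fun _ _ => by positivity)] at h
  simpa using h k (Finset.mem_univ k)

/-- Climbing with the ladder of sign `ε` must stop, by `weight_bound`, and it can only stop at `l`;
so `μ` is an integer number of steps away from `l`. -/
theorem exists_weight {μ : ℝ} {w : P.V} (hw : w ≠ 0)
    (h : P.spinDir (P.toC x) w = (μ : ℂ) • w) :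
    ∃ k : ℕ, k ≤ P.spin ∧ μ = P.l - P.ε * k := by
  have he := P.ε_mul_self
  -- `N` is a strict upper bound for the number of steps still to climb.
  have main : ∀ N : ℕ, ∀ (μ : ℝ) (w : P.V), w ≠ 0 → P.spinDir (P.toC x) w = (μ : ℂ) • w →
      P.ε * (P.l - μ) < N → ∃ k : ℕ, P.ε * (P.l - μ) = k := by
    intro N
    induction N with
    | zero =>
      intro μ w hw h hlt
      exfalso
      have hb := P.weight_bound x hw h
      have h1 : P.ε * μ ≤ |μ| := by
        have : |P.ε * μ| = |μ| := by
          rw [abs_mul]; unfold ε; split_ifs <;> simp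
        rw [← this]; exact le_abs_self _
      have h2 : P.ε * P.l = P.spin / 2 := by rw [l_eq, ← mul_assoc, he, one_mul]
      rw [mul_sub, h2] at hlt
      simp at hlt
      linarith
    | succ N ih =>
      intro μ w hw h hlt
      by_cases h0 : ∀ k, P.sphereLadder x P.ε k w = 0
      · have h1 := P.sum_norm_sphereLadder x he h
        simp only [h0, norm_zero, Finset.sum_const, casimir_eq] at h1
        have h3 : ‖w‖ ^ 2 ≠ 0 := by positivity
        have h4 : (P.l - μ) * (P.l + μ + P.ε) = 0 := by
          have : 2 * (P.l * (P.l + P.ε) - μ * μ - P.ε * μ) = 0 := by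
            rcases mul_eq_zero.1 (h1.symm.trans (by simp)) with h | h
            · exact h
            · exact absurd h h3
          linarith
        rcases mul_eq_zero.1 h4 with h5 | h5
        · exact ⟨0, by rw [h5]; simp⟩
        -- The second root `μ = -(l + ε)` of the vanishing condition lies one beyond the largest
        -- weight.
        · exfalso
          have hb := P.weight_bound x hw h
          have h6 : μ = -P.ε * (P.spin / 2 + 1) := by
            have := P.l_eq; linear_combination h5 - this
          have h7 : |μ| = P.spin / 2 + 1 := by
            rw [h6, abs_mul, abs_neg, abs_of_nonneg (by positivity : (0:ℝ) ≤ P.spin / 2 + 1)]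
            unfold ε; split_ifs <;> simp
          linarith
      · push Not at h0
        obtain ⟨j, hj⟩ := h0
        have he' : (P.ε : ℂ) * P.ε = 1 := P.ε_mul_self_complex
        have h1 := P.spinDir_sphereLadder x he' j h
        obtain ⟨k, hk⟩ := ih (μ + P.ε) _ hj (by rw [h1]; push_cast; rfl)
          (by push_cast at hlt; nlinarith)
        exact ⟨k + 1, by push_cast; rw [← hk]; linear_combination he⟩
  obtain ⟨N, hN⟩ := exists_nat_gt (P.ε * (P.l - μ))
  obtain ⟨k, hk⟩ := main N μ w hw h hN
  have hμ : μ = P.l - P.ε * k := by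
    linear_combination (P.l - μ) * he - P.ε * hk
  refine ⟨k, ?_, hμ⟩
  have hb := P.weight_bound x hw h
  have h2 : P.ε * μ = P.spin / 2 - k := by
    rw [hμ, l_eq]; linear_combination ((P.spin : ℝ) / 2 - k) * he
  have h3 : |P.ε * μ| = |μ| := by
    rw [abs_mul]; unfold ε; split_ifs <;> simp
  rw [← h3, h2, abs_le] at hb
  have : (k : ℝ) ≤ P.spin := by linarith [hb.1]
  exact_mod_cast this

/-- Tested on an orthonormal eigenbasis of the self-adjoint operator `σ · x`: every weight `l - ε k`
with `1 ≤ k ≤ 2|l|` is a root of the polynomial, and for `k = 0` the eigenvalue is already `l`. -/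
theorem spinDir_mul_fibreProj :
    P.spinDir (P.toC x) * P.fibreProj (P.toC x) = (P.l : ℂ) • P.fibreProj (P.toC x) := by
  set B := P.spinDir (P.toC x) with hB
  have hsym : (B : P.V →ₗ[ℂ] P.V).IsSymmetric := by
    have : IsSelfAdjoint B := P.spinDir_star x
    exact this.isSymmetric
  ext1 v
  refine congrFun (congrArg DFunLike.coe (?_ : ((B * P.fibreProj (P.toC x) : P.V →L[ℂ] P.V) :
    P.V →ₗ[ℂ] P.V) = (((P.l : ℂ) • P.fibreProj (P.toC x) : P.V →L[ℂ] P.V) : P.V →ₗ[ℂ] P.V))) v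
  refine (hsym.eigenvectorBasis (n := P.spin + 1) (by simp)).toBasis.ext fun i => ?_
  rw [OrthonormalBasis.coe_toBasis]
  set w := hsym.eigenvectorBasis (n := P.spin + 1) (by simp) i with hw
  have hw0 : w ≠ 0 := by
    have : ‖w‖ = 1 := (hsym.eigenvectorBasis (n := P.spin + 1) (by simp)).norm_eq_one i
    intro h; simp [h] at this
  have hBw : B w = ((hsym.eigenvalues (n := P.spin + 1) (by simp) i : ℝ) : ℂ) • w :=
    hsym.apply_eigenvectorBasis (n := P.spin + 1) (by simp) i
  obtain ⟨k, hk, hμ⟩ := P.exists_weight x hw0 hBw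
  have hBw' : B w = ((P.l - P.ε * k : ℝ) : ℂ) • w := by rw [hBw, hμ]
  simp only [ContinuousLinearMap.coe_coe, mul_apply_eq_comp,
    smul_apply]
  rw [fibreProj, ← hB, P.lagrange_apply hBw' P.spin, map_smul, hBw']
  rcases Nat.eq_zero_or_pos k with h0 | h0
  · subst h0
    rw [smul_comm]; simp
  · have hz : ∏ j ∈ Finset.range P.spin, ((P.ε : ℂ) * (j + 1))⁻¹ *
        (((P.l - P.ε * k : ℝ) : ℂ) - (P.l - P.ε * (j + 1))) = 0 := by
      -- The factors are numbered from zero, so the one that vanishes at `l - ε k` has index `k -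
      -- 1`.
      refine Finset.prod_eq_zero (i := k - 1) (Finset.mem_range.2 (by omega)) ?_
      rw [Nat.cast_sub h0]
      push_cast; ring
    rw [hz]; simp

theorem fibreProj_mem (w : P.V) : P.fibreProj (P.toC x) w ∈ P.fibre (P.toC x) := by
  rw [mem_fibre]
  exact congrArg (fun T : P.V →L[ℂ] P.V => T w) (P.spinDir_mul_fibreProj x)

omit x in
theorem star_fibreProj (a : Fin 3 → ℂ) : star (P.fibreProj a) = P.fibreProj (star a) := by
  rw [fibreProj, lagrange_star, star_spinDir, fibreProj]

theorem fibreProj_star : star (P.fibreProj (P.toC x)) = P.fibreProj (P.toC x) := by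
  rw [star_fibreProj, star_toC_eq]

omit x in
theorem inner_fibreProj (a : Fin 3 → ℂ) (v w : P.V) :
    ⟪P.fibreProj (star a) v, w⟫_ℂ = ⟪v, P.fibreProj a w⟫_ℂ := by
  rw [← star_fibreProj, ContinuousLinearMap.star_eq_adjoint]
  exact ContinuousLinearMap.adjoint_inner_left _ _ _

/-- The adjoint of the fact that the ladder of sign `ε` kills the fibre. To the right of `Π` it
trades `s × n` for `s - l n`, which computes `x × Ĵ` on the lowest level. -/
theorem fibreProj_mul_cross (k : Fin 3) :
    P.fibreProj (P.toC x) * spinCross P.spinOp (fun k => P.toC x k / P.r) k =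
      (-(Complex.I * P.ε)) • (P.fibreProj (P.toC x) * P.spinOp k -
        ((P.l : ℂ) * (P.toC x k / P.r)) • P.fibreProj (P.toC x)) := by
  have h0 : P.sphereLadder x P.ε k * P.fibreProj (P.toC x) = 0 := by
    ext1 w
    exact P.sphereLadder_of_mem_fibre x (P.fibreProj_mem x w) k
  have h1 := congrArg star h0
  rw [star_mul, fibreProj_star, sphereLadder_star, ContinuousLinearMap.star_eq_adjoint,
    map_zero] at h1
  have h2 : P.fibreProj (P.toC x) * P.spinDir (P.toC x) = (P.l : ℂ) • P.fibreProj (P.toC x) := by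
    rw [← P.spinDir_mul_fibreProj x]
    exact (P.lagrange_comm _ _).eq.symm
  simp only [sphereLadder, ladder, spinPerp, mul_add, mul_sub, mul_smul_comm] at h1
  change _ - _ • (P.fibreProj (P.toC x) * P.spinDir (P.toC x)) + _ = 0 at h1
  rw [h2] at h1
  have h3 : Complex.I * P.ε * (Complex.I * P.ε) = -1 := by
    linear_combination (P.ε : ℂ) * P.ε * Complex.I_mul_I - P.ε_mul_self_complex
  set T := P.fibreProj (P.toC x) * spinCross P.spinOp (fun k => P.toC x k / P.r) k with hT
  have h4 : T = -((Complex.I * P.ε * (Complex.I * P.ε)) • T) := by rw [h3]; module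
  rw [h4]
  linear_combination (norm := module) (Complex.I * P.ε) • h1

end Params

namespace Params
variable (P : Params)

/-! ### The fibres over the complex sphere are nonzero -/

/-- The components of the highest-weight vector along a spinor. -/
def spinorPower (z₁ z₂ : ℂ) (i : ℕ) : ℂ :=
  ((Real.sqrt (P.spin.choose i) : ℝ) : ℂ) * z₁ ^ (P.spin - i) * z₂ ^ i

theorem sqrt_mul_choose {S i : ℕ} (hi : i < S) :
    Real.sqrt (((i : ℝ) + 1) * ((S : ℝ) - i)) * Real.sqrt (S.choose (i + 1)) =
      ((S : ℝ) - i) * Real.sqrt (S.choose i) := by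
  have hS : (0 : ℝ) ≤ (S : ℝ) - i := by
    have : (i : ℝ) ≤ S := by exact_mod_cast hi.le
    linarith
  have h := Nat.choose_succ_right_eq S i
  have h' : (S.choose (i + 1) : ℝ) * (i + 1) = S.choose i * (S - i) := by
    have := congrArg (Nat.cast (R := ℝ)) h
    push_cast [Nat.cast_sub hi.le] at this
    exact this
  rw [← Real.sqrt_mul (by positivity)]
  rw [show ((i : ℝ) + 1) * ((S : ℝ) - i) * (S.choose (i + 1)) =
    ((S : ℝ) - i) ^ 2 * S.choose i by linear_combination ((S : ℝ) - i) * h']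
  rw [Real.sqrt_mul (by positivity), Real.sqrt_sq hS]

/-- The vector is the symmetric power of the spinor `(z₁, z₂)`, and raising replaces a factor `z₁`
by `z₂`. The constants `c`, `d` undo the replacement without dividing by a component that may
vanish. -/
theorem raise_spinorPower (z₁ z₂ : ℂ) {c d : ℂ} (h : c * z₂ = d * z₁) (i : Fin (P.spin + 1)) :
    c * ∑ k, P.raise i k * P.spinorPower z₁ z₂ k =
      d * ((P.spin : ℂ) - (i : ℕ)) * P.spinorPower z₁ z₂ i := by
  by_cases hi : (i : ℕ) < P.spin
  · rw [Finset.sum_eq_single ⟨i + 1, by omega⟩]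
    · simp only [raise, if_true, spinorPower]
      have h1 := congrArg (Complex.ofReal) (sqrt_mul_choose hi)
      push_cast at h1
      have h2 : P.spin - (i : ℕ) = P.spin - (i + 1) + 1 := by omega
      rw [h2, pow_succ, pow_succ]
      linear_combination c * z₁ ^ (P.spin - ((i : ℕ) + 1)) * z₂ ^ (i : ℕ) * z₂ * h1 +
        ((P.spin : ℂ) - (i : ℕ)) * ((Real.sqrt (P.spin.choose i) : ℝ) : ℂ) *
        z₁ ^ (P.spin - ((i : ℕ) + 1)) * z₂ ^ (i : ℕ) * h
    · intro b _ hb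
      have : ¬ ((b : ℕ) = i + 1) := fun h => hb (Fin.ext h)
      simp [raise, this]
    · simp
  · have hiS : (i : ℕ) = P.spin := by omega
    rw [Finset.sum_eq_zero, hiS]
    · simp
    · intro b _
      have : ¬ ((b : ℕ) = i + 1) := by omega
      simp [raise, this]

theorem lower_spinorPower (z₁ z₂ : ℂ) {c d : ℂ} (h : c * z₁ = d * z₂) (i : Fin (P.spin + 1)) :
    c * ∑ k, P.raise.conjTranspose i k * P.spinorPower z₁ z₂ k =
      d * (i : ℕ) * P.spinorPower z₁ z₂ i := by
  by_cases hi : 0 < (i : ℕ)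
  · obtain ⟨j, hj⟩ : ∃ j, (i : ℕ) = j + 1 := ⟨i - 1, by omega⟩
    rw [Finset.sum_eq_single ⟨j, by omega⟩]
    · simp only [raise, Matrix.conjTranspose_apply, hj, if_true, spinorPower]
      have hjS : j < P.spin := by omega
      have h1 := sqrt_mul_choose hjS
      have hpos : (0 : ℝ) < (P.spin : ℝ) - j := by
        have : (j : ℝ) < P.spin := by exact_mod_cast hjS
        linarith
      have h3 : Real.sqrt (((j : ℝ) + 1) * ((P.spin : ℝ) - j)) * Real.sqrt (P.spin.choose j) =
          ((j : ℝ) + 1) * Real.sqrt (P.spin.choose (j + 1)) := by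
        have h4 : Real.sqrt (((j : ℝ) + 1) * ((P.spin : ℝ) - j)) *
          Real.sqrt (((j : ℝ) + 1) * ((P.spin : ℝ) - j)) =
            ((j : ℝ) + 1) * ((P.spin : ℝ) - j) := Real.mul_self_sqrt (by positivity)
        have h5 : ((P.spin : ℝ) - j) * (Real.sqrt (((j : ℝ) + 1) * ((P.spin : ℝ) - j)) *
            Real.sqrt (P.spin.choose j)) = ((P.spin : ℝ) - j) *
            (((j : ℝ) + 1) * Real.sqrt (P.spin.choose (j + 1))) := by
          linear_combination -(Real.sqrt (((j : ℝ) + 1) * ((P.spin : ℝ) - j))) * h1 +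
            Real.sqrt (P.spin.choose (j + 1)) * h4
        exact mul_left_cancel₀ hpos.ne' h5
      have h6 := congrArg (Complex.ofReal) h3
      push_cast at h6
      rw [RCLike.star_def, Complex.conj_ofReal]
      have h2 : P.spin - j = P.spin - (j + 1) + 1 := by omega
      rw [h2, pow_succ, pow_succ]
      push_cast
      linear_combination c * z₁ ^ (P.spin - (j + 1)) * z₂ ^ j * z₁ * h6 +
        ((j : ℂ) + 1) * ((Real.sqrt (P.spin.choose (j + 1)) : ℝ) : ℂ) *
        z₁ ^ (P.spin - (j + 1)) * z₂ ^ j * h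
    · intro b _ hb
      have : ¬ ((i : ℕ) = b + 1) := fun h => hb (Fin.ext (by simp; omega))
      simp [raise, this]
    · simp
  · have hiS : (i : ℕ) = 0 := by omega
    rw [Finset.sum_eq_zero, hiS]
    · simp
    · intro b _
      have : ¬ ((i : ℕ) = b + 1) := by omega
      simp [raise, this]

/-- The two equations say that `(z₁, z₂)` is an eigenvector, for the eigenvalue `r`, of the Pauli
combination with coefficients `a`, whose eigenvalues are `±r`. -/
theorem exists_spinor {r : ℂ} (hr : r ≠ 0) {a : Fin 3 → ℂ} (ha : ∑ j, a j ^ 2 = r ^ 2) :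
    ∃ z₁ z₂ : ℂ, (z₁ ≠ 0 ∨ z₂ ≠ 0) ∧ (a 0 - Complex.I * a 1) * z₂ = (r - a 2) * z₁ ∧
      (a 0 + Complex.I * a 1) * z₁ = (r + a 2) * z₂ := by
  rw [Fin.sum_univ_three] at ha
  have hI : Complex.I ^ 2 = -1 := Complex.I_sq
  -- Each row of the matrix gives a formula for the eigenvector. The second formula is used when the
  -- first gives zero; `r ≠ 0` then keeps it nonzero.
  by_cases h : r + a 2 = 0 ∧ a 0 + Complex.I * a 1 = 0
  · refine ⟨a 0 - Complex.I * a 1, r - a 2, Or.inr ?_, by ring, ?_⟩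
    · have : r - a 2 = 2 * r := by linear_combination -h.1
      rw [this]; exact mul_ne_zero two_ne_zero hr
    · rw [h.1, h.2]; ring
  · refine ⟨r + a 2, a 0 + Complex.I * a 1, ?_, ?_, by ring⟩
    · by_contra hc
      push Not at hc
      exact h hc
    · linear_combination ha - a 1 ^ 2 * hI

/-- The symmetric power of a spinor polarised along `ε a` has weight `|l|` along `ε a`, hence weight
`l` along `a`. -/
theorem exists_mem_fibre_ne_zero {a : Fin 3 → ℂ} (ha : a ∈ P.sphereC) :
    ∃ v ∈ P.fibre a, v ≠ 0 := by
  have hε := P.ε_mul_self_complex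
  have ha' : ∑ j, ((P.ε : ℂ) * a j) ^ 2 = (P.r : ℂ) ^ 2 := by
    simp only [mul_pow, ← Finset.mul_sum]
    rw [show ∑ j, a j ^ 2 = (P.r : ℂ) ^ 2 from ha, pow_two (P.ε : ℂ), hε, one_mul]
  obtain ⟨z₁, z₂, hz, h1, h2⟩ := exists_spinor P.r_ne_zero ha'
  have hr := P.r_ne_zero
  refine ⟨WithLp.toLp 2 fun i => P.spinorPower z₁ z₂ i, ?_, ?_⟩
  · rw [mem_fibre]
    ext i
    have e1 := P.raise_spinorPower z₁ z₂ h1 i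
    have e2 := P.lower_spinorPower z₁ z₂ h2 i
    have hs : ∀ j : Fin 3, (P.spinOp j (WithLp.toLp 2 fun i : Fin (P.spin + 1) =>
        P.spinorPower z₁ z₂ i)) i = ∑ k, P.spinMatrix j i k * P.spinorPower z₁ z₂ k :=
      fun j => rfl
    simp only [spinDir, spinAlong, add_apply, smul_apply, Fin.sum_univ_three, PiLp.add_apply,
      PiLp.smul_apply, hs, smul_eq_mul]
    set R := ∑ k, P.raise i k * P.spinorPower z₁ z₂ k with hR
    set R' := ∑ k, P.raise.conjTranspose i k * P.spinorPower z₁ z₂ k with hR'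
    have hI : (1 / (2 * Complex.I) : ℂ) = -(Complex.I / 2) := by
      field_simp; simp
    have s0 : ∑ k, P.spinMatrix 0 i k * P.spinorPower z₁ z₂ k = 1 / 2 * (R + R') := by
      rw [hR, hR', ← Finset.sum_add_distrib, Finset.mul_sum]
      refine Finset.sum_congr rfl fun k _ => ?_
      simp only [spinMatrix_zero, Matrix.smul_apply, Matrix.add_apply, smul_eq_mul]
      ring
    have s1 : ∑ k, P.spinMatrix 1 i k * P.spinorPower z₁ z₂ k = -(Complex.I / 2) * (R - R') := by
      rw [hR, hR', ← Finset.sum_sub_distrib, Finset.mul_sum]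
      refine Finset.sum_congr rfl fun k _ => ?_
      simp only [spinMatrix_one, hI, Matrix.smul_apply, Matrix.sub_apply, smul_eq_mul]
      ring
    have s2 : ∑ k, P.spinMatrix 2 i k * P.spinorPower z₁ z₂ k =
        ((P.spin : ℂ) / 2 - (i : ℕ)) * P.spinorPower z₁ z₂ i := by
      rw [Finset.sum_eq_single i]
      · simp [spinMatrix]
      · intro b _ hb
        simp [spinMatrix, Matrix.diagonal_apply_ne' _ hb]
      · simp
    rw [s0, s1, s2]
    have hl : (P.l : ℂ) = P.ε * (P.spin / 2) := by
      rw [l_eq]; push_cast; ring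
    rw [hl]
    field_simp
    linear_combination (P.ε : ℂ) * e1 + (P.ε : ℂ) * e2 -
      (a 0 * (R + R') - Complex.I * a 1 * (R - R') +
        a 2 * (P.spin - 2 * (i : ℕ)) * P.spinorPower z₁ z₂ i) * hε
  · intro h0
    have hv : ∀ i : Fin (P.spin + 1), P.spinorPower z₁ z₂ i = 0 := fun i =>
      congrFun (congrArg WithLp.ofLp h0) i
    rcases hz with hz | hz
    · have := hv 0
      simp [spinorPower, hz] at this
    · have := hv (Fin.last _)
      simp [spinorPower, hz] at this

end Params

namespace Params
variable (P : Params)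

/-! ### Angular momentum on entire functions -/

/-- The functions on `ℂ³` with values in the spin space. -/
abbrev CFun : Type := (Fin 3 → ℂ) → P.V

variable {P}

/-- The complex partial derivative. -/
def cpartial (i : Fin 3) (F : P.CFun) : P.CFun := fun a => fderiv ℂ F a (Pi.single i 1)

/-- The angular momentum operator on functions on `ℂ³`. -/
def cangMom (j : Fin 3) (F : P.CFun) : P.CFun := fun a =>
  (-(Complex.I * (P.hbar : ℂ))) •
    (a (j + 1) • cpartial (j + 2) F a - a (j + 2) • cpartial (j + 1) F a) + P.σ j (F a)

/-- The square of the angular momentum on functions on `ℂ³`. -/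
def cangMomSq (F : P.CFun) : P.CFun := fun a => ∑ j, cangMom j (cangMom j F) a

/-- The component of `i (x × Ĵ)` on functions on `ℂ³`. -/
def crossMom (k : Fin 3) (F : P.CFun) : P.CFun := fun a =>
  Complex.I • (a (k + 1) • cangMom (k + 2) F a - a (k + 2) • cangMom (k + 1) F a)

variable (P)

/-- Multiplication by a coordinate on functions on `ℂ³`. -/
def cmul (k : Fin 3) : P.CFun →ₗ[ℂ] P.CFun where
  toFun F := fun a => a k • F a
  map_add' F G := by ext1 a; exact smul_add _ _ _
  map_smul' c F := by ext1 a; exact smul_comm (a k) c (F a)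

@[simp] theorem cmul_apply (k : Fin 3) (F : P.CFun) (a : Fin 3 → ℂ) :
    P.cmul k F a = a k • F a := rfl

variable {P}

theorem contDiff_coord (k : Fin 3) : ContDiff ℂ ∞ fun a : Fin 3 → ℂ => a k := by fun_prop

theorem _root_.ContDiff.cmul {F : P.CFun} (hF : ContDiff ℂ ∞ F) (k : Fin 3) :
    ContDiff ℂ ∞ (P.cmul k F) := (contDiff_coord k).smul hF

theorem _root_.ContDiff.cpartial {F : P.CFun} (hF : ContDiff ℂ ∞ F) (i : Fin 3) :
    ContDiff ℂ ∞ (cpartial i F) :=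
  (hF.fderiv_right (m := ∞) le_rfl).clm_apply contDiff_const

theorem _root_.ContDiff.cangMom {F : P.CFun} (hF : ContDiff ℂ ∞ F) (j : Fin 3) :
    ContDiff ℂ ∞ (cangMom j F) :=
  ((((contDiff_coord _).smul (hF.cpartial _)).sub
    ((contDiff_coord _).smul (hF.cpartial _))).const_smul _).add
      ((P.σ j).contDiff.comp hF)

theorem _root_.ContDiff.csmul {F : P.CFun} (hF : ContDiff ℂ ∞ F) (c : ℂ) :
    ContDiff ℂ ∞ (c • F) := hF.const_smul c

theorem _root_.ContDiff.cadd {F G : P.CFun} (hF : ContDiff ℂ ∞ F) (hG : ContDiff ℂ ∞ G) :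
    ContDiff ℂ ∞ (F + G) := hF.add hG

theorem _root_.ContDiff.cdiffAt {F : P.CFun} (hF : ContDiff ℂ ∞ F) (a : Fin 3 → ℂ) :
    DifferentiableAt ℂ F a := hF.differentiable (by simp) a

theorem cpartial_add {F G : P.CFun} (hF : ContDiff ℂ ∞ F) (hG : ContDiff ℂ ∞ G) (i : Fin 3) :
    cpartial i (F + G) = cpartial i F + cpartial i G := by
  ext1 a
  simp [cpartial, fderiv_add (hF.cdiffAt a) (hG.cdiffAt a)]

theorem cpartial_smul (c : ℂ) {F : P.CFun} (hF : ContDiff ℂ ∞ F) (i : Fin 3) :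
    cpartial i (c • F) = c • cpartial i F := by
  ext1 a
  simp [cpartial, fderiv_const_smul (hF.cdiffAt a)]

theorem cangMom_add {F G : P.CFun} (hF : ContDiff ℂ ∞ F) (hG : ContDiff ℂ ∞ G) (j : Fin 3) :
    cangMom j (F + G) = cangMom j F + cangMom j G := by
  ext1 a
  simp only [cangMom, cpartial_add hF hG, Pi.add_apply, map_add]
  module

theorem cangMom_smul (c : ℂ) {F : P.CFun} (hF : ContDiff ℂ ∞ F) (j : Fin 3) :
    cangMom j (c • F) = c • cangMom j F := by
  ext1 a
  simp only [cangMom, cpartial_smul c hF, Pi.smul_apply, map_smul]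
  module

theorem cpartial_cmul {F : P.CFun} (hF : ContDiff ℂ ∞ F) (i k : Fin 3) (a : Fin 3 → ℂ) :
    cpartial i (P.cmul k F) a =
      a k • cpartial i F a + (Pi.single i (1 : ℂ) : Fin 3 → ℂ) k • F a := by
  have h1 : HasFDerivAt (fun a : Fin 3 → ℂ => a k)
      (ContinuousLinearMap.proj (R := ℂ) (φ := fun _ : Fin 3 => ℂ) k) a :=
    (ContinuousLinearMap.proj (R := ℂ) (φ := fun _ : Fin 3 => ℂ) k).hasFDerivAt
  have h2 := h1.smul (hF.cdiffAt a).hasFDerivAt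
  have h3 : fderiv ℂ (P.cmul k F) a = _ := h2.fderiv
  rw [cpartial, h3]
  simp [cpartial]

theorem cangMom_cmul_self {F : P.CFun} (hF : ContDiff ℂ ∞ F) (j : Fin 3) :
    cangMom j (P.cmul j F) = P.cmul j (cangMom j F) := by
  have e1 : (Pi.single (j + 1) (1 : ℂ) : Fin 3 → ℂ) j = 0 := by fin_cases j <;> simp
  have e2 : (Pi.single (j + 2) (1 : ℂ) : Fin 3 → ℂ) j = 0 := by fin_cases j <;> simp
  ext1 a
  simp only [cangMom, cpartial_cmul hF, cmul_apply, e1, e2, map_smul]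
  module

theorem cangMom_cmul_next {F : P.CFun} (hF : ContDiff ℂ ∞ F) (j : Fin 3) :
    cangMom j (P.cmul (j + 1) F) = P.cmul (j + 1) (cangMom j F) +
      (Complex.I * P.hbar) • P.cmul (j + 2) F := by
  have e1 : (Pi.single (j + 1) (1 : ℂ) : Fin 3 → ℂ) (j + 1) = 1 := by simp
  have e2 : (Pi.single (j + 2) (1 : ℂ) : Fin 3 → ℂ) (j + 1) = 0 := by
    fin_cases j <;> simp
  ext1 a
  simp only [cangMom, cpartial_cmul hF, cmul_apply, e1, e2, map_smul, Pi.add_apply, Pi.smul_apply]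
  module

theorem cangMom_cmul_prev {F : P.CFun} (hF : ContDiff ℂ ∞ F) (j : Fin 3) :
    cangMom j (P.cmul (j + 2) F) = P.cmul (j + 2) (cangMom j F) -
      (Complex.I * P.hbar) • P.cmul (j + 1) F := by
  have e1 : (Pi.single (j + 2) (1 : ℂ) : Fin 3 → ℂ) (j + 2) = 1 := by simp
  have e2 : (Pi.single (j + 1) (1 : ℂ) : Fin 3 → ℂ) (j + 2) = 0 := by
    fin_cases j <;> simp
  ext1 a
  simp only [cangMom, cpartial_cmul hF, cmul_apply, e1, e2, map_smul, Pi.sub_apply, Pi.smul_apply]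
  module

theorem cangMomSq_add {F G : P.CFun} (hF : ContDiff ℂ ∞ F) (hG : ContDiff ℂ ∞ G) :
    cangMomSq (F + G) = cangMomSq F + cangMomSq G := by
  ext1 a
  simp only [cangMomSq, Pi.add_apply, ← Finset.sum_add_distrib]
  refine Finset.sum_congr rfl fun j _ => ?_
  rw [cangMom_add hF hG, cangMom_add (hF.cangMom j) (hG.cangMom j), Pi.add_apply]

theorem crossMom_add {F G : P.CFun} (hF : ContDiff ℂ ∞ F) (hG : ContDiff ℂ ∞ G) (k : Fin 3) :
    crossMom k (F + G) = crossMom k F + crossMom k G := by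
  ext1 a
  simp only [crossMom, cangMom_add hF hG, Pi.add_apply]
  module

/-- Commuting `x_k` through `Ĵ_j²` for the two axes `j ≠ k` leaves a first-order term, counted
twice, and a double commutator `ħ² x_k` from each axis. -/
theorem cangMomSq_cmul {F : P.CFun} (hF : ContDiff ℂ ∞ F) (k : Fin 3) :
    cangMomSq (P.cmul k F) = P.cmul k (cangMomSq F) +
      (2 * (P.hbar : ℂ) ^ 2) • P.cmul k F + (2 * (P.hbar : ℂ)) • crossMom k F := by
  have hI : Complex.I * Complex.I = -1 := Complex.I_mul_I
  have h0 : cangMom k (cangMom k (P.cmul k F)) = P.cmul k (cangMom k (cangMom k F)) := by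
    rw [cangMom_cmul_self hF, cangMom_cmul_self (hF.cangMom k)]
  have h1 : cangMom (k + 1) (cangMom (k + 1) (P.cmul k F)) =
      P.cmul k (cangMom (k + 1) (cangMom (k + 1) F)) -
        (2 * (Complex.I * P.hbar)) • P.cmul (k + 2) (cangMom (k + 1) F) +
        ((P.hbar : ℂ) ^ 2) • P.cmul k F := by
    have e1 := cangMom_cmul_prev hF (k + 1)
    have e2 := cangMom_cmul_prev (hF.cangMom (k + 1)) (k + 1)
    have e3 := cangMom_cmul_next hF (k + 1)
    rw [fin_three_add_one_add_two, fin_three_add_one_add_one] at e1 e2 e3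
    rw [e1, sub_eq_add_neg, ← neg_smul, cangMom_add ((hF.cangMom _).cmul _)
      ((hF.cmul _).csmul _), cangMom_smul _ (hF.cmul _), e2, e3, smul_add, smul_smul,
      show -(Complex.I * (P.hbar : ℂ)) * (Complex.I * P.hbar) = (P.hbar : ℂ) ^ 2 by
        linear_combination (-(P.hbar : ℂ) ^ 2) * hI]
    module
  have h2 : cangMom (k + 2) (cangMom (k + 2) (P.cmul k F)) =
      P.cmul k (cangMom (k + 2) (cangMom (k + 2) F)) +
        (2 * (Complex.I * P.hbar)) • P.cmul (k + 1) (cangMom (k + 2) F) +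
        ((P.hbar : ℂ) ^ 2) • P.cmul k F := by
    have e1 := cangMom_cmul_next hF (k + 2)
    have e2 := cangMom_cmul_next (hF.cangMom (k + 2)) (k + 2)
    have e3 := cangMom_cmul_prev hF (k + 2)
    rw [fin_three_add_two_add_one, fin_three_add_two_add_two] at e1 e2 e3
    rw [e1, cangMom_add ((hF.cangMom _).cmul _)
      ((hF.cmul _).csmul _), cangMom_smul _ (hF.cmul _), e2, e3, smul_sub, smul_smul,
      show (Complex.I * (P.hbar : ℂ)) * (Complex.I * P.hbar) = -(P.hbar : ℂ) ^ 2 by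
        linear_combination ((P.hbar : ℂ) ^ 2) * hI]
    module
  ext1 a
  have e0 : ∀ G : P.CFun, cangMomSq G a = cangMom k (cangMom k G) a +
      cangMom (k + 1) (cangMom (k + 1) G) a + cangMom (k + 2) (cangMom (k + 2) G) a :=
    fun G => sum_cyclic k _
  simp only [Pi.add_apply, Pi.smul_apply, cmul_apply, e0, h0, h1, h2, crossMom, Pi.sub_apply]
  module

/-- Multiplication by a coordinate and `i (x × Ĵ)`. -/
theorem crossMom_cmul {F : P.CFun} (hF : ContDiff ℂ ∞ F) (k p : Fin 3) {a : Fin 3 → ℂ}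
    (ha : a ∈ P.sphereC) :
    crossMom k (P.cmul p F) a = a p • crossMom k F a + ((P.hbar : ℂ) * a k * a p) • F a -
      (if p = k then (P.hbar : ℂ) * P.r ^ 2 else 0) • F a := by
  have hI : Complex.I * Complex.I = -1 := Complex.I_mul_I
  have ha' : a k ^ 2 + a (k + 1) ^ 2 + a (k + 2) ^ 2 = (P.r : ℂ) ^ 2 := by
    rw [← sum_cyclic k fun j => a j ^ 2]; exact ha
  have cases : p = k ∨ p = k + 1 ∨ p = k + 2 := by
    fin_cases k <;> fin_cases p <;> decide
  rcases cases with h | h | h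
  -- The sphere equation enters in this case only: it turns `a_{k+1}² + a_{k+2}²` into `r² - a_k²`.
  · subst h
    have e1 := cangMom_cmul_next hF (p + 2)
    have e2 := cangMom_cmul_prev hF (p + 1)
    rw [fin_three_add_two_add_one, fin_three_add_two_add_two] at e1
    rw [fin_three_add_one_add_two, fin_three_add_one_add_one] at e2
    simp only [crossMom, e1, e2, if_true, Pi.add_apply, Pi.sub_apply, Pi.smul_apply, cmul_apply,
      ← ha']
    have : (Complex.I * Complex.I) • ((P.hbar : ℂ) * (a (p + 1) ^ 2 + a (p + 2) ^ 2)) • F a =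
      -((P.hbar : ℂ) * (a (p + 1) ^ 2 + a (p + 2) ^ 2)) • F a := by rw [hI]; module
    linear_combination (norm := module) this
  · have hk : ¬ p = k := by rw [h]; fin_cases k <;> decide
    rw [if_neg hk, h]
    have e1 := cangMom_cmul_prev hF (k + 2)
    have e2 := cangMom_cmul_self hF (k + 1)
    rw [fin_three_add_two_add_one, fin_three_add_two_add_two] at e1
    simp only [crossMom, e1, e2, Pi.sub_apply, Pi.smul_apply, cmul_apply]
    have : (Complex.I * Complex.I) • ((P.hbar : ℂ) * (a k * a (k + 1))) • F a =
      -((P.hbar : ℂ) * (a k * a (k + 1))) • F a := by rw [hI]; module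
    linear_combination (norm := module) -this
  · have hk : ¬ p = k := by rw [h]; fin_cases k <;> decide
    rw [if_neg hk, h]
    have e1 := cangMom_cmul_next hF (k + 1)
    have e2 := cangMom_cmul_self hF (k + 2)
    rw [fin_three_add_one_add_two, fin_three_add_one_add_one] at e1
    simp only [crossMom, e1, e2, Pi.add_apply, Pi.smul_apply, cmul_apply]
    have : (Complex.I * Complex.I) • ((P.hbar : ℂ) * (a k * a (k + 2))) • F a =
      -((P.hbar : ℂ) * (a k * a (k + 2))) • F a := by rw [hI]; module
    linear_combination (norm := module) -this

/-! ### The lowest level -/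

theorem contDiff_spinDir : ContDiff ℂ ∞ P.spinDir := by
  unfold spinDir spinAlong
  refine ContDiff.sum fun k _ => ?_
  have h : ContDiff ℂ ∞ fun a : Fin 3 → ℂ => a k / (P.r : ℂ) := by fun_prop
  exact h.smul contDiff_const

theorem contDiff_lagrange (N : ℕ) : ContDiff ℂ ∞ fun a => P.lagrange (P.spinDir a) N := by
  induction N with
  | zero => exact contDiff_const
  | succ k ih =>
    simp only [lagrange]
    exact ((contDiff_spinDir.sub contDiff_const).mul ih).const_smul _

theorem σ_spinDir_comm (j : Fin 3) (a : Fin 3 → ℂ) (v : P.V) :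
    P.σ j (P.spinDir a v) = P.spinDir a (P.σ j v) + (Complex.I * P.hbar / P.r) •
      (a (j + 1) • P.spinOp (j + 2) v - a (j + 2) • P.spinOp (j + 1) v) := by
  have h := spinAlong_comm (n := fun k => a k / (P.r : ℂ)) P.spinOp_comm j
  have h2 := congrArg (fun T : P.V →L[ℂ] P.V => T v) h
  change P.spinDir a (P.spinOp j v) - P.spinOp j (P.spinDir a v) =
    Complex.I • ((a (j + 2) / (P.r : ℂ)) • P.spinOp (j + 1) v -
      (a (j + 1) / (P.r : ℂ)) • P.spinOp (j + 2) v) at h2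
  simp only [σ_eq, smul_apply, map_smul]
  linear_combination (norm := module) (-(P.hbar : ℂ)) • h2

theorem fderiv_spinDir_apply {F : P.CFun} (hF : ContDiff ℂ ∞ F) (i : Fin 3) (a : Fin 3 → ℂ) :
    cpartial i (fun a => P.spinDir a (F a)) a =
      P.spinDir a (cpartial i F a) + (P.r : ℂ)⁻¹ • P.spinOp i (F a) := by
  have h1 : (fun a => P.spinDir a (F a)) =
      fun a => ∑ k, ((P.r : ℂ)⁻¹ • P.spinOp k) (P.cmul k F a) := by
    ext1 a
    simp only [spinDir, spinAlong, sum_apply, smul_apply, cmul_apply, map_smul]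
    refine Finset.sum_congr rfl fun k _ => ?_
    module
  have h2 : HasFDerivAt (fun a => ∑ k, ((P.r : ℂ)⁻¹ • P.spinOp k) (P.cmul k F a))
      (∑ k, ((P.r : ℂ)⁻¹ • P.spinOp k).comp (fderiv ℂ (P.cmul k F) a)) a :=
    HasFDerivAt.fun_sum fun k _ => ((P.r : ℂ)⁻¹ • P.spinOp k).hasFDerivAt.comp a
      ((hF.cmul k).cdiffAt a).hasFDerivAt
  rw [h1, cpartial, h2.fderiv]
  have h3 : ∀ k, (fderiv ℂ (P.cmul k F) a) (Pi.single i 1) = _ := fun k => cpartial_cmul hF i k a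
  simp only [sum_apply, ContinuousLinearMap.comp_apply, h3, smul_apply, map_add, map_smul,
    Finset.sum_add_distrib]
  congr 1
  · simp only [spinDir, spinAlong, sum_apply, smul_apply]
    refine Finset.sum_congr rfl fun k _ => ?_
    module
  · rw [Finset.sum_eq_single i]
    · simp
    · intro b _ hb
      simp [hb]
    · simp

/-- `σ · a` is invariant under simultaneous rotation of `a` and of the spin: the orbital and spin
contributions to its commutator with `Ĵ_j` cancel. -/
theorem cangMom_spinDir {F : P.CFun} (hF : ContDiff ℂ ∞ F) (j : Fin 3) :
    cangMom j (fun a => P.spinDir a (F a)) = fun a => P.spinDir a (cangMom j F a) := by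
  ext1 a
  simp only [cangMom, fderiv_spinDir_apply hF, σ_spinDir_comm, map_add, map_smul, map_sub]
  module

variable (P)

/-- The sections `x ↦ Π_x w` of the lowest level. -/
def lowest : P.V →ₗ[ℂ] P.CFun where
  toFun w := fun a => P.fibreProj a w
  map_add' v w := by ext1 a; exact map_add _ _ _
  map_smul' c w := by ext1 a; exact map_smul _ _ _

@[simp] theorem lowest_apply (w : P.V) (a : Fin 3 → ℂ) : P.lowest w a = P.fibreProj a w := rfl

variable {P}

theorem contDiff_lowest (w : P.V) : ContDiff ℂ ∞ (P.lowest w) :=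
  (contDiff_lagrange P.spin).clm_apply contDiff_const

/-- `Ĵ_j` commutes with polynomials in `σ · a`, and on the constant function `w` it is just `σ_j`.
-/
theorem cangMom_lagrange (N : ℕ) (j : Fin 3) (w : P.V) :
    cangMom j (fun a => P.lagrange (P.spinDir a) N w) =
      fun a => P.lagrange (P.spinDir a) N (P.σ j w) := by
  induction N with
  | zero =>
    ext1 a
    simp [cangMom, cpartial, lagrange]
  | succ k ih =>
    have hF : ContDiff ℂ ∞ fun a => P.lagrange (P.spinDir a) k w :=
      (contDiff_lagrange k).clm_apply contDiff_const
    have hG : ContDiff ℂ ∞ fun a => P.spinDir a (P.lagrange (P.spinDir a) k w) :=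
      contDiff_spinDir.clm_apply hF
    have h1 : ∀ v, (fun a => P.lagrange (P.spinDir a) (k + 1) v) =
        ((P.ε : ℂ) * (k + 1))⁻¹ • ((fun a => P.spinDir a (P.lagrange (P.spinDir a) k v)) +
          (-((P.l : ℂ) - P.ε * (k + 1))) • (fun a => P.lagrange (P.spinDir a) k v)) := by
      intro v
      ext1 a
      rw [lagrange]
      simp only [smul_apply, mul_apply_eq_comp, sub_apply, one_apply_eq_self, Pi.smul_apply,
        Pi.add_apply]
      module
    rw [h1, h1, cangMom_smul _ (hG.cadd (hF.csmul _)), cangMom_add hG (hF.csmul _),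
      cangMom_smul _ hF, cangMom_spinDir hF, ih]

theorem cangMom_lowest (j : Fin 3) (w : P.V) : cangMom j (P.lowest w) = P.lowest (P.σ j w) :=
  cangMom_lagrange P.spin j w

theorem cangMomSq_lowest (w : P.V) : cangMomSq (P.lowest w) =
    ((P.hbar : ℂ) ^ 2 * ((P.spin : ℂ) / 2 * (P.spin / 2 + 1))) • P.lowest w := by
  ext1 a
  simp only [cangMomSq, cangMom_lowest, lowest_apply, ← map_sum, Pi.smul_apply]
  rw [← map_smul]
  congr 1
  have h := congrArg (fun T : P.V →L[ℂ] P.V => T w) P.spinOp_casimir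
  simp only [sum_apply, mul_apply_eq_comp, smul_apply, one_apply_eq_self] at h
  rw [mul_smul, ← h, Finset.smul_sum]
  refine Finset.sum_congr rfl fun j _ => ?_
  simp only [σ_eq, smul_apply, map_smul]
  module

end Params

namespace Params
variable (P : Params)

/-! ### The filtration by levels -/

/-- The span of the products of fewer than `n` coordinates with sections of the lowest level. -/
def level : ℕ → Submodule ℂ P.CFun
  | 0 => ⊥
  | n + 1 => LinearMap.range P.lowest ⊔ ((level n).map (P.cmul 0) ⊔ ((level n).map (P.cmul 1) ⊔
      (level n).map (P.cmul 2)))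

variable {P}

theorem level_zero : P.level 0 = ⊥ := rfl

theorem level_succ (n : ℕ) : P.level (n + 1) = LinearMap.range P.lowest ⊔
    ((P.level n).map (P.cmul 0) ⊔ ((P.level n).map (P.cmul 1) ⊔ (P.level n).map (P.cmul 2))) := rfl

theorem lowest_mem_level (w : P.V) (n : ℕ) : P.lowest w ∈ P.level (n + 1) :=
  Submodule.mem_sup_left ⟨w, rfl⟩

theorem cmul_mem_level {n : ℕ} {F : P.CFun} (hF : F ∈ P.level n) (k : Fin 3) :
    P.cmul k F ∈ P.level (n + 1) := by
  fin_cases k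
  · exact Submodule.mem_sup_right (Submodule.mem_sup_left ⟨F, hF, rfl⟩)
  · exact Submodule.mem_sup_right (Submodule.mem_sup_right (Submodule.mem_sup_left ⟨F, hF, rfl⟩))
  · exact Submodule.mem_sup_right (Submodule.mem_sup_right (Submodule.mem_sup_right ⟨F, hF, rfl⟩))

/-- The summands are recorded as members of the level because `Ĵ` is additive only on smooth
functions. -/
theorem level_induction {n : ℕ} {p : P.CFun → Prop} (hlow : ∀ w, p (P.lowest w))
    (hmul : ∀ F ∈ P.level n, ∀ k, p (P.cmul k F))
    (hadd : ∀ F ∈ P.level (n + 1), ∀ G ∈ P.level (n + 1), p F → p G → p (F + G)) {F : P.CFun}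
    (hF : F ∈ P.level (n + 1)) : p F := by
  obtain ⟨F₀, ⟨w, rfl⟩, F₁, hF₁, rfl⟩ := Submodule.mem_sup.1 hF
  obtain ⟨_, ⟨G₀, hG₀, rfl⟩, F₂, hF₂, rfl⟩ := Submodule.mem_sup.1 hF₁
  obtain ⟨_, ⟨G₁, hG₁, rfl⟩, _, ⟨G₂, hG₂, rfl⟩, rfl⟩ := Submodule.mem_sup.1 hF₂
  have h0 := cmul_mem_level hG₀ 0
  have h1 := cmul_mem_level hG₁ 1
  have h2 := cmul_mem_level hG₂ 2
  exact hadd _ (lowest_mem_level w n) _ (add_mem h0 (add_mem h1 h2)) (hlow w)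
    (hadd _ h0 _ (add_mem h1 h2) (hmul _ hG₀ 0)
      (hadd _ h1 _ h2 (hmul _ hG₁ 1) (hmul _ hG₂ 2)))

theorem level_induction' {p : P.CFun → Prop} (hzero : p 0) (hlow : ∀ w, p (P.lowest w))
    (hmul : ∀ F k, p F → p (P.cmul k F)) (hadd : ∀ F G, p F → p G → p (F + G)) {n : ℕ}
    {F : P.CFun} (hF : F ∈ P.level n) : p F := by
  induction n generalizing F with
  | zero => rw [(Submodule.mem_bot ℂ).1 hF]; exact hzero
  | succ n ih =>
    exact level_induction hlow (fun F hF k => hmul F k (ih hF)) (fun F _ G _ => hadd F G) hF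

theorem level_le_succ (n : ℕ) : P.level n ≤ P.level (n + 1) := by
  induction n with
  | zero => exact bot_le
  | succ n ih =>
    intro F hF
    refine level_induction (fun w => lowest_mem_level w _)
      (fun F hF k => cmul_mem_level (ih hF) k) (fun F _ G _ h1 h2 => add_mem h1 h2) hF

theorem level_mono : Monotone P.level := monotone_nat_of_le_succ level_le_succ

theorem contDiff_of_mem_level {n : ℕ} {F : P.CFun} (hF : F ∈ P.level n) : ContDiff ℂ ∞ F :=
  level_induction' contDiff_const contDiff_lowest (fun _ k h => h.cmul k)
    (fun _ _ h1 h2 => h1.cadd h2) hF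

theorem mem_fibre_of_mem_level {n : ℕ} {F : P.CFun} (hF : F ∈ P.level n) (x : P.Sphere) :
    F (P.toC x) ∈ P.fibre (P.toC x) :=
  level_induction' (p := fun F => F (P.toC x) ∈ P.fibre (P.toC x)) (Submodule.zero_mem _)
    (fun w => P.fibreProj_mem x w) (fun _ _ h => Submodule.smul_mem _ _ h)
    (fun _ _ h1 h2 => add_mem h1 h2) hF

/-- The conjugation of the argument cancels the conjugate-linearity of the first slot; on the lowest
level this is `Π_ā* = Π_a`. It makes the reproducing kernels holomorphic in the label. -/
theorem contDiff_inner_star {n : ℕ} {F : P.CFun} (hF : F ∈ P.level n) (v : P.V) :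
    ContDiff ℂ ∞ fun a : Fin 3 → ℂ => ⟪F (star a), v⟫_ℂ := by
  refine level_induction' (p := fun F => ContDiff ℂ ∞ fun a : Fin 3 → ℂ => ⟪F (star a), v⟫_ℂ)
    ?_ ?_ ?_ ?_ hF
  · simpa using contDiff_const
  · intro w
    simp only [lowest_apply, inner_fibreProj]
    exact (innerSL ℂ w).contDiff.comp (contDiff_lowest v)
  · intro F k h
    have : (fun a : Fin 3 → ℂ => ⟪P.cmul k F (star a), v⟫_ℂ) =
        fun a => a k * ⟪F (star a), v⟫_ℂ := by
      ext1 a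
      simp [mul_comm]
    rw [this]
    exact (contDiff_coord k).mul h
  · intro F G h1 h2
    simp only [Pi.add_apply, inner_add_left]
    exact h1.add h2

/-- Commuting `Ĵ_j` past a coordinate yields another coordinate, so the degree does not grow. -/
theorem cangMom_mem_level {n : ℕ} {F : P.CFun} (hF : F ∈ P.level n) (j : Fin 3) :
    cangMom j F ∈ P.level n := by
  induction n generalizing F with
  | zero =>
    rw [(Submodule.mem_bot ℂ).1 hF] at *
    have := cangMom_smul (P := P) (F := 0) 0 contDiff_const j
    rw [zero_smul, zero_smul] at this
    rw [this]; exact Submodule.zero_mem _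
  | succ n ih =>
    refine level_induction (p := fun F => cangMom j F ∈ P.level (n + 1)) ?_ ?_ ?_ hF
    · intro w
      rw [cangMom_lowest]
      exact lowest_mem_level _ _
    · intro F hF k
      have hc := contDiff_of_mem_level hF
      have cases : k = j ∨ k = j + 1 ∨ k = j + 2 := by
        fin_cases k <;> fin_cases j <;> decide
      rcases cases with rfl | rfl | rfl
      · rw [cangMom_cmul_self hc]
        exact cmul_mem_level (ih hF) _
      · rw [cangMom_cmul_next hc]
        exact add_mem (cmul_mem_level (ih hF) _) (Submodule.smul_mem _ _ (cmul_mem_level hF _))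
      · rw [cangMom_cmul_prev hc]
        exact sub_mem (cmul_mem_level (ih hF) _) (Submodule.smul_mem _ _ (cmul_mem_level hF _))
    · intro F hF G hG h1 h2
      rw [cangMom_add (contDiff_of_mem_level hF) (contDiff_of_mem_level hG)]
      exact add_mem h1 h2

/-- Equivariance turns `x × Ĵ` into `Π (x × σ)`, and `fibreProj_mul_cross` evaluates that product.
The resulting multiple `ħ |l|` of `x_k` is what shifts the spectrum by the spin. -/
theorem crossMom_lowest (k : Fin 3) (w : P.V) (x : P.Sphere) :
    crossMom k (P.lowest w) (P.toC x) =
      ((P.hbar : ℂ) * (P.spin / 2)) • P.cmul k (P.lowest w) (P.toC x) +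
        P.lowest ((-(P.r * P.ε : ℂ)) • P.σ k w) (P.toC x) := by
  have h := congrArg (fun T : P.V →L[ℂ] P.V => T w) (P.fibreProj_mul_cross x k)
  change P.fibreProj (P.toC x) ((P.toC x (k + 2) / (P.r : ℂ)) • P.spinOp (k + 1) w -
    (P.toC x (k + 1) / (P.r : ℂ)) • P.spinOp (k + 2) w) =
    (-(Complex.I * P.ε)) • (P.fibreProj (P.toC x) (P.spinOp k w) -
      ((P.l : ℂ) * (P.toC x k / P.r)) • P.fibreProj (P.toC x) w) at h
  have hI : Complex.I * Complex.I = -1 := Complex.I_mul_I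
  have hε := P.ε_mul_self_complex
  have hr := P.r_ne_zero
  have hl : (P.l : ℂ) = P.ε * (P.spin / 2) := by
    rw [l_eq]; push_cast; ring
  have e : ∀ j, P.toC x j = P.r * (P.toC x j / P.r) := fun j => by field_simp
  simp only [crossMom, cangMom_lowest, lowest_apply, cmul_apply, σ_eq, smul_apply, map_smul,
    map_sub] at h ⊢
  rw [e k, e (k + 1), e (k + 2)]
  set n := fun j => P.toC x j / P.r
  set A := P.fibreProj (P.toC x) (P.spinOp k w)
  set B := P.fibreProj (P.toC x) w
  have h1 : (Complex.I * (P.ε * Complex.I)) • A = -(P.ε : ℂ) • A := by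
    rw [show Complex.I * (P.ε * Complex.I) = -(P.ε : ℂ) by linear_combination (P.ε : ℂ) * hI]
  have h2 : (Complex.I * (P.ε * Complex.I) * (P.l * n k)) • B =
      -((P.spin / 2 * n k) • B) := by
    rw [← neg_smul]
    congr 1
    rw [hl]
    linear_combination (P.ε : ℂ) * P.ε * (P.spin / 2 * n k) * hI - (P.spin / 2 * n k) * hε
  change _ = ((P.hbar : ℂ) * (P.spin / 2)) • (P.r * n k) • B + _
  change n (k + 2) • _ - n (k + 1) • _ = (-(Complex.I * P.ε)) • (A - ((P.l : ℂ) * n k) • B) at h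
  linear_combination (norm := module) (-(Complex.I * P.r * P.hbar)) • h +
    (P.r * P.hbar : ℂ) • h1 - (P.r * P.hbar : ℂ) • h2

/-- By `crossMom_cmul`, each further coordinate factor adds `ħ x_k` to the leading coefficient; the
other terms do not exceed the level. -/
theorem crossMom_level (n : ℕ) {F : P.CFun} (hF : F ∈ P.level (n + 1)) (k : Fin 3) :
    ∃ G ∈ P.level (n + 1), ∀ x : P.Sphere, crossMom k F (P.toC x) =
      ((P.hbar : ℂ) * (P.spin / 2 + n)) • P.cmul k F (P.toC x) + G (P.toC x) := by
  have hadd : ∀ n, ∀ F ∈ P.level (n + 1), ∀ G ∈ P.level (n + 1),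
      (∃ F' ∈ P.level (n + 1), ∀ x : P.Sphere, crossMom k F (P.toC x) =
        ((P.hbar : ℂ) * (P.spin / 2 + n)) • P.cmul k F (P.toC x) + F' (P.toC x)) →
      (∃ G' ∈ P.level (n + 1), ∀ x : P.Sphere, crossMom k G (P.toC x) =
        ((P.hbar : ℂ) * (P.spin / 2 + n)) • P.cmul k G (P.toC x) + G' (P.toC x)) →
      ∃ G' ∈ P.level (n + 1), ∀ x : P.Sphere, crossMom k (F + G) (P.toC x) =
        ((P.hbar : ℂ) * (P.spin / 2 + n)) • P.cmul k (F + G) (P.toC x) + G' (P.toC x) := by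
    rintro n F hF G hG ⟨F', hF', h1⟩ ⟨G', hG', h2⟩
    refine ⟨F' + G', add_mem hF' hG', fun x => ?_⟩
    rw [crossMom_add (contDiff_of_mem_level hF) (contDiff_of_mem_level hG), map_add]
    simp only [Pi.add_apply, h1, h2]
    module
  induction n generalizing F with
  | zero =>
    refine level_induction (p := fun F => ∃ G ∈ P.level 1, ∀ x : P.Sphere,
      crossMom k F (P.toC x) =
        ((P.hbar : ℂ) * (P.spin / 2 + (0 : ℕ))) • P.cmul k F (P.toC x) + G (P.toC x)) ?_ ?_
      (hadd 0) hF
    · intro w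
      refine ⟨P.lowest ((-(P.r * P.ε : ℂ)) • P.σ k w), lowest_mem_level _ 0, fun x => ?_⟩
      rw [crossMom_lowest]
      simp
    · intro F hF j
      rw [(Submodule.mem_bot ℂ).1 hF, map_zero]
      refine ⟨0, Submodule.zero_mem _, fun x => ?_⟩
      have h := crossMom_cmul (P := P) (F := 0) contDiff_const k 0 (P.toC_mem_sphereC x)
      have h2 := cangMom_smul (P := P) (F := 0) 0 contDiff_const
      simp only [zero_smul] at h2
      simp [crossMom, h2]
  | succ n ih =>
    refine level_induction (p := fun F => ∃ G ∈ P.level (n + 2), ∀ x : P.Sphere,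
      crossMom k F (P.toC x) =
        ((P.hbar : ℂ) * (P.spin / 2 + (n + 1 : ℕ))) • P.cmul k F (P.toC x) + G (P.toC x)) ?_ ?_
      (hadd (n + 1)) hF
    · intro w
      -- On `Π w` the true coefficient is `ħ |l|`; the excess `ħ (n + 1) x_k Π w` is moved into the
      -- remainder.
      refine ⟨P.lowest ((-(P.r * P.ε : ℂ)) • P.σ k w) -
        ((P.hbar : ℂ) * (n + 1)) • P.cmul k (P.lowest w),
        sub_mem (lowest_mem_level _ _) (Submodule.smul_mem _ _
          (cmul_mem_level (lowest_mem_level _ _) _)), fun x => ?_⟩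
      rw [crossMom_lowest]
      simp only [Pi.sub_apply, Pi.smul_apply]
      push_cast
      module
    · intro F hF p
      obtain ⟨G, hG, h⟩ := ih hF
      refine ⟨P.cmul p G - (if p = k then (P.hbar : ℂ) * P.r ^ 2 else 0) • F,
        sub_mem (cmul_mem_level hG p) (Submodule.smul_mem _ _ (level_le_succ _ hF)), fun x => ?_⟩
      rw [crossMom_cmul (contDiff_of_mem_level hF) k p (P.toC_mem_sphereC x), h]
      simp only [Pi.sub_apply, Pi.smul_apply, cmul_apply]
      push_cast
      module

variable (P) in
/-- The eigenvalues of `Ĵ²`. -/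
def eig (n : ℕ) : ℝ := P.hbar ^ 2 * ((P.spin / 2 + n) * (P.spin / 2 + n + 1))

/-- By `cangMomSq_cmul` and `crossMom_level`, one more coordinate raises the leading eigenvalue by
`2ħ² + 2ħ² (|l| + n)`, which is the gap between consecutive values of `eig`. -/
theorem cangMomSq_level (n : ℕ) {F : P.CFun} (hF : F ∈ P.level (n + 1)) :
    ∃ G ∈ P.level n, ∀ x : P.Sphere,
      cangMomSq F (P.toC x) = (P.eig n : ℂ) • F (P.toC x) + G (P.toC x) := by
  have hadd : ∀ n, ∀ F ∈ P.level (n + 1), ∀ G ∈ P.level (n + 1),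
      (∃ F' ∈ P.level n, ∀ x : P.Sphere,
        cangMomSq F (P.toC x) = (P.eig n : ℂ) • F (P.toC x) + F' (P.toC x)) →
      (∃ G' ∈ P.level n, ∀ x : P.Sphere,
        cangMomSq G (P.toC x) = (P.eig n : ℂ) • G (P.toC x) + G' (P.toC x)) →
      ∃ G' ∈ P.level n, ∀ x : P.Sphere,
        cangMomSq (F + G) (P.toC x) = (P.eig n : ℂ) • (F + G) (P.toC x) + G' (P.toC x) := by
    rintro n F hF G hG ⟨F', hF', h1⟩ ⟨G', hG', h2⟩
    refine ⟨F' + G', add_mem hF' hG', fun x => ?_⟩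
    rw [cangMomSq_add (contDiff_of_mem_level hF) (contDiff_of_mem_level hG)]
    simp only [Pi.add_apply, h1, h2]
    module
  induction n generalizing F with
  | zero =>
    refine level_induction (p := fun F => ∃ G ∈ P.level 0, ∀ x : P.Sphere,
      cangMomSq F (P.toC x) = (P.eig 0 : ℂ) • F (P.toC x) + G (P.toC x)) ?_ ?_ (hadd 0) hF
    · intro w
      refine ⟨0, Submodule.zero_mem _, fun x => ?_⟩
      rw [cangMomSq_lowest]
      simp [eig]
    · intro F hF j
      rw [(Submodule.mem_bot ℂ).1 hF, map_zero]
      refine ⟨0, Submodule.zero_mem _, fun x => ?_⟩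
      have h2 := cangMom_smul (P := P) (F := 0) 0 contDiff_const
      simp only [zero_smul] at h2
      simp [cangMomSq, h2]
  | succ n ih =>
    refine level_induction (p := fun F => ∃ G ∈ P.level (n + 1), ∀ x : P.Sphere,
      cangMomSq F (P.toC x) = (P.eig (n + 1) : ℂ) • F (P.toC x) + G (P.toC x)) ?_ ?_
      (hadd (n + 1)) hF
    · intro w
      refine ⟨((P.eig 0 : ℂ) - P.eig (n + 1)) • P.lowest w,
        Submodule.smul_mem _ _ (lowest_mem_level _ _), fun x => ?_⟩
      rw [cangMomSq_lowest]
      simp only [Pi.smul_apply, eig]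
      push_cast
      module
    · intro F hF k
      obtain ⟨G, hG, h⟩ := ih hF
      obtain ⟨G', hG', h'⟩ := crossMom_level n hF k
      refine ⟨P.cmul k G + (2 * (P.hbar : ℂ)) • G', add_mem (cmul_mem_level hG k)
        (Submodule.smul_mem _ _ hG'), fun x => ?_⟩
      rw [cangMomSq_cmul (contDiff_of_mem_level hF)]
      simp only [Pi.add_apply, Pi.smul_apply, cmul_apply, h, h', eig]
      push_cast
      module

instance finiteDimensional_level (n : ℕ) : FiniteDimensional ℂ (P.level n) := by
  induction n with
  | zero => exact inferInstanceAs (FiniteDimensional ℂ (⊥ : Submodule ℂ P.CFun))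
  | succ n ih => rw [level_succ]; infer_instance

/-- The true growth is polynomial, but any exponential bound is beaten by the Gaussian decay of the
heat factors. -/
theorem finrank_level_le (n : ℕ) :
    Module.finrank ℂ (P.level n) ≤ (P.spin + 1) * 4 ^ n := by
  have hsup : ∀ A B : Submodule ℂ P.CFun, ∀ [FiniteDimensional ℂ A] [FiniteDimensional ℂ B],
      Module.finrank ℂ (A ⊔ B : Submodule ℂ P.CFun) ≤
        Module.finrank ℂ A + Module.finrank ℂ B := fun A B _ _ =>
    Submodule.finrank_add_le_finrank_add_finrank A B
  induction n with
  | zero => rw [level_zero, finrank_bot]; exact Nat.zero_le _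
  | succ n ih =>
    have h0 : Module.finrank ℂ (LinearMap.range P.lowest) ≤ P.spin + 1 := by
      simpa using LinearMap.finrank_range_le P.lowest
    have hk : ∀ k, Module.finrank ℂ ((P.level n).map (P.cmul k)) ≤ (P.spin + 1) * 4 ^ n :=
      fun k => (Submodule.finrank_map_le _ _).trans ih
    have h1 : 1 ≤ 4 ^ n := Nat.one_le_pow _ _ (by norm_num)
    have h2 : P.spin + 1 ≤ (P.spin + 1) * 4 ^ n := Nat.le_mul_of_pos_right _ h1
    rw [level_succ]
    refine (hsup _ _).trans ?_
    refine (Nat.add_le_add_left (hsup _ _) _).trans ?_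
    refine (Nat.add_le_add_left (Nat.add_le_add_left (hsup _ _) _) _).trans ?_
    have a0 := hk 0
    have a1 := hk 1
    have a2 := hk 2
    rw [pow_succ, ← mul_assoc]
    omega

end Params

namespace Params
variable (P : Params)

/-! ### Rotations of the sphere -/

/-- The action of a linear isometry on a sphere about the origin. -/
def sphereMap (U : E3 ≃ₗᵢ[ℝ] E3) (r : ℝ) (x : sphere (0 : E3) r) : sphere (0 : E3) r :=
  ⟨U x, by simp⟩

theorem continuous_sphereMap (U : E3 ≃ₗᵢ[ℝ] E3) (r : ℝ) : Continuous (sphereMap U r) :=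
  (U.continuous.comp continuous_subtype_val).subtype_mk _

open scoped Pointwise in
-- The area of a subset of the unit sphere is a multiple of the volume of the cone over it, and
-- isometries preserve volume.
theorem map_sphereMap_toSphere (U : E3 ≃ₗᵢ[ℝ] E3) :
    (volume : Measure E3).toSphere.map (sphereMap U 1) = (volume : Measure E3).toSphere := by
  ext s hs
  have hm := (continuous_sphereMap U 1).measurable
  rw [Measure.map_apply hm hs, Measure.toSphere_apply' _ hs, Measure.toSphere_apply' _ (hm hs)]
  congr 1
  have h : Set.Ioo (0 : ℝ) 1 • ((↑) '' (sphereMap U 1 ⁻¹' s) : Set E3) =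
      U ⁻¹' (Set.Ioo (0 : ℝ) 1 • ((↑) '' s : Set E3)) := by
    ext y
    simp only [Set.mem_smul, Set.mem_image, Set.mem_preimage]
    constructor
    · rintro ⟨t, ht, _, ⟨z, hz, rfl⟩, rfl⟩
      exact ⟨t, ht, _, ⟨_, hz, rfl⟩, by simp [sphereMap]⟩
    · rintro ⟨t, ht, _, ⟨z, hz, rfl⟩, h⟩
      refine ⟨t, ht, U.symm z, ⟨⟨U.symm z, by simp⟩, ?_, rfl⟩, ?_⟩
      · convert hz
        simp [sphereMap]
      · rw [← map_smul, h]; simp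
  rw [h]
  exact U.measurePreserving.measure_preimage_equiv (f := U.toMeasurableEquiv) _

theorem continuous_dilate : Continuous P.dilate :=
  (continuous_subtype_val.const_smul P.r).subtype_mk _

theorem map_sphereMap_area (U : E3 ≃ₗᵢ[ℝ] E3) : P.area.map (sphereMap U P.r) = P.area := by
  have h : sphereMap U P.r ∘ P.dilate = P.dilate ∘ sphereMap U 1 := by
    ext1 u
    apply Subtype.ext
    simp [sphereMap, dilate]
  rw [area, Measure.map_smul, Measure.map_map (continuous_sphereMap U P.r).measurable
    P.continuous_dilate.measurable, h, ← Measure.map_map P.continuous_dilate.measurable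
    (continuous_sphereMap U 1).measurable, map_sphereMap_toSphere]

theorem dilate_surjective : Function.Surjective P.dilate := by
  intro x
  have hr := P.r_pos
  have hx : ‖(x : E3)‖ = P.r := by simp
  refine ⟨⟨P.r⁻¹ • (x : E3), by simp [norm_smul, abs_of_pos hr, hr.ne']⟩, ?_⟩
  apply Subtype.ext
  simp [dilate, smul_smul, hr.ne']

instance : P.area.IsOpenPosMeasure where
  open_pos U hU hne := by
    have hr := P.r_pos
    rw [area, Measure.smul_apply, Measure.map_apply P.continuous_dilate.measurable
      hU.measurableSet, smul_eq_mul]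
    refine mul_ne_zero (by simpa using hr.ne') ?_
    exact (hU.preimage P.continuous_dilate).measure_ne_zero _
      (hne.preimage P.dilate_surjective)

open scoped Pointwise in
-- The cone over a point lies in a line, which is a null set in three-space.
theorem area_singleton (x : P.Sphere) : P.area {x} = 0 := by
  have hr := P.r_pos
  rw [area, Measure.smul_apply, Measure.map_apply P.continuous_dilate.measurable
    (measurableSet_singleton x), smul_eq_mul]
  have hms : MeasurableSet (P.dilate ⁻¹' {x}) :=
    P.continuous_dilate.measurable (measurableSet_singleton x)
  rw [Measure.toSphere_apply' _ hms]
  have hne : (Submodule.span ℝ {(x : E3)}) ≠ ⊤ := by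
    intro h
    have h1 : Module.finrank ℝ (Submodule.span ℝ {(x : E3)}) ≤ 1 := by
      simpa using finrank_span_le_card (R := ℝ) {(x : E3)}
    rw [h, finrank_top] at h1
    simp at h1
  have hsub : Set.Ioo (0 : ℝ) 1 • ((↑) '' (P.dilate ⁻¹' {x}) : Set E3) ⊆
      (Submodule.span ℝ {(x : E3)} : Set E3) := by
    rintro _ ⟨t, -, _, ⟨u, hu, rfl⟩, rfl⟩
    have hu' : P.r • (u : E3) = x := congrArg Subtype.val hu
    have hu2 : (u : E3) = P.r⁻¹ • (x : E3) := by rw [← hu', smul_smul, inv_mul_cancel₀ hr.ne', one_smul]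
    simp only [hu2]
    exact Submodule.smul_mem _ _ (Submodule.smul_mem _ _ (Submodule.mem_span_singleton_self _))
  have h0 := measure_mono_null hsub (Measure.addHaar_submodule volume _ hne)
  rw [h0]; simp

/-- The rotation about a coordinate axis. -/
def rotFun (j : Fin 3) (θ : ℝ) : E3 →ₗ[ℝ] E3 where
  toFun x := WithLp.toLp 2 fun k => if k = j then x j else
    if k = j + 1 then Real.cos θ * x (j + 1) - Real.sin θ * x (j + 2) else
      Real.sin θ * x (j + 1) + Real.cos θ * x (j + 2)
  map_add' x y := by
    ext k
    simp only [PiLp.add_apply]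
    split_ifs <;> ring
  map_smul' c x := by
    ext k
    simp only [PiLp.smul_apply, smul_eq_mul, RingHom.id_apply]
    split_ifs <;> ring

theorem rotFun_self (j : Fin 3) (θ : ℝ) (x : E3) : rotFun j θ x j = x j := by simp [rotFun]

theorem rotFun_next (j : Fin 3) (θ : ℝ) (x : E3) :
    rotFun j θ x (j + 1) = Real.cos θ * x (j + 1) - Real.sin θ * x (j + 2) := by
  have : ¬ j + 1 = j := by fin_cases j <;> decide
  simp [rotFun]

theorem rotFun_prev (j : Fin 3) (θ : ℝ) (x : E3) :
    rotFun j θ x (j + 2) = Real.sin θ * x (j + 1) + Real.cos θ * x (j + 2) := by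
  have h1 : ¬ j + 2 = j := by fin_cases j <;> decide
  have h2 : ¬ j + 2 = j + 1 := by fin_cases j <;> decide
  simp [rotFun, h1]

theorem norm_rotFun (j : Fin 3) (θ : ℝ) (x : E3) : ‖rotFun j θ x‖ = ‖x‖ := by
  have h : ‖rotFun j θ x‖ ^ 2 = ‖x‖ ^ 2 := by
    rw [EuclideanSpace.norm_sq_eq, EuclideanSpace.norm_sq_eq, sum_cyclic j, sum_cyclic j]
    simp only [Real.norm_eq_abs, sq_abs, rotFun_self, rotFun_next, rotFun_prev]
    linear_combination (x (j + 1) ^ 2 + x (j + 2) ^ 2) * Real.sin_sq_add_cos_sq θ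
  exact (sq_eq_sq₀ (norm_nonneg _) (norm_nonneg _)).1 h

/-- The rotation about a coordinate axis as an isometry. -/
def rot (j : Fin 3) (θ : ℝ) : E3 ≃ₗᵢ[ℝ] E3 :=
  LinearIsometry.toLinearIsometryEquiv ⟨rotFun j θ, norm_rotFun j θ⟩ rfl

theorem rot_apply (j : Fin 3) (θ : ℝ) (x : E3) : rot j θ x = rotFun j θ x := rfl

variable {E : Type*} [NormedAddCommGroup E] [NormedSpace ℝ E]

/-- The derivative along the rotations about a coordinate axis. -/
def rotDeriv (j : Fin 3) (f : E3 → E) (x : E3) : E :=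
  x (j + 1) • fderiv ℝ f x (EuclideanSpace.single (j + 2) 1) -
    x (j + 2) • fderiv ℝ f x (EuclideanSpace.single (j + 1) 1)

omit [NormedAddCommGroup E] [NormedSpace ℝ E] in
theorem hasDerivAt_of_coord {φ : ℝ → E3} {φ' : E3} {t : ℝ}
    (h : ∀ i, HasDerivAt (fun t => φ t i) (φ' i) t) : HasDerivAt φ φ' t := by
  have h1 : HasDerivAt (fun t => (fun i => φ t i : Fin 3 → ℝ)) (fun i => φ' i) t :=
    hasDerivAt_pi.2 h
  exact ((EuclideanSpace.equiv (Fin 3) ℝ).symm : (Fin 3 → ℝ) →L[ℝ] E3).hasFDerivAt.comp_hasDerivAt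
    t h1

theorem hasDerivAt_comp_rot {f : E3 → E} (hf : Differentiable ℝ f) (j : Fin 3) (x : E3) (θ : ℝ) :
    HasDerivAt (fun θ => f (rot j θ x)) (rotDeriv j f (rot j θ x)) θ := by
  have h1 : HasDerivAt (fun θ => rot j θ x)
      ((rot j θ x) (j + 1) • EuclideanSpace.single (j + 2) (1 : ℝ) -
        (rot j θ x) (j + 2) • EuclideanSpace.single (j + 1) (1 : ℝ)) θ := by
    refine hasDerivAt_of_coord fun k => ?_
    have a1 : ¬ j = j + 1 := by fin_cases j <;> decide
    have a2 : ¬ j = j + 2 := by fin_cases j <;> decide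
    have a3 : ¬ j + 1 = j + 2 := by fin_cases j <;> decide
    have a4 : ¬ j + 2 = j + 1 := by fin_cases j <;> decide
    have cases : k = j ∨ k = j + 1 ∨ k = j + 2 := by
      fin_cases k <;> fin_cases j <;> decide
    simp only [rot_apply, rotFun_next, rotFun_prev]
    rcases cases with rfl | rfl | rfl
    · simp only [rotFun_self]
      simpa [a1, a2] using hasDerivAt_const θ (x k)
    · simp only [rotFun_next]
      have := ((Real.hasDerivAt_cos θ).mul_const (x (j + 1))).sub
        ((Real.hasDerivAt_sin θ).mul_const (x (j + 2)))
      refine this.congr_deriv ?_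
      simp
      ring
    · simp only [rotFun_prev]
      have := ((Real.hasDerivAt_sin θ).mul_const (x (j + 1))).add
        ((Real.hasDerivAt_cos θ).mul_const (x (j + 2)))
      refine this.congr_deriv ?_
      simp
      ring
  have h2 := (hf (rot j θ x)).hasFDerivAt.comp_hasDerivAt θ h1
  refine h2.congr_deriv ?_
  simp [rotDeriv]

/-- The integral of `f` composed with the rotation by `θ` does not depend on `θ`; its derivative at
`θ = 0` is taken under the integral sign. -/
theorem integral_rotDeriv [CompleteSpace E] {f : E3 → E} (hf : ContDiff ℝ ∞ f) (j : Fin 3) :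
    ∫ x : P.Sphere, rotDeriv j f x ∂P.area = 0 := by
  have hdf : Continuous (rotDeriv j f) := by
    have h := hf.continuous_fderiv (by simp)
    unfold rotDeriv
    fun_prop
  have hc : Continuous fun x : P.Sphere => f x := hf.continuous.comp continuous_subtype_val
  obtain ⟨C, hC⟩ := isCompact_univ.exists_bound_of_continuousOn
    (f := fun x : P.Sphere => rotDeriv j f x)
    (hdf.comp continuous_subtype_val).continuousOn
  have hconst : ∀ θ, ∫ x : P.Sphere, f (rot j θ x) ∂P.area = ∫ x : P.Sphere, f x ∂P.area := by
    intro θ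
    have h := P.map_sphereMap_area (rot j θ)
    conv_rhs => rw [← h]
    rw [integral_map (continuous_sphereMap _ _).aemeasurable
      (hc.aestronglyMeasurable)]
    rfl
  have hderiv := hasDerivAt_integral_of_dominated_loc_of_deriv_le (μ := P.area) (x₀ := (0 : ℝ))
    (F := fun θ (x : P.Sphere) => f (rot j θ x))
    (F' := fun θ (x : P.Sphere) => rotDeriv j f (rot j θ x)) (s := Set.univ)
    (bound := fun _ => C) Filter.univ_mem
    (Filter.Eventually.of_forall fun θ => (hf.continuous.comp
      ((rot j θ).continuous.comp continuous_subtype_val)).aestronglyMeasurable)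
    ((hf.continuous.comp
      ((rot j 0).continuous.comp continuous_subtype_val)).integrable_of_hasCompactSupport
      (HasCompactSupport.of_compactSpace _))
    (hdf.comp
      ((rot j 0).continuous.comp continuous_subtype_val)).aestronglyMeasurable
    (Filter.Eventually.of_forall fun x θ _ => hC (sphereMap (rot j θ) P.r x) (Set.mem_univ _))
    (integrable_const C)
    (Filter.Eventually.of_forall fun x θ _ =>
      hasDerivAt_comp_rot (hf.differentiable (by simp)) j x θ)
  have h2 := hderiv.2
  simp only [hconst] at h2
  have h3 := h2.unique (hasDerivAt_const (0 : ℝ) _)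
  have h0 : ∀ x : E3, rot j 0 x = x := by
    intro x
    rw [rot_apply]
    ext k
    have cases : k = j ∨ k = j + 1 ∨ k = j + 2 := by
      fin_cases k <;> fin_cases j <;> decide
    rcases cases with rfl | rfl | rfl
    · simp [rotFun_self]
    · simp [rotFun_next]
    · simp [rotFun_prev]
  simpa only [h0] using h3

variable {P}

/-! ### Symmetry of the angular momentum on the sphere. -/

theorem angMom_eq (j : Fin 3) (F : E3 → P.V) (x : E3) :
    P.angMom j F x = (-(Complex.I * (P.hbar : ℂ))) • rotDeriv j F x + P.σ j (F x) := rfl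

theorem rotDeriv_inner {F G : E3 → P.V} (hF : Differentiable ℝ F) (hG : Differentiable ℝ G)
    (j : Fin 3) (x : E3) : rotDeriv j (fun x => ⟪F x, G x⟫_ℂ) x =
      ⟪rotDeriv j F x, G x⟫_ℂ + ⟪F x, rotDeriv j G x⟫_ℂ := by
  have h : ∀ v, fderiv ℝ (fun x => ⟪F x, G x⟫_ℂ) x v =
      ⟪F x, fderiv ℝ G x v⟫_ℂ + ⟪fderiv ℝ F x v, G x⟫_ℂ := fun v =>
    fderiv_inner_apply ℂ (hF x) (hG x) v
  have hc : ∀ (c : ℝ) (v : P.V), c • v = (c : ℂ) • v := fun c v => (Complex.coe_smul c v).symm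
  simp only [rotDeriv, h, hc, inner_sub_left, inner_sub_right, inner_smul_left, inner_smul_right,
    Complex.conj_ofReal, Complex.real_smul]
  ring

theorem _root_.ContDiff.angMom {F : E3 → P.V} (hF : ContDiff ℝ ∞ F) (j : Fin 3) :
    ContDiff ℝ ∞ (P.angMom j F) := by
  have h : ∀ i, ContDiff ℝ ∞ (P.partialDeriv i F) := fun i =>
    (hF.fderiv_right (m := ∞) le_rfl).clm_apply contDiff_const
  have hx : ∀ i, ContDiff ℝ ∞ fun x : E3 => x i := fun i =>
    (EuclideanSpace.proj (𝕜 := ℝ) i).contDiff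
  have hσ : ContDiff ℝ ∞ fun v : P.V => P.σ j v :=
    ((P.σ j).restrictScalars ℝ).contDiff
  exact ((((hx _).smul (h _)).sub ((hx _).smul (h _))).const_smul _).add (hσ.comp hF)

theorem integrable_inner_sphere {F G : E3 → P.V} (hF : Continuous F) (hG : Continuous G) :
    Integrable (fun x : P.Sphere => ⟪F x, G x⟫_ℂ) P.area :=
  ((hF.comp continuous_subtype_val).inner
    (hG.comp continuous_subtype_val)).integrable_of_hasCompactSupport
      (HasCompactSupport.of_compactSpace _)

/-- The spin parts cancel, and the orbital parts combine to a rotation derivative of `⟨F, G⟩`, which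
integrates to zero. -/
theorem integral_inner_angMom {F G : E3 → P.V} (hF : ContDiff ℝ ∞ F) (hG : ContDiff ℝ ∞ G)
    (j : Fin 3) : ∫ x : P.Sphere, ⟪P.angMom j F x, G x⟫_ℂ ∂P.area =
      ∫ x : P.Sphere, ⟪F x, P.angMom j G x⟫_ℂ ∂P.area := by
  rw [← sub_eq_zero, ← integral_sub (integrable_inner_sphere (hF.angMom j).continuous
    hG.continuous) (integrable_inner_sphere hF.continuous (hG.angMom j).continuous)]
  have h : ∀ x : P.Sphere, ⟪P.angMom j F x, G x⟫_ℂ - ⟪F x, P.angMom j G x⟫_ℂ =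
      (Complex.I * P.hbar) * rotDeriv j (fun x => ⟪F x, G x⟫_ℂ) x := by
    intro x
    rw [rotDeriv_inner (hF.differentiable (by simp)) (hG.differentiable (by simp))]
    simp only [angMom_eq, inner_add_left, inner_add_right, inner_smul_left, inner_smul_right,
      inner_σ, map_neg, map_mul, Complex.conj_I, Complex.conj_ofReal]
    ring
  simp only [h]
  rw [integral_const_mul, integral_rotDeriv P (hF.inner ℂ hG), mul_zero]

theorem integral_inner_angMomSq {F G : E3 → P.V} (hF : ContDiff ℝ ∞ F) (hG : ContDiff ℝ ∞ G) :
    ∫ x : P.Sphere, ⟪P.angMomSq F x, G x⟫_ℂ ∂P.area =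
      ∫ x : P.Sphere, ⟪F x, P.angMomSq G x⟫_ℂ ∂P.area := by
  simp only [angMomSq, sum_inner, inner_sum]
  rw [integral_finsetSum _ fun j _ => integrable_inner_sphere
    ((hF.angMom j).angMom j).continuous hG.continuous, integral_finsetSum _ fun j _ =>
    integrable_inner_sphere hF.continuous ((hG.angMom j).angMom j).continuous]
  refine Finset.sum_congr rfl fun j _ => ?_
  rw [integral_inner_angMom (hF.angMom j) hG, integral_inner_angMom hF (hG.angMom j)]

end Params

namespace Params
variable (P : Params)

/-! ### Entire sections in the Hilbert space -/

/-- The inclusion of real in complex three-space. -/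
def complexify : E3 →L[ℝ] (Fin 3 → ℂ) :=
  ContinuousLinearMap.pi fun j => Complex.ofRealCLM.comp (EuclideanSpace.proj j)

theorem complexify_apply (x : E3) (j : Fin 3) : complexify x j = ((x j : ℝ) : ℂ) := rfl

theorem toC_eq (x : P.Sphere) : P.toC x = complexify x := rfl

variable {P}

theorem _root_.ContDiff.comp_complexify {F : P.CFun} (hF : ContDiff ℂ ∞ F) :
    ContDiff ℝ ∞ fun x : E3 => F (complexify x) :=
  (hF.restrict_scalars ℝ).comp complexify.contDiff

theorem fderiv_comp_complexify {F : P.CFun} (hF : ContDiff ℂ ∞ F) (x v : E3) :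
    fderiv ℝ (fun x => F (complexify x)) x v = fderiv ℂ F (complexify x) (complexify v) := by
  have h1 := ((hF.cdiffAt (complexify x)).hasFDerivAt.restrictScalars ℝ).comp x
    complexify.hasFDerivAt
  have h2 : fderiv ℝ (fun x => F (complexify x)) x = _ := h1.fderiv
  rw [h2]; rfl

theorem complexify_single (i : Fin 3) :
    complexify (EuclideanSpace.single i 1) = Pi.single i 1 := by
  ext k
  rw [complexify_apply]
  by_cases h : k = i
  · subst h; simp
  · simp [h]

theorem angMom_comp_complexify {F : P.CFun} (hF : ContDiff ℂ ∞ F) (j : Fin 3) :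
    P.angMom j (fun x => F (complexify x)) = fun x => cangMom j F (complexify x) := by
  ext1 x
  simp only [angMom, partialDeriv, fderiv_comp_complexify hF, complexify_single, cangMom,
    cpartial, complexify_apply, Complex.coe_smul]

theorem angMomSq_comp_complexify {F : P.CFun} (hF : ContDiff ℂ ∞ F) :
    P.angMomSq (fun x => F (complexify x)) = fun x => cangMomSq F (complexify x) := by
  ext1 x
  simp only [angMomSq, angMom_comp_complexify hF, angMom_comp_complexify (hF.cangMom _), cangMomSq]

variable (P)

/-- The entire functions on `ℂ³` which restrict to sections on the real sphere. -/
def entireSections : Submodule ℂ P.CFun where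
  carrier := {F | ContDiff ℂ ∞ F ∧ ∀ x : P.Sphere, F (P.toC x) ∈ P.fibre (P.toC x)}
  zero_mem' := ⟨contDiff_const, fun _ => Submodule.zero_mem _⟩
  add_mem' := fun h1 h2 => ⟨h1.1.cadd h2.1, fun x => add_mem (h1.2 x) (h2.2 x)⟩
  smul_mem' := fun c _ h => ⟨h.1.csmul c, fun x => Submodule.smul_mem _ c (h.2 x)⟩

variable {P} in
theorem level_le_entireSections (n : ℕ) : P.level n ≤ P.entireSections := fun _ hF =>
  ⟨contDiff_of_mem_level hF, mem_fibre_of_mem_level hF⟩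

/-- Restriction of an entire section to the sphere. -/
def restrictSphere : P.entireSections →ₗ[ℂ] P.smoothSections where
  toFun F := ⟨fun x => (F : P.CFun) (P.toC x),
    ⟨fun x => (F : P.CFun) (complexify x), F.2.1.comp_complexify, fun _ => rfl⟩, F.2.2⟩
  map_add' _ _ := rfl
  map_smul' _ _ := rfl

/-- An entire section as a vector of the Hilbert space. -/
def emb : P.entireSections →ₗ[ℂ] P.H := P.ofSmooth ∘ₗ P.restrictSphere

variable {P}

theorem ofSmooth_coe (f : P.smoothSections) :
    ((P.ofSmooth f : P.H) : P.L2V) =ᵐ[P.area] (f : P.Sphere → P.V) :=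
  (P.memLp_smooth f).coeFn_toLp

theorem emb_coe (F : P.entireSections) :
    ((P.emb F : P.H) : P.L2V) =ᵐ[P.area] fun x => (F : P.CFun) (P.toC x) :=
  ofSmooth_coe _

theorem inner_eq_integral (f g : P.H) :
    ⟪f, g⟫_ℂ = ∫ x, ⟪(f : P.L2V) x, (g : P.L2V) x⟫_ℂ ∂P.area := rfl

theorem inner_eq_integral_of_ae {f g : P.H} {f' g' : P.Sphere → P.V}
    (hf : (f : P.L2V) =ᵐ[P.area] f') (hg : (g : P.L2V) =ᵐ[P.area] g') :
    ⟪f, g⟫_ℂ = ∫ x, ⟪f' x, g' x⟫_ℂ ∂P.area := by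
  rw [inner_eq_integral]
  refine integral_congr_ae ?_
  filter_upwards [hf, hg] with x h1 h2
  rw [h1, h2]

theorem continuous_smoothSection (f : P.smoothSections) : Continuous (f : P.Sphere → P.V) := by
  obtain ⟨F, hF, h⟩ := f.2.1
  rw [show (f : P.Sphere → P.V) = fun x : P.Sphere => F (x : E3) from funext h]
  exact hF.continuous.comp continuous_subtype_val

/-- Nonempty open sets have positive area. Equality in the Hilbert space can therefore be read
pointwise, as analytic continuation requires. -/
theorem ofSmooth_injective : Function.Injective P.ofSmooth := by
  intro f g h
  apply Subtype.ext
  have h1 : (f : P.Sphere → P.V) =ᵐ[P.area] g :=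
    (ofSmooth_coe f).symm.trans (h ▸ ofSmooth_coe g)
  exact (continuous_smoothSection f).ae_eq_iff_eq _ (continuous_smoothSection g) |>.1 h1

theorem emb_eq_iff {F G : P.entireSections} :
    P.emb F = P.emb G ↔ ∀ x, (F : P.CFun) (P.toC x) = (G : P.CFun) (P.toC x) := by
  constructor
  · intro h x
    exact congrFun (congrArg Subtype.val (ofSmooth_injective h)) x
  · intro h
    exact congrArg P.ofSmooth (Subtype.ext (funext h))

theorem X_coe (j : Fin 3) (ψ : P.H) :
    ((P.X j ψ : P.H) : P.L2V) =ᵐ[P.area] fun x => P.toC x j • (ψ : P.L2V) x :=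
  (P.memLp_coord_smul j ψ).coeFn_toLp

theorem X_ofSmooth (j : Fin 3) (f : P.smoothSections) :
    P.X j (P.ofSmooth f) = P.ofSmooth (P.mulCoord j f) := by
  refine Subtype.ext (Lp.ext ?_)
  refine (X_coe j _).trans (Filter.EventuallyEq.trans ?_ (ofSmooth_coe _).symm)
  filter_upwards [ofSmooth_coe f] with x hx
  rw [hx]; rfl

theorem inner_X_left (j : Fin 3) (f g : P.H) : ⟪P.X j f, g⟫_ℂ = ⟪f, P.X j g⟫_ℂ := by
  rw [inner_eq_integral_of_ae (X_coe j f) Filter.EventuallyEq.rfl,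
    inner_eq_integral_of_ae Filter.EventuallyEq.rfl (X_coe j g)]
  refine integral_congr_ae (Filter.Eventually.of_forall fun x => ?_)
  simp [toC]

theorem norm_X_le (j : Fin 3) (f : P.H) : ‖P.X j f‖ ≤ P.r * ‖f‖ := by
  change ‖((P.X j f : P.H) : P.L2V)‖ ≤ P.r * ‖(f : P.L2V)‖
  refine Lp.norm_le_mul_norm_of_ae_le_mul ?_
  filter_upwards [X_coe j f] with x hx
  rw [hx, norm_smul]
  gcongr
  have h1 : ‖(x : E3) j‖ ≤ ‖(x : E3)‖ := PiLp.norm_apply_le _ j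
  have h2 : ‖(x : E3)‖ = P.r := by simp
  rw [toC, Complex.norm_real]
  exact h1.trans h2.le

theorem cmul_mem_entireSections {F : P.CFun} (hF : F ∈ P.entireSections) (k : Fin 3) :
    P.cmul k F ∈ P.entireSections :=
  ⟨hF.1.cmul k, fun x => Submodule.smul_mem _ _ (hF.2 x)⟩

theorem X_emb (j : Fin 3) (F : P.entireSections) :
    P.X j (P.emb F) = P.emb ⟨P.cmul j F, cmul_mem_entireSections F.2 j⟩ :=
  X_ofSmooth j _

theorem inner_emb_cangMom {F G F' G' : P.entireSections} (j : Fin 3)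
    (hF : (F' : P.CFun) = cangMom j F) (hG : (G' : P.CFun) = cangMom j G) :
    ⟪P.emb F', P.emb G⟫_ℂ = ⟪P.emb F, P.emb G'⟫_ℂ := by
  rw [inner_eq_integral_of_ae (emb_coe F') (emb_coe G),
    inner_eq_integral_of_ae (emb_coe F) (emb_coe G')]
  have h := integral_inner_angMom F.2.1.comp_complexify G.2.1.comp_complexify j
  simp only [angMom_comp_complexify F.2.1, angMom_comp_complexify G.2.1] at h
  simp only [hF, hG, toC_eq]
  exact h

/-! ### The levels span a dense subspace -/

theorem ae_eq_zero_of_forall_continuous {φ : P.Sphere → ℂ} (hφ : MemLp φ 2 P.area)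
    {A : StarSubalgebra ℂ C(P.Sphere, ℂ)} (hA : A.topologicalClosure = ⊤)
    (h : ∀ q ∈ A, ∫ x, (starRingEnd ℂ) (q x) * φ x ∂P.area = 0) : φ =ᵐ[P.area] 0 := by
  have hdense : DenseRange (ContinuousMap.toLp (E := ℂ) 2 P.area ℂ) :=
    ContinuousMap.toLp_denseRange ℂ P.area ℂ (by simp)
  have hAd : Dense (A : Set C(P.Sphere, ℂ)) := by
    rw [dense_iff_closure_eq, ← StarSubalgebra.topologicalClosure_coe, hA]
    rfl
  have hd : Dense (ContinuousMap.toLp (E := ℂ) 2 P.area ℂ '' (A : Set C(P.Sphere, ℂ))) :=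
    hdense.dense_image (ContinuousMap.toLp (E := ℂ) 2 P.area ℂ).continuous hAd
  have h0 : hφ.toLp φ = 0 := by
    have hcl : IsClosed {g : Lp ℂ 2 P.area | ⟪g, hφ.toLp φ⟫_ℂ = 0} :=
      isClosed_eq (by fun_prop) continuous_const
    have hsub : ContinuousMap.toLp (E := ℂ) 2 P.area ℂ '' (A : Set C(P.Sphere, ℂ)) ⊆
        {g : Lp ℂ 2 P.area | ⟪g, hφ.toLp φ⟫_ℂ = 0} := by
      rintro _ ⟨q, hq, rfl⟩
      rw [Set.mem_ofPred_eq, L2.inner_def, ← h q hq]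
      refine integral_congr_ae ?_
      filter_upwards [ContinuousMap.coeFn_toLp (p := 2) P.area (𝕜 := ℂ) q, hφ.coeFn_toLp]
        with x h1 h2
      rw [h1, h2]
      simp [mul_comm]
    have := hcl.closure_subset_iff.2 hsub
    rw [hd.closure_eq] at this
    exact inner_self_eq_zero.1 (this (Set.mem_univ (hφ.toLp φ)))
  have h1 := hφ.coeFn_toLp
  rw [h0] at h1
  exact h1.symm.trans (Lp.coeFn_zero ℂ 2 P.area)

variable (P) in
/-- The coordinate functions on the sphere. -/
def coordMap (j : Fin 3) : C(P.Sphere, ℂ) := ⟨fun x => P.toC x j, by unfold toC; fun_prop⟩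

theorem adjoin_coordMap_dense :
    (StarAlgebra.adjoin ℂ (Set.range P.coordMap)).topologicalClosure = ⊤ := by
  refine ContinuousMap.starSubalgebra_topologicalClosure_eq_top_of_separatesPoints _ ?_
  intro x y hxy
  by_contra hcon
  push Not at hcon
  apply hxy
  apply Subtype.ext
  ext j
  have := hcon (P.coordMap j) ⟨P.coordMap j, StarAlgebra.subset_adjoin ℂ _ ⟨j, rfl⟩, rfl⟩
  exact Complex.ofReal_injective this

/-- Multiplication by polynomials in the coordinates preserves the union of the levels. The
induction carries `q` and its conjugate together, to pass the star step. -/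
theorem exists_level_mul {q : C(P.Sphere, ℂ)}
    (hq : q ∈ StarAlgebra.adjoin ℂ (Set.range P.coordMap)) :
    ∀ n, ∀ F ∈ P.level n, ∃ m, ∃ G ∈ P.level m, ∀ x, G (P.toC x) = q x • F (P.toC x) := by
  let T : C(P.Sphere, ℂ) → Prop := fun q =>
    ∀ n, ∀ F ∈ P.level n, ∃ m, ∃ G ∈ P.level m, ∀ x, G (P.toC x) = q x • F (P.toC x)
  have hadd : ∀ p q, T p → T q → T (p + q) := by
    intro p q hp hq n F hF
    obtain ⟨m, G, hG, h⟩ := hp n F hF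
    obtain ⟨m', G', hG', h'⟩ := hq n F hF
    refine ⟨max m m', G + G', add_mem (level_mono (le_max_left _ _) hG)
      (level_mono (le_max_right _ _) hG'), fun x => ?_⟩
    simp [h, h', add_smul]
  have hmul : ∀ p q, T p → T q → T (p * q) := by
    intro p q hp hq n F hF
    obtain ⟨m, G, hG, h⟩ := hq n F hF
    obtain ⟨m', G', hG', h'⟩ := hp m G hG
    refine ⟨m', G', hG', fun x => ?_⟩
    simp [h, h', mul_smul]
  have hconst : ∀ c : ℂ, T (algebraMap ℂ _ c) := fun c n F hF =>
    ⟨n, c • F, Submodule.smul_mem _ _ hF, fun x => rfl⟩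
  have hcoord : ∀ j, T (P.coordMap j) := fun j n F hF =>
    ⟨n + 1, P.cmul j F, cmul_mem_level hF j, fun x => rfl⟩
  refine (StarAlgebra.adjoin_induction (p := fun q _ => T q ∧ T (star q)) ?_ ?_ ?_ ?_ ?_ hq).1
  · rintro _ ⟨j, rfl⟩
    refine ⟨hcoord j, ?_⟩
    have : star (P.coordMap j) = P.coordMap j := by
      ext x
      exact Complex.conj_ofReal _
    rw [this]
    exact hcoord j
  · intro c
    refine ⟨hconst c, ?_⟩
    have : star (algebraMap ℂ C(P.Sphere, ℂ) c) = algebraMap ℂ _ (star c) := by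
      ext x; rfl
    rw [this]
    exact hconst _
  · intro p q _ _ hp hq
    rw [star_add]
    exact ⟨hadd _ _ hp.1 hq.1, hadd _ _ hp.2 hq.2⟩
  · intro p q _ _ hp hq
    rw [star_mul]
    exact ⟨hmul _ _ hp.1 hq.1, hmul _ _ hq.2 hp.2⟩
  · intro p _ hp
    rw [star_star]
    exact ⟨hp.2, hp.1⟩

/-- Since `Π_x ψ(x) = ψ(x)` almost everywhere, pairing `ψ` with `q Π w` is pairing the scalar
function `⟨w, ψ⟩` with `q`; the polynomials `q` are dense by Stone-Weierstrass. -/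
theorem eq_zero_of_orthogonal_level {ψ : P.H}
    (h : ∀ n, ∀ F, ∀ hF : F ∈ P.level n, ⟪P.emb ⟨F, level_le_entireSections n hF⟩, ψ⟫_ℂ = 0) :
    ψ = 0 := by
  have hw : ∀ w : P.V, (fun x => ⟪w, (ψ : P.L2V) x⟫_ℂ) =ᵐ[P.area] 0 := by
    intro w
    have hmem : MemLp (fun x => ⟪w, (ψ : P.L2V) x⟫_ℂ) 2 P.area :=
      (innerSL ℂ w).comp_memLp' (Lp.memLp (ψ : P.L2V))
    refine ae_eq_zero_of_forall_continuous hmem adjoin_coordMap_dense fun q hq => ?_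
    obtain ⟨m, G, hG, hGq⟩ := exists_level_mul hq 1 _ (lowest_mem_level w 0)
    rw [← h m G hG, inner_eq_integral_of_ae (emb_coe _) Filter.EventuallyEq.rfl]
    refine integral_congr_ae ?_
    filter_upwards [ψ.2] with x hx
    have e1 : ⟪P.fibreProj (P.toC x) w, (ψ : P.L2V) x⟫_ℂ = ⟪w, (ψ : P.L2V) x⟫_ℂ := by
      conv_lhs => rw [← P.star_toC_eq x, P.inner_fibreProj, P.fibreProj_of_mem hx]
    simp only [hGq, lowest_apply, inner_smul_left, e1]
  have hall : ∀ᵐ x ∂P.area, ∀ i, ⟪(EuclideanSpace.basisFun (Fin (P.spin + 1)) ℂ) i,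
      (ψ : P.L2V) x⟫_ℂ = 0 := ae_all_iff.2 fun i => hw _
  refine Subtype.ext (Lp.ext ?_)
  refine Filter.EventuallyEq.trans ?_ (Lp.coeFn_zero P.V 2 P.area).symm
  filter_upwards [hall] with x hx
  ext i
  have := hx i
  rw [EuclideanSpace.basisFun_apply, EuclideanSpace.inner_single_left] at this
  simpa using this

end Params

namespace Params
variable (P : Params)

/-! ### The spectral decomposition of `Ĵ²` -/

/-- The restriction to the sphere of the functions in a level. -/
def embLevel (n : ℕ) : P.level n →ₗ[ℂ] P.H :=
  P.emb ∘ₗ Submodule.inclusion (level_le_entireSections n)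

/-- The levels as subspaces of the Hilbert space. -/
def hlevel (n : ℕ) : Submodule ℂ P.H := LinearMap.range (P.embLevel n)

instance (n : ℕ) : FiniteDimensional ℂ (P.hlevel n) := by
  unfold hlevel; infer_instance

instance (n : ℕ) : CompleteSpace (P.hlevel n) := FiniteDimensional.complete ℂ _

instance (n : ℕ) : (P.hlevel n).HasOrthogonalProjection :=
  Submodule.HasOrthogonalProjection.ofCompleteSpace _

/-- The part of a level orthogonal to the preceding one. -/
def band (n : ℕ) : Submodule ℂ P.H := P.hlevel (n + 1) ⊓ (P.hlevel n)ᗮ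

instance (n : ℕ) : FiniteDimensional ℂ (P.band n) :=
  Submodule.finiteDimensional_of_le (inf_le_left : P.band n ≤ P.hlevel (n + 1))

instance (n : ℕ) : CompleteSpace (P.band n) := FiniteDimensional.complete ℂ _

instance (n : ℕ) : (P.band n).HasOrthogonalProjection :=
  Submodule.HasOrthogonalProjection.ofCompleteSpace _

variable {P}

theorem hinner_smul_left (c : ℂ) (f g : P.H) : ⟪c • f, g⟫_ℂ = (starRingEnd ℂ) c * ⟪f, g⟫_ℂ :=
  inner_smul_left (E := P.H) f g c

theorem hinner_smul_right (c : ℂ) (f g : P.H) : ⟪f, c • g⟫_ℂ = c * ⟪f, g⟫_ℂ :=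
  inner_smul_right (E := P.H) f g c

theorem embLevel_mem {n : ℕ} (F : P.level n) : P.embLevel n F ∈ P.hlevel n := ⟨F, rfl⟩

theorem embLevel_eq_iff {m n : ℕ} {F : P.level m} {G : P.level n} :
    P.embLevel m F = P.embLevel n G ↔ ∀ x, (F : P.CFun) (P.toC x) = (G : P.CFun) (P.toC x) :=
  emb_eq_iff

theorem embLevel_coe {n : ℕ} (F : P.level n) :
    ((P.embLevel n F : P.H) : P.L2V) =ᵐ[P.area] fun x => (F : P.CFun) (P.toC x) :=
  emb_coe _

theorem hlevel_zero : P.hlevel 0 = ⊥ := by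
  rw [hlevel, LinearMap.range_eq_bot]
  ext1 F
  have : F = 0 := Subtype.ext ((Submodule.mem_bot ℂ).1 F.2)
  rw [this, map_zero, LinearMap.zero_apply]

theorem hlevel_mono : Monotone P.hlevel := by
  rintro m n hmn _ ⟨F, rfl⟩
  exact ⟨⟨F, level_mono hmn F.2⟩, rfl⟩

theorem X_mem_hlevel {n : ℕ} {ψ : P.H} (hψ : ψ ∈ P.hlevel n) (j : Fin 3) :
    P.X j ψ ∈ P.hlevel (n + 1) := by
  obtain ⟨F, rfl⟩ := hψ
  exact ⟨⟨P.cmul j F, cmul_mem_level F.2 j⟩, (X_emb j (Submodule.inclusion (level_le_entireSections n) F)).symm⟩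

/-- The angular momentum on a level. -/
def levelMom {n : ℕ} (j : Fin 3) (F : P.level n) : P.level n :=
  ⟨cangMom j F, cangMom_mem_level F.2 j⟩

/-- The square of the angular momentum on a level. -/
def levelMomSq {n : ℕ} (F : P.level n) : P.level n := ∑ j, levelMom j (levelMom j F)

theorem levelMomSq_coe {n : ℕ} (F : P.level n) : (levelMomSq F : P.CFun) = cangMomSq F := by
  ext1 a
  simp [levelMomSq, levelMom, cangMomSq]

theorem inner_embLevel_levelMom {m n : ℕ} (F : P.level m) (G : P.level n) (j : Fin 3) :
    ⟪P.embLevel m (levelMom j F), P.embLevel n G⟫_ℂ =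
      ⟪P.embLevel m F, P.embLevel n (levelMom j G)⟫_ℂ :=
  inner_emb_cangMom (F := Submodule.inclusion (level_le_entireSections m) F)
    (G := Submodule.inclusion (level_le_entireSections n) G) j rfl rfl

theorem inner_embLevel_levelMomSq {m n : ℕ} (F : P.level m) (G : P.level n) :
    ⟪P.embLevel m (levelMomSq F), P.embLevel n G⟫_ℂ =
      ⟪P.embLevel m F, P.embLevel n (levelMomSq G)⟫_ℂ := by
  unfold levelMomSq
  rw [map_sum, map_sum, sum_inner, inner_sum]
  refine Finset.sum_congr rfl fun j _ => ?_
  rw [inner_embLevel_levelMom, inner_embLevel_levelMom]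

/-- Write `Ĵ² F = c F + g` with `g` one level lower. As `Ĵ²` is symmetric and preserves that level,
to which `F` is orthogonal, `g` is orthogonal to itself. -/
theorem cangMomSq_of_mem_band {n : ℕ} {F : P.level (n + 1)} (h : P.embLevel (n + 1) F ∈ P.band n)
    (x : P.Sphere) : cangMomSq F (P.toC x) = (P.eig n : ℂ) • (F : P.CFun) (P.toC x) := by
  revert x
  have hF := h.2
  obtain ⟨G, hG, hFG⟩ := cangMomSq_level n F.2
  set g : P.H := P.embLevel n ⟨G, hG⟩ with hg
  have h1 : P.embLevel (n + 1) (levelMomSq F) =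
      (P.eig n : ℂ) • P.embLevel (n + 1) F + g := by
    have : g = P.embLevel (n + 1) ⟨G, level_le_succ n hG⟩ := rfl
    rw [this, ← map_smul, ← map_add, embLevel_eq_iff, levelMomSq_coe]
    exact hFG
  have h2 : ⟪g, g⟫_ℂ = 0 := by
    have e1 : ⟪P.embLevel (n + 1) (levelMomSq F), g⟫_ℂ = 0 := by
      rw [hg, inner_embLevel_levelMomSq]
      exact (Submodule.mem_orthogonal' _ _).1 hF _ (embLevel_mem _)
    have e2 : ⟪P.embLevel (n + 1) F, g⟫_ℂ = 0 :=
      (Submodule.mem_orthogonal' _ _).1 hF _ (embLevel_mem _)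
    rwa [h1, inner_add_left, hinner_smul_left, e2, mul_zero, zero_add] at e1
  have h3 : g = 0 := (inner_self_eq_zero (𝕜 := ℂ) (E := P.H)).1 h2
  rw [h3, add_zero, ← map_smul, embLevel_eq_iff, levelMomSq_coe] at h1
  exact h1

theorem band_le_eigenspace (n : ℕ) : P.band n ≤ P.eigenspace (P.eig n) := by
  intro f hf
  obtain ⟨F, rfl⟩ := hf.1
  have hF := cangMomSq_of_mem_band hf
  have hc := contDiff_of_mem_level F.2
  refine Submodule.le_topologicalClosure _ (Submodule.subset_span
    ⟨fun x => (F : P.CFun) (complexify x), hc.comp_complexify, fun x => ?_, embLevel_coe F⟩)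
  rw [angMomSq_comp_complexify hc]
  exact (hF x).trans (Complex.coe_smul _ _)

theorem eigenspace_orthogonal {c c' : ℝ} (hc : c ≠ c') : P.eigenspace c ⟂ P.eigenspace c' := by
  unfold eigenspace
  have key : ∀ f g : P.H, (∃ F : E3 → P.V, ContDiff ℝ ∞ F ∧
      (∀ x : P.Sphere, P.angMomSq F x = c • F x) ∧ ∀ᵐ x ∂P.area, (f : P.L2V) x = F x) →
      (∃ F : E3 → P.V, ContDiff ℝ ∞ F ∧
      (∀ x : P.Sphere, P.angMomSq F x = c' • F x) ∧ ∀ᵐ x ∂P.area, (g : P.L2V) x = F x) →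
      ⟪f, g⟫_ℂ = 0 := by
    rintro f g ⟨F, hF, hF1, hF2⟩ ⟨G, hG, hG1, hG2⟩
    rw [inner_eq_integral_of_ae hF2 hG2]
    have h := integral_inner_angMomSq hF hG
    simp only [hF1, hG1, inner_smul_left_eq_smul, inner_smul_right_eq_smul] at h
    rw [integral_smul, integral_smul, ← sub_eq_zero, ← sub_smul] at h
    exact (smul_eq_zero.1 h).resolve_left (sub_ne_zero.2 hc)
  have h2 := Submodule.isOrtho_span.2 (fun f hf g hg => key f g hf hg)
  intro u hu
  rw [Submodule.orthogonal_closure]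
  exact Submodule.topologicalClosure_minimal _ h2 (Submodule.isClosed_orthogonal _) hu

theorem band_orthogonal {m n : ℕ} (h : m ≠ n) : P.band m ⟂ P.band n := by
  have key : ∀ m n, m < n → P.band m ⟂ P.band n := by
    intro m n hmn
    rw [Submodule.isOrtho_comm, Submodule.isOrtho_iff_le]
    refine inf_le_right.trans (Submodule.orthogonal_le ?_)
    exact inf_le_left.trans (hlevel_mono hmn)
  rcases lt_or_gt_of_ne h with h | h
  · exact key m n h
  · exact (key n m h).symm

theorem hlevel_succ_eq (n : ℕ) : P.hlevel (n + 1) = P.hlevel n ⊔ P.band n := by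
  rw [band, inf_comm]
  exact (Submodule.sup_orthogonal_inf_of_hasOrthogonalProjection (hlevel_mono n.le_succ)).symm

theorem eq_zero_of_orthogonal_band {ψ : P.H} (h : ∀ n, ∀ f ∈ P.band n, ⟪f, ψ⟫_ℂ = 0) :
    ψ = 0 := by
  have key : ∀ n, P.hlevel n ≤ (Submodule.span ℂ {ψ})ᗮ := by
    intro n
    induction n with
    | zero => rw [hlevel_zero]; exact bot_le
    | succ n ih =>
      rw [hlevel_succ_eq]
      refine sup_le ih fun f hf => ?_
      rw [Submodule.mem_orthogonal_singleton_iff_inner_left]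
      exact h n f hf
  refine eq_zero_of_orthogonal_level fun n F hF => ?_
  exact Submodule.mem_orthogonal_singleton_iff_inner_left.1 (key n (embLevel_mem ⟨F, hF⟩))

/-! ### Identification of the spectrum and its eigenspaces. -/

theorem eig_strictMono : StrictMono P.eig := by
  refine strictMono_nat_of_lt_succ fun n => ?_
  have h := P.hbar_pos
  unfold eig
  push_cast
  have h2 : (0 : ℝ) ≤ P.spin / 2 + n := by positivity
  gcongr <;> linarith

/-- An eigenvector minus its projection on the band is orthogonal to this band by construction and
to the other bands because their eigenvalues differ; the bands are total. -/
theorem eigenspace_eig (n : ℕ) : P.eigenspace (P.eig n) = P.band n := by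
  refine le_antisymm ?_ (band_le_eigenspace n)
  intro f hf
  have hp := (P.band n).starProjection_apply_mem f
  have h0 : f - (P.band n).starProjection f = 0 := by
    refine eq_zero_of_orthogonal_band fun m g hg => ?_
    by_cases hmn : m = n
    · subst hmn
      exact (P.band m).sub_starProjection_mem_orthogonal f g hg
    · rw [inner_sub_right]
      have h1 : ⟪g, f⟫_ℂ = 0 := (eigenspace_orthogonal (fun h => hmn
        (eig_strictMono.injective h))).inner_eq (band_le_eigenspace m hg) hf
      have h2 : ⟪g, (P.band n).starProjection f⟫_ℂ = 0 :=
        (band_orthogonal hmn).inner_eq hg hp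
      rw [h1, h2, sub_zero]
  rw [sub_eq_zero.1 h0]
  exact hp

theorem eigenspace_of_notMem {c : ℝ} (hc : c ∉ Set.range P.eig) : P.eigenspace c = ⊥ := by
  rw [eq_bot_iff]
  intro f hf
  refine (Submodule.mem_bot ℂ).2 (eq_zero_of_orthogonal_band fun n g hg => ?_)
  exact (eigenspace_orthogonal fun h => hc ⟨n, h⟩).inner_eq (band_le_eigenspace n hg) hf

variable (P) in
/-- The projection onto a band. -/
def proj (n : ℕ) : P.H →L[ℂ] P.H := (P.band n).starProjection

theorem starProjection_congr {K L : Submodule ℂ P.H} [K.HasOrthogonalProjection]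
    [L.HasOrthogonalProjection] (h : K = L) : K.starProjection = L.starProjection := by
  subst h; rfl

theorem specProj_eig (n : ℕ) : P.specProj (P.eig n) = P.proj n :=
  starProjection_congr (eigenspace_eig n)

theorem specProj_of_notMem {c : ℝ} (hc : c ∉ Set.range P.eig) : P.specProj c = 0 := by
  have : P.specProj c = (⊥ : Submodule ℂ P.H).starProjection :=
    starProjection_congr (eigenspace_of_notMem hc)
  rw [this, Submodule.starProjection_bot]

/-- The sum over all real numbers reduces to the eigenvalues, as the other spectral projections
vanish. -/
theorem mem_domain_iff {t : ℝ} {ψ : P.H} : ψ ∈ (P.expAngMomSq t).domain ↔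
    Summable fun n => ((Real.exp (t * P.eig n) : ℝ) : ℂ) • P.proj n ψ := by
  change (Summable fun c : ℝ => ((Real.exp (t * c) : ℝ) : ℂ) • P.specProj c ψ) ↔ _
  rw [← (eig_strictMono (P := P)).injective.summable_iff]
  · simp only [Function.comp_def, specProj_eig]
  · intro c hc
    rw [specProj_of_notMem hc]; simp

theorem expAngMomSq_apply {t : ℝ} (ψ : (P.expAngMomSq t).domain) :
    P.expAngMomSq t ψ = ∑' n, ((Real.exp (t * P.eig n) : ℝ) : ℂ) • P.proj n ψ := by
  change ∑' c : ℝ, ((Real.exp (t * c) : ℝ) : ℂ) • P.specProj c (ψ : P.H) = _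
  rw [← (eig_strictMono (P := P)).injective.tsum_eq]
  · simp only [specProj_eig]
  · intro c hc
    by_contra hcon
    rw [Function.mem_support, specProj_of_notMem hcon] at hc
    simp at hc

end Params

namespace Params
variable (P : Params)

/-! ### Great circles and analytic continuation -/

theorem exists_unit_orthogonal (e : E3) : ∃ f : E3, ‖f‖ = 1 ∧ ⟪e, f⟫_ℝ = 0 := by
  have h : (Submodule.span ℝ {e})ᗮ ≠ ⊥ := by
    intro h0
    have h1 := Submodule.finrank_add_finrank_orthogonal (Submodule.span ℝ {e})
    rw [h0, finrank_bot, finrank_euclideanSpace_fin] at h1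
    have h2 : Module.finrank ℝ (Submodule.span ℝ {e}) ≤ 1 := by
      simpa using finrank_span_le_card (R := ℝ) {e}
    omega
  obtain ⟨f, hf, hf0⟩ := Submodule.exists_mem_ne_zero_of_ne_bot h
  rw [Submodule.mem_orthogonal_singleton_iff_inner_right] at hf
  have hn : ‖f‖ ≠ 0 := norm_ne_zero_iff.2 hf0
  refine ⟨‖f‖⁻¹ • f, ?_, ?_⟩
  · rw [norm_smul, norm_inv, norm_norm, inv_mul_cancel₀ hn]
  · rw [inner_smul_right, hf, mul_zero]

theorem exists_unit_orthogonal_smul {e p : E3} (he : ‖e‖ = 1) (hp : ⟪e, p⟫_ℝ = 0) :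
    ∃ f : E3, ‖f‖ = 1 ∧ ⟪e, f⟫_ℝ = 0 ∧ p = ‖p‖ • f := by
  by_cases h : p = 0
  · obtain ⟨f, hf1, hf2⟩ := exists_unit_orthogonal e
    exact ⟨f, hf1, hf2, by simp [h]⟩
  · have hn : ‖p‖ ≠ 0 := norm_ne_zero_iff.2 h
    refine ⟨‖p‖⁻¹ • p, ?_, ?_, ?_⟩
    · rw [norm_smul, norm_inv, norm_norm, inv_mul_cancel₀ hn]
    · rw [inner_smul_right, hp, mul_zero]
    · rw [smul_smul, mul_inv_cancel₀ hn, one_smul]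

/-- The complexified great circle through two orthogonal directions. -/
def greatCircle (e f : E3) (θ : ℂ) : Fin 3 → ℂ := fun j =>
  P.r * (Complex.cos θ * (e j : ℂ) + Complex.sin θ * (f j : ℂ))

variable {P}

theorem hasDerivAt_greatCircle (e f : E3) (θ : ℂ) : HasDerivAt (P.greatCircle e f)
    (fun j => P.r * (-Complex.sin θ * (e j : ℂ) + Complex.cos θ * (f j : ℂ))) θ := by
  rw [hasDerivAt_pi]
  intro j
  exact (((Complex.hasDerivAt_cos θ).mul_const _).add
    ((Complex.hasDerivAt_sin θ).mul_const _)).const_mul _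

theorem greatCircle_real (e f : E3) (θ : ℝ) :
    P.greatCircle e f θ = complexify (P.r • (Real.cos θ • e + Real.sin θ • f)) := by
  ext j
  simp [greatCircle, complexify_apply]
  ring

theorem sum_sq_of_norm {e : E3} (he : ‖e‖ = 1) : e 0 ^ 2 + e 1 ^ 2 + e 2 ^ 2 = 1 := by
  have h : ‖e‖ ^ 2 = 1 := by rw [he, one_pow]
  rw [EuclideanSpace.norm_sq_eq, Fin.sum_univ_three] at h
  simpa using h

theorem inner_eq_coord (e f : E3) : ⟪e, f⟫_ℝ = e 0 * f 0 + e 1 * f 1 + e 2 * f 2 := by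
  rw [PiLp.inner_apply, Fin.sum_univ_three]
  simp [mul_comm]

theorem greatCircle_mem {e f : E3} (he : ‖e‖ = 1) (hf : ‖f‖ = 1) (hef : ⟪e, f⟫_ℝ = 0) (θ : ℂ) :
    P.greatCircle e f θ ∈ P.sphereC := by
  have h1 : (e 0 : ℂ) ^ 2 + (e 1 : ℂ) ^ 2 + (e 2 : ℂ) ^ 2 = 1 := by
    simpa using congrArg Complex.ofReal (sum_sq_of_norm he)
  have h2 : (f 0 : ℂ) ^ 2 + (f 1 : ℂ) ^ 2 + (f 2 : ℂ) ^ 2 = 1 := by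
    simpa using congrArg Complex.ofReal (sum_sq_of_norm hf)
  have h3 : (e 0 : ℂ) * f 0 + (e 1 : ℂ) * f 1 + (e 2 : ℂ) * f 2 = 0 := by
    rw [inner_eq_coord] at hef; exact_mod_cast hef
  change ∑ j, P.greatCircle e f θ j ^ 2 = (P.r : ℂ) ^ 2
  rw [Fin.sum_univ_three]
  simp only [greatCircle]
  linear_combination (P.r : ℂ) ^ 2 * (Complex.cos θ ^ 2 * h1 + Complex.sin θ ^ 2 * h2 +
    2 * Complex.cos θ * Complex.sin θ * h3 + Complex.sin_sq_add_cos_sq θ)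

/-- The point of a great circle at a real angle. -/
def circlePoint {e f : E3} (he : ‖e‖ = 1) (hf : ‖f‖ = 1) (hef : ⟪e, f⟫_ℝ = 0) (θ : ℝ) :
    P.Sphere :=
  ⟨P.r • (Real.cos θ • e + Real.sin θ • f), by
    have h : ‖Real.cos θ • e + Real.sin θ • f‖ ^ 2 = 1 := by
      rw [norm_add_sq_real, norm_smul, norm_smul, inner_smul_left, inner_smul_right, hef, he, hf]
      simp
    have h2 : ‖Real.cos θ • e + Real.sin θ • f‖ = 1 := by
      have := norm_nonneg (Real.cos θ • e + Real.sin θ • f)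
      nlinarith
    rw [mem_sphere_zero_iff_norm, norm_smul, h2, mul_one, Real.norm_eq_abs, abs_of_pos P.r_pos]⟩

theorem toC_circlePoint {e f : E3} (he : ‖e‖ = 1) (hf : ‖f‖ = 1) (hef : ⟪e, f⟫_ℝ = 0) (θ : ℝ) :
    P.toC (circlePoint he hf hef θ) = P.greatCircle e f θ := (greatCircle_real e f θ).symm

theorem exists_circle_through (x y : P.Sphere) : ∃ e f : E3, ∃ he : ‖e‖ = 1, ∃ hf : ‖f‖ = 1,
    ∃ hef : ⟪e, f⟫_ℝ = 0, ∃ θ : ℝ, x = circlePoint he hf hef 0 ∧ y = circlePoint he hf hef θ := by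
  have hr := P.r_pos
  have hx : ‖(x : E3)‖ = P.r := by simp
  have hy : ‖(y : E3)‖ = P.r := by simp
  set e : E3 := P.r⁻¹ • (x : E3) with he'
  set z : E3 := P.r⁻¹ • (y : E3) with hz'
  have he : ‖e‖ = 1 := by rw [he', norm_smul, hx]; simp [abs_of_pos hr, hr.ne']
  have hz : ‖z‖ = 1 := by rw [hz', norm_smul, hy]; simp [abs_of_pos hr, hr.ne']
  set c : ℝ := ⟪e, z⟫_ℝ with hc
  have hp : ⟪e, z - c • e⟫_ℝ = 0 := by
    rw [inner_sub_right, real_inner_smul_right e e c, real_inner_self_eq_norm_sq, he]; simp [hc]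
  obtain ⟨f, hf, hef, hpf⟩ := exists_unit_orthogonal_smul he hp
  have hnorm : ‖z - c • e‖ ^ 2 = 1 - c ^ 2 := by
    rw [norm_sub_sq_real, real_inner_smul_right z e c, real_inner_comm, ← hc, norm_smul c e, hz, he,
      Real.norm_eq_abs, mul_one, sq_abs]
    ring
  have hc1 : c ^ 2 ≤ 1 := by nlinarith [sq_nonneg ‖z - c • e‖]
  have hsin : Real.sin (Real.arccos c) = ‖z - c • e‖ := by
    rw [Real.sin_arccos, ← hnorm, Real.sqrt_sq (norm_nonneg _)]
  have hcos : Real.cos (Real.arccos c) = c := by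
    have := abs_le.1 (sq_le_one_iff_abs_le_one c |>.1 hc1)
    exact Real.cos_arccos this.1 this.2
  refine ⟨e, f, he, hf, hef, Real.arccos c, ?_, ?_⟩
  · apply Subtype.ext
    simp [circlePoint, he', smul_smul, hr.ne']
  · apply Subtype.ext
    simp only [circlePoint]
    rw [hcos, hsin, ← hpf, add_sub_cancel, hz', smul_smul, mul_inv_cancel₀ hr.ne', one_smul]

/-- For `a = u + i w` the sphere equation says `|u|² - |w|² = r²` and `u ⟂ w`, so `a = r (cosh τ e +
i sinh τ f)`, the point at angle `i τ` of a great circle. -/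
theorem exists_circle_complex {a : Fin 3 → ℂ} (ha : a ∈ P.sphereC) : ∃ e f : E3, ‖e‖ = 1 ∧
    ‖f‖ = 1 ∧ ⟪e, f⟫_ℝ = 0 ∧ ∃ τ : ℝ, 0 ≤ τ ∧ a = P.greatCircle e f (Complex.I * τ) ∧
      P.r * Real.exp τ ≤ 4 * ‖a‖ := by
  have hr := P.r_pos
  set u : E3 := WithLp.toLp 2 fun j => (a j).re with hu
  set w : E3 := WithLp.toLp 2 fun j => (a j).im with hw
  have haj : ∀ j, a j = (u j : ℂ) + Complex.I * (w j : ℂ) := by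
    intro j
    rw [mul_comm]
    exact (Complex.re_add_im (a j)).symm
  have hsum : ∑ j, a j ^ 2 = (P.r : ℂ) ^ 2 := ha
  rw [Fin.sum_univ_three] at hsum
  have hre := congrArg Complex.re hsum
  have him := congrArg Complex.im hsum
  simp only [haj, pow_two] at hre him
  simp at hre him
  have hu2 : ‖u‖ ^ 2 = u 0 ^ 2 + u 1 ^ 2 + u 2 ^ 2 := by
    rw [EuclideanSpace.norm_sq_eq, Fin.sum_univ_three]; simp
  have hw2 : ‖w‖ ^ 2 = w 0 ^ 2 + w 1 ^ 2 + w 2 ^ 2 := by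
    rw [EuclideanSpace.norm_sq_eq, Fin.sum_univ_three]; simp
  have hdiff : ‖u‖ ^ 2 - ‖w‖ ^ 2 = P.r ^ 2 := by rw [hu2, hw2]; linear_combination hre
  have horth : ⟪u, w⟫_ℝ = 0 := by rw [inner_eq_coord]; linarith
  have hu0 : 0 < ‖u‖ := by
    rcases (norm_nonneg u).eq_or_lt with h | h
    · rw [← h] at hdiff; nlinarith [sq_nonneg ‖w‖]
    · exact h
  set e : E3 := ‖u‖⁻¹ • u with he'
  have he : ‖e‖ = 1 := by rw [he', norm_smul, norm_inv, norm_norm, inv_mul_cancel₀ hu0.ne']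
  have hew : ⟪e, w⟫_ℝ = 0 := by rw [he', inner_smul_left, horth, mul_zero]
  obtain ⟨f, hf, hef, hwf⟩ := exists_unit_orthogonal_smul he hew
  have hue : u = ‖u‖ • e := by rw [he', smul_smul, mul_inv_cancel₀ hu0.ne', one_smul]
  set τ := Real.arsinh (‖w‖ / P.r) with hτ
  have hsinh : P.r * Real.sinh τ = ‖w‖ := by
    rw [hτ, Real.sinh_arsinh]; field_simp
  have hcosh : P.r * Real.cosh τ = ‖u‖ := by
    have h1 : (P.r * Real.cosh τ) ^ 2 = ‖u‖ ^ 2 := by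
      have h2 := Real.cosh_sq τ
      have h3 : P.r ^ 2 * Real.sinh τ ^ 2 = ‖w‖ ^ 2 := by rw [← hsinh]; ring
      rw [mul_pow, h2, mul_add, h3]; linarith
    exact (sq_eq_sq₀ (by have := Real.cosh_pos τ; positivity) hu0.le).1 h1
  have hτ0 : 0 ≤ τ := Real.arsinh_nonneg_iff.2 (by positivity)
  refine ⟨e, f, he, hf, hef, τ, hτ0, ?_, ?_⟩
  · ext j
    have h1 : u j = ‖u‖ * e j := congrFun (congrArg WithLp.ofLp hue) j
    have h2 : w j = ‖w‖ * f j := congrFun (congrArg WithLp.ofLp hwf) j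
    rw [haj, h1, h2, ← hcosh, ← hsinh, greatCircle, mul_comm Complex.I (τ : ℂ),
      Complex.cos_mul_I, Complex.sin_mul_I]
    push_cast
    ring
  · have h1 : Real.exp τ ≤ 2 * Real.cosh τ := by
      rw [Real.cosh_eq]
      have := Real.exp_pos (-τ)
      linarith
    -- `‖a‖` is the sup norm, so `|u|² ≤ 3 ‖a‖²`.
    have h2 : ‖u‖ ≤ 2 * ‖a‖ := by
      have h3 : ∀ j, u j ^ 2 ≤ ‖a‖ ^ 2 := by
        intro j
        rw [← sq_abs]
        have h4 : |u j| ≤ ‖a‖ := (Complex.abs_re_le_norm (a j)).trans (norm_le_pi_norm a j)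
        gcongr
      have h5 : ‖u‖ ^ 2 ≤ (2 * ‖a‖) ^ 2 := by
        rw [hu2]
        nlinarith [h3 0, h3 1, h3 2, sq_nonneg ‖a‖]
      exact (sq_le_sq₀ hu0.le (by positivity)).1 h5
    calc P.r * Real.exp τ ≤ P.r * (2 * Real.cosh τ) := by gcongr
      _ = 2 * ‖u‖ := by rw [← hcosh]; ring
      _ ≤ 4 * ‖a‖ := by linarith

/-- On the complexified great circle through `a` this is a one-variable entire function that
vanishes at all real angles. -/
theorem eq_zero_of_real {E : Type*} [NormedAddCommGroup E] [NormedSpace ℂ E] [CompleteSpace E]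
    {F : (Fin 3 → ℂ) → E} (hF : Differentiable ℂ F) (h : ∀ x : P.Sphere, F (P.toC x) = 0)
    {a : Fin 3 → ℂ} (ha : a ∈ P.sphereC) : F a = 0 := by
  obtain ⟨e, f, he, hf, hef, τ, -, rfl, -⟩ := exists_circle_complex ha
  have hd : Differentiable ℂ fun θ => F (P.greatCircle e f θ) := fun θ =>
    (hF _).comp θ (hasDerivAt_greatCircle e f θ).differentiableAt
  have han : AnalyticOnNhd ℂ (fun θ => F (P.greatCircle e f θ)) Set.univ :=
    fun θ _ => hd.analyticAt θ
  have hfreq : ∃ᶠ z in nhdsWithin (0 : ℂ) {0}ᶜ, F (P.greatCircle e f z) = 0 := by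
    have hreal : ∀ t : ℝ, F (P.greatCircle e f t) = 0 := fun t => by
      rw [← toC_circlePoint he hf hef t]; exact h _
    have ht : Filter.Tendsto (fun t : ℝ => (t : ℂ)) (nhdsWithin 0 {0}ᶜ)
        (nhdsWithin (0 : ℂ) {0}ᶜ) := by
      refine tendsto_nhdsWithin_iff.2 ⟨?_, ?_⟩
      · have : Filter.Tendsto (fun t : ℝ => (t : ℂ)) (nhds 0) (nhds ((0 : ℝ) : ℂ)) :=
          Complex.continuous_ofReal.tendsto 0
        rw [Complex.ofReal_zero] at this
        exact this.mono_left nhdsWithin_le_nhds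
      · filter_upwards [self_mem_nhdsWithin] with t ht
        simpa using ht
    exact ht.frequently (Filter.Frequently.of_forall hreal)
  exact han.eqOn_zero_of_preconnected_of_frequently_eq_zero isPreconnected_univ
    (Set.mem_univ 0) hfreq (Set.mem_univ _)

theorem eq_on_sphereC {F G : P.CFun} (hF : ContDiff ℂ ∞ F) (hG : ContDiff ℂ ∞ G)
    (h : ∀ x : P.Sphere, F (P.toC x) = G (P.toC x)) {a : Fin 3 → ℂ} (ha : a ∈ P.sphereC) :
    F a = G a := by
  have := eq_zero_of_real (F := fun a => F a - G a)
    ((hF.differentiable (by simp)).sub (hG.differentiable (by simp)))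
    (fun x => sub_eq_zero.2 (h x)) ha
  exact sub_eq_zero.1 this

/-- The derivative of an entire function along a great circle. -/
theorem hasDerivAt_comp_greatCircle {F : P.CFun} (hF : ContDiff ℂ ∞ F) {e f : E3}
    (he : ‖e‖ = 1) (hf : ‖f‖ = 1) (hef : ⟪e, f⟫_ℝ = 0) (θ : ℂ) :
    HasDerivAt (fun θ => F (P.greatCircle e f θ))
      ((Complex.I / P.hbar) • ∑ j : Fin 3,
        ((e (j + 1) * f (j + 2) - e (j + 2) * f (j + 1) : ℝ) : ℂ) •
        (cangMom j F (P.greatCircle e f θ) - P.σ j (F (P.greatCircle e f θ)))) θ := by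
  have h := (hF.cdiffAt (P.greatCircle e f θ)).hasFDerivAt.comp_hasDerivAt θ
    (hasDerivAt_greatCircle e f θ)
  refine h.congr_deriv ?_
  set a := P.greatCircle e f θ with ha
  have h1 : (e 0 : ℂ) ^ 2 + (e 1 : ℂ) ^ 2 + (e 2 : ℂ) ^ 2 = 1 := by
    simpa using congrArg Complex.ofReal (sum_sq_of_norm he)
  have h2 : (f 0 : ℂ) ^ 2 + (f 1 : ℂ) ^ 2 + (f 2 : ℂ) ^ 2 = 1 := by
    simpa using congrArg Complex.ofReal (sum_sq_of_norm hf)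
  have h3 : (e 0 : ℂ) * f 0 + (e 1 : ℂ) * f 1 + (e 2 : ℂ) * f 2 = 0 := by
    rw [inner_eq_coord] at hef; exact_mod_cast hef
  have hD : ∀ j, (Complex.I / P.hbar) • (cangMom j F a - P.σ j (F a)) =
      a (j + 1) • cpartial (j + 2) F a - a (j + 2) • cpartial (j + 1) F a := by
    intro j
    rw [cangMom, add_sub_cancel_right, smul_smul]
    have : Complex.I / (P.hbar : ℂ) * -(Complex.I * P.hbar) = 1 := by
      have := P.hbar_ne_zero
      field_simp
      simp
    rw [this, one_smul]
  simp only [Finset.smul_sum, smul_comm (Complex.I / (P.hbar : ℂ)), hD]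
  have hv : ∀ v : Fin 3 → ℂ, fderiv ℂ F a v =
      v 0 • cpartial 0 F a + v 1 • cpartial 1 F a + v 2 • cpartial 2 F a := by
    intro v
    have hvs : v = v 0 • Pi.single 0 (1 : ℂ) + v 1 • Pi.single 1 (1 : ℂ) +
        v 2 • Pi.single 2 (1 : ℂ) := by
      ext j
      fin_cases j <;> simp
    conv_lhs => rw [hvs]
    simp only [map_add, map_smul, cpartial]
  rw [hv, Fin.sum_univ_three]
  simp only [zero_add, show (1 + 1 : Fin 3) = 2 from rfl, show (1 + 2 : Fin 3) = 0 from rfl,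
    show (2 + 1 : Fin 3) = 0 from rfl, show (2 + 2 : Fin 3) = 1 from rfl]
  have ea : ∀ j, a j = P.r * (Complex.cos θ * (e j : ℂ) + Complex.sin θ * (f j : ℂ)) := fun j => rfl
  simp only [ea]
  push_cast
  -- The velocity of the circle is `(e × f) × a`; comparing coefficients of the partial derivatives
  -- is the triple product expansion for orthonormal `e`, `f`.
  match_scalars
  · linear_combination
      (P.r : ℂ) * (Complex.sin θ * (e 0 * h2 - f 0 * h3) - Complex.cos θ * (f 0 * h1 - e 0 * h3))
  · linear_combination
      (P.r : ℂ) * (Complex.sin θ * (e 1 * h2 - f 1 * h3) - Complex.cos θ * (f 1 * h1 - e 1 * h3))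
  · linear_combination
      (P.r : ℂ) * (Complex.sin θ * (e 2 * h2 - f 2 * h3) - Complex.cos θ * (f 2 * h1 - e 2 * h3))

end Params

namespace Params
variable (P : Params)

/-! ### Bounds on the reproducing kernels of the eigenspaces -/

/-- An orthonormal basis of an eigenspace. -/
def bandBasis (n : ℕ) : OrthonormalBasis (Fin (Module.finrank ℂ (P.band n))) ℂ (P.band n) :=
  stdOrthonormalBasis ℂ (P.band n)

/-- The entire functions which represent the basis of an eigenspace. -/
def bandFun (n : ℕ) (i : Fin (Module.finrank ℂ (P.band n))) : P.level (n + 1) :=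
  ((P.bandBasis n i).2.1).choose

variable {P}

theorem embLevel_bandFun (n : ℕ) (i : Fin (Module.finrank ℂ (P.band n))) :
    P.embLevel (n + 1) (P.bandFun n i) = P.bandBasis n i :=
  ((P.bandBasis n i).2.1).choose_spec

theorem contDiff_level {n : ℕ} (F : P.level n) : ContDiff ℂ ∞ (F : P.CFun) :=
  contDiff_of_mem_level F.2

theorem levelMom_add {n : ℕ} (j : Fin 3) (F G : P.level n) :
    levelMom j (F + G) = levelMom j F + levelMom j G :=
  Subtype.ext (cangMom_add (contDiff_level F) (contDiff_level G) j)

theorem levelMom_smul {n : ℕ} (j : Fin 3) (c : ℂ) (F : P.level n) :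
    levelMom j (c • F) = c • levelMom j F :=
  Subtype.ext (cangMom_smul c (contDiff_level F) j)

variable (P) in
/-- The angular momentum on a level as a linear map. -/
def levelMomₗ (n : ℕ) (j : Fin 3) : P.level n →ₗ[ℂ] P.level n where
  toFun := levelMom j
  map_add' := levelMom_add j
  map_smul' := levelMom_smul j

theorem levelMom_sum {n : ℕ} {ι : Type*} (s : Finset ι) (j : Fin 3) (F : ι → P.level n) :
    levelMom j (∑ i ∈ s, F i) = ∑ i ∈ s, levelMom j (F i) :=
  map_sum (P.levelMomₗ n j) F s

/-- A symmetric operator that preserves both levels preserves the orthogonal complement of one in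
the other. -/
theorem embLevel_levelMom_mem_band {n : ℕ} {F : P.level (n + 1)}
    (h : P.embLevel (n + 1) F ∈ P.band n) (j : Fin 3) :
    P.embLevel (n + 1) (levelMom j F) ∈ P.band n := by
  refine ⟨embLevel_mem _, (Submodule.mem_orthogonal _ _).2 ?_⟩
  rintro _ ⟨G, rfl⟩
  rw [← inner_embLevel_levelMom]
  exact (Submodule.mem_orthogonal _ _).1 h.2 _ (embLevel_mem _)

/-- By symmetry `∑ ‖Ĵ_k F‖² = ⟨F, Ĵ² F⟩`, which is the eigenvalue times `‖F‖²`. -/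
theorem norm_embLevel_levelMom_le {n : ℕ} {F : P.level (n + 1)}
    (h : P.embLevel (n + 1) F ∈ P.band n) (j : Fin 3) :
    ‖P.embLevel (n + 1) (levelMom j F)‖ ≤ Real.sqrt (P.eig n) * ‖P.embLevel (n + 1) F‖ := by
  have h1 : P.embLevel (n + 1) (levelMomSq F) = (P.eig n : ℂ) • P.embLevel (n + 1) F := by
    rw [← map_smul, embLevel_eq_iff, levelMomSq_coe]
    exact cangMomSq_of_mem_band h
  have h2 : ∑ k, ‖P.embLevel (n + 1) (levelMom k F)‖ ^ 2 =
      P.eig n * ‖P.embLevel (n + 1) F‖ ^ 2 := by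
    have h3 : ⟪P.embLevel (n + 1) F, P.embLevel (n + 1) (levelMomSq F)⟫_ℂ =
        ∑ k, ((‖P.embLevel (n + 1) (levelMom k F)‖ ^ 2 : ℝ) : ℂ) := by
      rw [levelMomSq, map_sum, inner_sum]
      refine Finset.sum_congr rfl fun k _ => ?_
      rw [← inner_embLevel_levelMom, inner_self_eq_norm_sq_to_K (E := P.H)]
      simp
    rw [h1, hinner_smul_right, inner_self_eq_norm_sq_to_K (E := P.H)] at h3
    have h4 := congrArg Complex.re h3
    simp only [← Complex.ofReal_sum, Complex.ofReal_re] at h4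
    rw [← h4, Complex.re_ofReal_mul]
    norm_cast
  have h3 : ‖P.embLevel (n + 1) (levelMom j F)‖ ^ 2 ≤
      ∑ k, ‖P.embLevel (n + 1) (levelMom k F)‖ ^ 2 :=
    Finset.single_le_sum (f := fun k => ‖P.embLevel (n + 1) (levelMom k F)‖ ^ 2)
      (fun k _ => sq_nonneg _) (Finset.mem_univ j)
  have he : 0 ≤ P.eig n := by have := P.hbar_pos; unfold eig; positivity
  refine le_of_sq_le_sq ?_ (by positivity)
  rw [mul_pow, Real.sq_sqrt he, ← h2]
  exact h3

theorem inner_embLevel_levelMom_im {n : ℕ} (F : P.level n) (j : Fin 3) :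
    (⟪P.embLevel n F, P.embLevel n (levelMom j F)⟫_ℂ).im = 0 := by
  have h := inner_embLevel_levelMom F F j
  rw [← inner_conj_symm (E := P.H)] at h
  exact Complex.conj_eq_iff_im.1 h

/-- The expansion in the basis holds in the Hilbert space, hence pointwise on the real sphere, and
continues to the complex sphere. -/
theorem bandFun_expand {n : ℕ} {F : P.level (n + 1)} (h : P.embLevel (n + 1) F ∈ P.band n)
    {a : Fin 3 → ℂ} (ha : a ∈ P.sphereC) :
    (F : P.CFun) a = ∑ k, ⟪P.embLevel (n + 1) (P.bandFun n k), P.embLevel (n + 1) F⟫_ℂ •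
      (P.bandFun n k : P.CFun) a := by
  have h1 : P.embLevel (n + 1) F = P.embLevel (n + 1)
      (∑ k, ⟪P.embLevel (n + 1) (P.bandFun n k), P.embLevel (n + 1) F⟫_ℂ • P.bandFun n k) := by
    have h2 := congrArg (Subtype.val) ((P.bandBasis n).sum_repr' ⟨_, h⟩)
    rw [map_sum]
    simp only [map_smul, embLevel_bandFun]
    refine h2.symm.trans ?_
    simp
  have h2 := eq_on_sphereC (contDiff_level F) (contDiff_level _) (embLevel_eq_iff.1 h1) ha
  rw [h2]
  simp

variable (P) in
/-- The trace of the reproducing kernel of an eigenspace. -/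
def bandKernel (n : ℕ) (a : Fin 3 → ℂ) : ℝ := ∑ i, ‖(P.bandFun n i : P.CFun) a‖ ^ 2

variable (P) in
/-- A component of the reproducing kernel of an eigenspace. -/
def bandComp (n : ℕ) (a : Fin 3 → ℂ) (b : Fin (P.spin + 1)) : P.level (n + 1) :=
  ∑ i, (starRingEnd ℂ) ((P.bandFun n i : P.CFun) a b) • P.bandFun n i

theorem embLevel_bandComp (n : ℕ) (a : Fin 3 → ℂ) (b : Fin (P.spin + 1)) :
    P.embLevel (n + 1) (P.bandComp n a b) =
      ∑ i, (starRingEnd ℂ) ((P.bandFun n i : P.CFun) a b) • (P.bandBasis n i : P.H) := by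
  simp only [bandComp, map_sum, map_smul, embLevel_bandFun]

theorem embLevel_bandComp_mem (n : ℕ) (a : Fin 3 → ℂ) (b : Fin (P.spin + 1)) :
    P.embLevel (n + 1) (P.bandComp n a b) ∈ P.band n := by
  rw [embLevel_bandComp]
  exact sum_mem fun i _ => Submodule.smul_mem _ _ (P.bandBasis n i).2

theorem norm_sq_sum_bandBasis (n : ℕ) (c : Fin (Module.finrank ℂ (P.band n)) → ℂ) :
    ‖∑ i, c i • (P.bandBasis n i : P.H)‖ ^ 2 = ∑ i, ‖c i‖ ^ 2 := by
  have h : ∑ i, c i • (P.bandBasis n i : P.H) =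
      (((P.bandBasis n).repr.symm (WithLp.toLp 2 c) : P.band n) : P.H) := by
    rw [← (P.bandBasis n).sum_repr_symm]
    simp
  rw [h]
  have h2 : ‖(((P.bandBasis n).repr.symm (WithLp.toLp 2 c) : P.band n) : P.H)‖ =
      ‖(P.bandBasis n).repr.symm (WithLp.toLp 2 c)‖ := rfl
  rw [h2, LinearIsometryEquiv.norm_map, EuclideanSpace.norm_sq_eq]

theorem sum_norm_sq_bandComp (n : ℕ) (a : Fin 3 → ℂ) :
    ∑ b, ‖P.embLevel (n + 1) (P.bandComp n a b)‖ ^ 2 = P.bandKernel n a := by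
  simp only [embLevel_bandComp, norm_sq_sum_bandBasis, bandKernel, EuclideanSpace.norm_sq_eq,
    RCLike.norm_conj]
  exact Finset.sum_comm

/-- Expanding `Ĵ_j` in its matrix on the band converts a pointwise pairing at a complex point, where
no symmetry is available, into Hilbert space pairings of the kernel components. -/
theorem sum_inner_bandFun_cangMom (n : ℕ) (j : Fin 3) {a : Fin 3 → ℂ} (ha : a ∈ P.sphereC) :
    ∑ i, ⟪(P.bandFun n i : P.CFun) a, cangMom j (P.bandFun n i) a⟫_ℂ =
      ∑ b, ⟪P.embLevel (n + 1) (P.bandComp n a b),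
        P.embLevel (n + 1) (levelMom j (P.bandComp n a b))⟫_ℂ := by
  have h1 : ∀ i, cangMom j (P.bandFun n i) a =
      ∑ k, ⟪P.embLevel (n + 1) (P.bandFun n k),
        P.embLevel (n + 1) (levelMom j (P.bandFun n i))⟫_ℂ • (P.bandFun n k : P.CFun) a := by
    intro i
    refine bandFun_expand (F := levelMom j (P.bandFun n i)) (embLevel_levelMom_mem_band ?_ j) ha
    rw [embLevel_bandFun]
    exact (P.bandBasis n i).2
  have h2 : ∀ b, ⟪P.embLevel (n + 1) (P.bandComp n a b),
      P.embLevel (n + 1) (levelMom j (P.bandComp n a b))⟫_ℂ =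
      ∑ i, ∑ k, ((P.bandFun n k : P.CFun) a b * (starRingEnd ℂ) ((P.bandFun n i : P.CFun) a b)) *
        ⟪P.embLevel (n + 1) (P.bandFun n k),
          P.embLevel (n + 1) (levelMom j (P.bandFun n i))⟫_ℂ := by
    intro b
    simp only [bandComp, levelMom_sum, levelMom_smul, map_sum, map_smul]
    rw [inner_sum]
    refine Finset.sum_congr rfl fun i _ => ?_
    rw [sum_inner]
    refine Finset.sum_congr rfl fun k _ => ?_
    rw [hinner_smul_left, hinner_smul_right, Complex.conj_conj, mul_assoc]
  simp only [h1, h2]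
  rw [Finset.sum_comm]
  refine Finset.sum_congr rfl fun i _ => ?_
  rw [inner_sum, Finset.sum_comm]
  refine Finset.sum_congr rfl fun k _ => ?_
  rw [inner_smul_right, PiLp.inner_apply, Finset.mul_sum]
  refine Finset.sum_congr rfl fun b _ => ?_
  rw [RCLike.inner_apply]
  ring

variable (P) in
/-- The logarithmic derivative of the kernel along a rotation, up to a constant. -/
def kernelMom (n : ℕ) (j : Fin 3) (a : Fin 3 → ℂ) : ℂ :=
  ∑ i, ⟪(P.bandFun n i : P.CFun) a,
    cangMom j (P.bandFun n i) a - P.σ j ((P.bandFun n i : P.CFun) a)⟫_ℂ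

theorem kernelMom_im (n : ℕ) (j : Fin 3) {a : Fin 3 → ℂ} (ha : a ∈ P.sphereC) :
    (P.kernelMom n j a).im = 0 := by
  have h : ∀ v : P.V, (⟪v, P.σ j v⟫_ℂ).im = 0 := fun v => by
    have h := P.inner_σ j v v
    rw [← inner_conj_symm] at h
    exact Complex.conj_eq_iff_im.1 h
  simp only [kernelMom, inner_sub_right, Finset.sum_sub_distrib]
  rw [sum_inner_bandFun_cangMom n j ha, Complex.sub_im, Complex.im_sum, Complex.im_sum]
  simp only [h, inner_embLevel_levelMom_im, Finset.sum_const_zero, sub_zero]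

variable (P) in
/-- A bound on the spin operators. -/
def spinBound : ℝ := ∑ j, ‖P.σ j‖

/-- Cauchy-Schwarz, with `Ĵ_j` of norm at most `√c_n` on the band; the squared norms of the kernel
components add up to the trace. -/
theorem norm_kernelMom_le (n : ℕ) (j : Fin 3) {a : Fin 3 → ℂ} (ha : a ∈ P.sphereC) :
    ‖P.kernelMom n j a‖ ≤ (Real.sqrt (P.eig n) + P.spinBound) * P.bandKernel n a := by
  have hσ : ‖P.σ j‖ ≤ P.spinBound :=
    Finset.single_le_sum (f := fun j => ‖P.σ j‖) (fun _ _ => norm_nonneg _) (Finset.mem_univ j)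
  simp only [kernelMom, inner_sub_right, Finset.sum_sub_distrib]
  rw [sum_inner_bandFun_cangMom n j ha, add_mul]
  refine (norm_sub_le _ _).trans (add_le_add ?_ ?_)
  · rw [← sum_norm_sq_bandComp, Finset.mul_sum]
    refine norm_sum_le_of_le _ fun b _ => ?_
    refine (norm_inner_le_norm (E := P.H) _ _).trans ?_
    calc _ ≤ ‖P.embLevel (n + 1) (P.bandComp n a b)‖ *
          (Real.sqrt (P.eig n) * ‖P.embLevel (n + 1) (P.bandComp n a b)‖) := by
          gcongr
          exact norm_embLevel_levelMom_le (embLevel_bandComp_mem n a b) j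
      _ = _ := by ring
  · rw [bandKernel, Finset.mul_sum]
    refine norm_sum_le_of_le _ fun i _ => ?_
    refine (norm_inner_le_norm _ _).trans ?_
    calc _ ≤ ‖(P.bandFun n i : P.CFun) a‖ * (P.spinBound * ‖(P.bandFun n i : P.CFun) a‖) := by
          gcongr
          refine ((P.σ j).le_opNorm _).trans ?_
          gcongr
      _ = _ := by ring

/-- The derivative of the kernel along a complexified great circle. -/
theorem hasDerivAt_bandKernel (n : ℕ) {e f : E3} (he : ‖e‖ = 1) (hf : ‖f‖ = 1)
    (hef : ⟪e, f⟫_ℝ = 0) (ζ : ℂ) (t : ℝ) :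
    HasDerivAt (fun t : ℝ => P.bandKernel n (P.greatCircle e f (ζ * t)))
      (2 * (ζ * (Complex.I / P.hbar) * ∑ j : Fin 3,
        ((e (j + 1) * f (j + 2) - e (j + 2) * f (j + 1) : ℝ) : ℂ) *
          P.kernelMom n j (P.greatCircle e f (ζ * t))).re) t := by
  have h1 : HasDerivAt (fun t : ℝ => ζ * (t : ℂ)) ζ t := by
    simpa using (Complex.ofRealCLM.hasDerivAt (x := t)).const_mul ζ
  have h2 := fun i => ((hasDerivAt_comp_greatCircle (contDiff_level (P.bandFun n i)) he hf hef
    (ζ * t)).scomp t h1).norm_sq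
  refine (HasDerivAt.fun_sum fun i _ => h2 i).congr_deriv ?_
  have h3 : ∀ v w : P.V, ⟪v, w⟫_ℝ = (⟪v, w⟫_ℂ).re := fun v w => by
    rw [PiLp.inner_apply, PiLp.inner_apply, Complex.re_sum]
    rfl
  simp only [h3, Function.comp_apply]
  rw [← Finset.mul_sum]
  congr 1
  rw [← Complex.re_sum]
  congr 1
  simp only [kernelMom, inner_smul_right, inner_sum, Finset.mul_sum]
  rw [Finset.sum_comm]
  refine Finset.sum_congr rfl fun j _ => Finset.sum_congr rfl fun i _ => ?_
  ring

/-- At real angles the derivative of the trace is the real part of `i` times a real number, so the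
trace is constant along great circles, and any two points lie on one. -/
theorem bandKernel_toC_eq (n : ℕ) (x y : P.Sphere) :
    P.bandKernel n (P.toC x) = P.bandKernel n (P.toC y) := by
  obtain ⟨e, f, he, hf, hef, θ, rfl, rfl⟩ := exists_circle_through x y
  have hd := fun t => hasDerivAt_bandKernel (P := P) n he hf hef 1 t
  have h0 := is_const_of_deriv_eq_zero (fun t => (hd t).differentiableAt) (fun t => by
    rw [(hd t).deriv]
    set Z : ℂ := ∑ j : Fin 3, ((e (j + 1) * f (j + 2) - e (j + 2) * f (j + 1) : ℝ) : ℂ) *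
      P.kernelMom n j (P.greatCircle e f (1 * t)) with hZ
    have him : Z.im = 0 := by
      rw [hZ, Complex.im_sum]
      refine Finset.sum_eq_zero fun j _ => ?_
      rw [Complex.im_ofReal_mul, kernelMom_im n j (greatCircle_mem he hf hef _), mul_zero]
    have : 1 * (Complex.I / P.hbar) * Z = ((Z.re / P.hbar : ℝ) : ℂ) * Complex.I := by
      conv_lhs => rw [← Complex.re_add_im Z, him]
      push_cast
      ring
    rw [this, Complex.re_ofReal_mul, Complex.I_re, mul_zero, mul_zero]) 0 θ
  simpa [toC_circlePoint] using h0

theorem finrank_band_le (n : ℕ) :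
    Module.finrank ℂ (P.band n) ≤ (P.spin + 1) * 4 ^ (n + 1) :=
  ((Submodule.finrank_mono inf_le_left).trans (LinearMap.finrank_range_le _)).trans
    (finrank_level_le (n + 1))

theorem integral_bandKernel (n : ℕ) :
    ∫ x, P.bandKernel n (P.toC x) ∂P.area = Module.finrank ℂ (P.band n) := by
  have hint : ∀ i, Integrable (fun x => ‖(P.bandFun n i : P.CFun) (P.toC x)‖ ^ 2) P.area := by
    intro i
    have hc : Continuous fun x : P.Sphere => ‖(P.bandFun n i : P.CFun) (P.toC x)‖ ^ 2 :=
      ((contDiff_level (P.bandFun n i)).comp_complexify.continuous.comp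
        continuous_subtype_val).norm.pow 2
    exact hc.integrable_of_hasCompactSupport (HasCompactSupport.of_compactSpace _)
  have h1 : ∀ i, ∫ x, ‖(P.bandFun n i : P.CFun) (P.toC x)‖ ^ 2 ∂P.area = 1 := by
    intro i
    have h2 : ⟪P.embLevel (n + 1) (P.bandFun n i), P.embLevel (n + 1) (P.bandFun n i)⟫_ℂ = 1 := by
      rw [embLevel_bandFun, inner_self_eq_norm_sq_to_K (E := P.H)]
      have : ‖(P.bandBasis n i : P.H)‖ = 1 := (P.bandBasis n).norm_eq_one i
      rw [this]; simp
    rw [inner_eq_integral_of_ae (embLevel_coe _) (embLevel_coe _)] at h2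
    simp only [inner_self_eq_norm_sq_to_K] at h2
    have h3 := integral_ofReal (𝕜 := ℂ) (μ := P.area)
      (f := fun x => ‖(P.bandFun n i : P.CFun) (P.toC x)‖ ^ 2)
    simp only [RCLike.ofReal_pow] at h3
    rw [h3] at h2
    exact Complex.ofReal_injective (h2.trans Complex.ofReal_one.symm)
  simp only [bandKernel]
  rw [integral_finsetSum _ fun i _ => hint i]
  simp [h1]

theorem area_pos (x : P.Sphere) : 0 < P.area.real Set.univ := by
  have : (Set.univ : Set P.Sphere).Nonempty := ⟨x, trivial⟩
  exact ENNReal.toReal_pos (isOpen_univ.measure_pos P.area this).ne' (measure_ne_top _ _)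

theorem bandKernel_toC (n : ℕ) (x : P.Sphere) :
    P.bandKernel n (P.toC x) = Module.finrank ℂ (P.band n) / P.area.real Set.univ := by
  have h := integral_bandKernel (P := P) n
  simp only [bandKernel_toC_eq n _ x] at h
  rw [integral_const, smul_eq_mul] at h
  rw [← h, mul_div_cancel_left₀ _ (area_pos x).ne']

theorem bandKernel_nonneg (n : ℕ) (a : Fin 3 → ℂ) : 0 ≤ P.bandKernel n a :=
  Finset.sum_nonneg fun _ _ => sq_nonneg _

/-- Grönwall on the segment of imaginary angles from a real point, where the trace is dimension over
area, to `a`. The constant `12` is `2 · 3 · 2`: derivative of a square, three axes, components of `e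
× f` crudely bounded by two. -/
theorem bandKernel_le (n : ℕ) {a : Fin 3 → ℂ} (ha : a ∈ P.sphereC) :
    P.bandKernel n a ≤ Module.finrank ℂ (P.band n) / P.area.real Set.univ *
      Real.exp (12 / P.hbar * (Real.sqrt (P.eig n) + P.spinBound) * (4 * ‖a‖ / P.r)) := by
  have hr := P.r_pos
  have hh := P.hbar_pos
  obtain ⟨e, f, he, hf, hef, τ, hτ0, rfl, hτ⟩ := exists_circle_complex ha
  set C := Real.sqrt (P.eig n) + P.spinBound with hC
  have hC0 : 0 ≤ C := by
    have : 0 ≤ P.spinBound := Finset.sum_nonneg fun _ _ => norm_nonneg _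
    positivity
  have hd := hasDerivAt_bandKernel (P := P) n he hf hef Complex.I
  have hcomp : ∀ {g : E3}, ‖g‖ = 1 → ∀ j, |g j| ≤ 1 := fun {g} hg j => by
    have := PiLp.norm_apply_le g j
    rwa [hg] at this
  have hbound : ∀ t : ℝ, ‖2 * (Complex.I * (Complex.I / P.hbar) * ∑ j : Fin 3,
      ((e (j + 1) * f (j + 2) - e (j + 2) * f (j + 1) : ℝ) : ℂ) *
        P.kernelMom n j (P.greatCircle e f (Complex.I * t))).re‖ ≤
      12 / P.hbar * C * ‖P.bandKernel n (P.greatCircle e f (Complex.I * t))‖ + 0 := by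
    intro t
    have hk := bandKernel_nonneg (P := P) n (P.greatCircle e f (Complex.I * t))
    have h1 : ‖∑ j : Fin 3, ((e (j + 1) * f (j + 2) - e (j + 2) * f (j + 1) : ℝ) : ℂ) *
        P.kernelMom n j (P.greatCircle e f (Complex.I * t))‖ ≤
        ∑ j : Fin 3, 2 * (C * P.bandKernel n (P.greatCircle e f (Complex.I * t))) := by
      refine norm_sum_le_of_le _ fun j _ => ?_
      rw [norm_mul]
      have h2 : ‖((e (j + 1) * f (j + 2) - e (j + 2) * f (j + 1) : ℝ) : ℂ)‖ ≤ 2 := by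
        rw [Complex.norm_real, Real.norm_eq_abs]
        refine (abs_sub _ _).trans ?_
        rw [abs_mul, abs_mul]
        have := mul_le_one₀ (hcomp he (j + 1)) (abs_nonneg _) (hcomp hf (j + 2))
        have := mul_le_one₀ (hcomp he (j + 2)) (abs_nonneg _) (hcomp hf (j + 1))
        linarith
      exact mul_le_mul h2 (norm_kernelMom_le n j (greatCircle_mem he hf hef _)) (norm_nonneg _)
        (by norm_num)
    rw [add_zero, norm_mul, Real.norm_of_nonneg hk, Real.norm_ofNat, Real.norm_eq_abs]
    calc _ ≤ 2 * ‖Complex.I * (Complex.I / P.hbar) * ∑ j : Fin 3,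
          ((e (j + 1) * f (j + 2) - e (j + 2) * f (j + 1) : ℝ) : ℂ) *
          P.kernelMom n j (P.greatCircle e f (Complex.I * t))‖ := by
          gcongr
          exact Complex.abs_re_le_norm _
      _ ≤ 2 * (1 / P.hbar * ∑ j : Fin 3,
          2 * (C * P.bandKernel n (P.greatCircle e f (Complex.I * t)))) := by
          rw [norm_mul, norm_mul, norm_div, Complex.norm_I, Complex.norm_real,
            Real.norm_of_nonneg hh.le, one_mul]
          gcongr
      _ = _ := by
          rw [Finset.sum_const, Finset.card_univ, Fintype.card_fin, nsmul_eq_mul]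
          push_cast
          ring
  have h0 : ‖P.bandKernel n (P.greatCircle e f (Complex.I * ((0 : ℝ) : ℂ)))‖ ≤
      Module.finrank ℂ (P.band n) / P.area.real Set.univ := by
    rw [Real.norm_of_nonneg (bandKernel_nonneg _ _), ← bandKernel_toC n (circlePoint he hf hef 0),
      toC_circlePoint]
    simp
  have h1 := norm_le_gronwallBound_of_norm_deriv_right_le
    (f := fun t : ℝ => P.bandKernel n (P.greatCircle e f (Complex.I * t))) (a := 0) (b := τ)
    (fun t _ => (hd t).continuousAt.continuousWithinAt)
    (fun t _ => (hd t).hasDerivWithinAt) h0 (fun t _ => hbound t) τ ⟨hτ0, le_rfl⟩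
  rw [gronwallBound_ε0, sub_zero, Real.norm_of_nonneg (bandKernel_nonneg _ _)] at h1
  refine h1.trans ?_
  have h2 : τ ≤ 4 * ‖P.greatCircle e f (Complex.I * τ)‖ / P.r := by
    rw [le_div_iff₀ hr]
    have := Real.add_one_le_exp τ
    nlinarith
  gcongr

theorem sqrt_eig_le (n : ℕ) : Real.sqrt (P.eig n) ≤ P.hbar * (P.spin / 2 + n + 1) := by
  have hh := P.hbar_pos
  refine Real.sqrt_le_iff.2 ⟨by positivity, ?_⟩
  have h2 : (0 : ℝ) ≤ P.spin / 2 + n := by positivity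
  rw [eig, mul_pow]
  gcongr
  nlinarith

theorem exists_bandKernel_le (R : ℝ) : ∃ C D : ℝ, ∀ (n : ℕ) (a : Fin 3 → ℂ), a ∈ P.sphereC →
    ‖a‖ ≤ R → P.bandKernel n a ≤ Real.exp (C * n + D) ^ 2 := by
  have hr := P.r_pos
  have hh := P.hbar_pos
  set A := P.area.real Set.univ with hA
  set T := 4 * R / P.r with hT
  -- The constants collect the exponents of dimension, area and Grönwall factor. They are halved
  -- because the bound is a square, ready for norms of kernel vectors.
  refine ⟨(3 + 12 * T) / 2, (P.spin + 3 + 1 / A + 12 * T * (P.spin / 2 + 1) +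
    12 / P.hbar * P.spinBound * T) / 2, fun n a ha haR => (bandKernel_le n ha).trans ?_⟩
  have hA0 : 0 ≤ A := measureReal_nonneg
  have hs0 : 0 ≤ P.spinBound := Finset.sum_nonneg fun _ _ => norm_nonneg _
  have hR : 0 ≤ R := (norm_nonneg a).trans haR
  have hT0 : 0 ≤ T := by positivity
  have h1 : (Module.finrank ℂ (P.band n) : ℝ) ≤ Real.exp (P.spin + 3 * (n + 1)) := by
    have h2 : (Module.finrank ℂ (P.band n) : ℝ) ≤ (P.spin + 1) * 4 ^ (n + 1) := by
      exact_mod_cast finrank_band_le n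
    have h3 : (4 : ℝ) ^ (n + 1) ≤ Real.exp (3 * (n + 1)) := by
      have h4 : (4 : ℝ) ≤ Real.exp 3 := by linarith [Real.add_one_le_exp (3 : ℝ)]
      have h5 : Real.exp (3 * (n + 1)) = Real.exp 3 ^ (n + 1) := by
        rw [← Real.exp_nat_mul]; push_cast; ring_nf
      rw [h5]
      gcongr
    rw [Real.exp_add]
    refine h2.trans ?_
    gcongr
    exact Real.add_one_le_exp _
  have h2 : 1 / A ≤ Real.exp (1 / A) := by linarith [Real.add_one_le_exp (1 / A)]
  have h3 : 12 / P.hbar * (Real.sqrt (P.eig n) + P.spinBound) * (4 * ‖a‖ / P.r) ≤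
      12 / P.hbar * (P.hbar * (P.spin / 2 + n + 1) + P.spinBound) * T := by
    have := sqrt_eig_le (P := P) n
    rw [hT]
    gcongr
  calc _ ≤ Real.exp (P.spin + 3 * (n + 1)) * Real.exp (1 / A) *
        Real.exp (12 / P.hbar * (P.hbar * (P.spin / 2 + n + 1) + P.spinBound) * T) := by
        rw [div_eq_mul_one_div]
        gcongr
    _ = _ := by
        rw [← Real.exp_add, ← Real.exp_add, ← Real.exp_nat_mul]
        congr 1
        push_cast
        field_simp
        ring

end Params

namespace Params
variable (P : Params)

/-! ### Reproducing kernels -/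

/-- The reproducing kernel of an eigenspace at a point of the complex sphere: pairing with it
evaluates the elements of the eigenspace at the conjugate point. -/
def kernelVec (n : ℕ) (a : Fin 3 → ℂ) : P.V →L[ℂ] P.H :=
  ∑ i, (innerSL ℂ ((P.bandFun n i : P.CFun) (star a))).smulRight (P.bandBasis n i : P.H)

/-- The partial sums of the reproducing kernels. -/
def kernelSum (N : ℕ) (a : Fin 3 → ℂ) : P.V →L[ℂ] P.H := ∑ n ∈ Finset.range N, P.kernelVec n a

variable {P}

theorem kernelVec_apply (n : ℕ) (a : Fin 3 → ℂ) (v : P.V) :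
    P.kernelVec n a v = ∑ i, ⟪(P.bandFun n i : P.CFun) (star a), v⟫_ℂ • (P.bandBasis n i : P.H) := by
  simp [kernelVec]

theorem kernelSum_apply (N : ℕ) (a : Fin 3 → ℂ) (v : P.V) :
    P.kernelSum N a v = ∑ n ∈ Finset.range N, P.kernelVec n a v := by
  simp [kernelSum]

theorem kernelVec_mem (n : ℕ) (a : Fin 3 → ℂ) (v : P.V) : P.kernelVec n a v ∈ P.band n := by
  rw [kernelVec_apply]
  exact sum_mem fun i _ => Submodule.smul_mem _ _ (P.bandBasis n i).2

theorem star_mem_sphereC {a : Fin 3 → ℂ} (ha : a ∈ P.sphereC) : star a ∈ P.sphereC := by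
  have h : ∑ j, a j ^ 2 = (P.r : ℂ) ^ 2 := ha
  change ∑ j, (star a) j ^ 2 = (P.r : ℂ) ^ 2
  have h2 := congrArg (starRingEnd ℂ) h
  simpa using h2

theorem contDiff_kernelVec (n : ℕ) (v : P.V) : ContDiff ℂ ∞ fun a => P.kernelVec n a v := by
  simp only [kernelVec_apply]
  exact ContDiff.sum fun i _ => (contDiff_inner_star (P.bandFun n i).2 v).smul contDiff_const

theorem exists_kernelVec_le (R : ℝ) : ∃ C D : ℝ, ∀ (n : ℕ) (a : Fin 3 → ℂ), a ∈ P.sphereC →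
    ‖a‖ ≤ R → ‖P.kernelVec n a‖ ≤ Real.exp (C * n + D) := by
  obtain ⟨C, D, h⟩ := exists_bandKernel_le (P := P) R
  refine ⟨C, D, fun n a ha haR => ContinuousLinearMap.opNorm_le_bound _ (Real.exp_pos _).le
    fun v => le_of_sq_le_sq ?_ (by positivity)⟩
  rw [kernelVec_apply, norm_sq_sum_bandBasis, mul_pow]
  have h1 := h n (star a) (star_mem_sphereC ha) (by rwa [norm_star])
  calc _ ≤ ∑ i, ‖(P.bandFun n i : P.CFun) (star a)‖ ^ 2 * ‖v‖ ^ 2 := by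
        refine Finset.sum_le_sum fun i _ => ?_
        rw [← mul_pow]
        gcongr
        exact norm_inner_le_norm _ _
    _ = P.bandKernel n (star a) * ‖v‖ ^ 2 := by rw [bandKernel, Finset.sum_mul]
    _ ≤ _ := by gcongr

theorem inner_kernelVec {n : ℕ} {F : P.level (n + 1)} (hF : P.embLevel (n + 1) F ∈ P.band n)
    {a : Fin 3 → ℂ} (ha : a ∈ P.sphereC) (v : P.V) :
    ⟪P.embLevel (n + 1) F, P.kernelVec n a v⟫_ℂ = ⟪(F : P.CFun) (star a), v⟫_ℂ := by
  rw [bandFun_expand hF (star_mem_sphereC ha), kernelVec_apply, inner_sum, sum_inner]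
  refine Finset.sum_congr rfl fun i _ => ?_
  rw [hinner_smul_right, inner_smul_left, inner_conj_symm (E := P.H), embLevel_bandFun, mul_comm]

theorem band_le_hlevel {m n : ℕ} (h : n < m) : P.band n ≤ P.hlevel m :=
  inf_le_left.trans (hlevel_mono h)

theorem inner_band_eq_zero {m n : ℕ} (h : m ≠ n) {f g : P.H} (hf : f ∈ P.band m)
    (hg : g ∈ P.band n) : ⟪f, g⟫_ℂ = 0 :=
  (band_orthogonal h).inner_eq hf hg

/-- The element is split into its band components as functions, the splitting being continued from
the real sphere to `ā`; each component is reproduced by its own kernel. -/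
theorem inner_kernelSum {m N : ℕ} (hmN : m ≤ N) (F : P.level m) {a : Fin 3 → ℂ}
    (ha : a ∈ P.sphereC) (v : P.V) :
    ⟪P.embLevel m F, P.kernelSum N a v⟫_ℂ = ⟪(F : P.CFun) (star a), v⟫_ℂ := by
  induction m with
  | zero =>
    have h0 : F = 0 := Subtype.ext ((Submodule.mem_bot ℂ).1 F.2)
    rw [h0, map_zero, inner_zero_left (E := P.H)]
    simp
  | succ m ih =>
    have h1 : P.embLevel (m + 1) F ∈ P.hlevel m ⊔ P.band m := by
      rw [← hlevel_succ_eq]; exact embLevel_mem F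
    obtain ⟨_, ⟨G, rfl⟩, f, hf, hGf⟩ := Submodule.mem_sup.1 h1
    obtain ⟨F', rfl⟩ := hf.1
    have h2 : (F : P.CFun) (star a) = (G : P.CFun) (star a) + (F' : P.CFun) (star a) := by
      refine eq_on_sphereC (contDiff_level F) ((contDiff_level G).cadd (contDiff_level F'))
        (fun x => ?_) (star_mem_sphereC ha)
      have h3 : P.embLevel (m + 1) F =
          P.embLevel (m + 1) (Submodule.inclusion (level_le_succ m) G + F') := by
        rw [map_add]; exact hGf.symm
      exact embLevel_eq_iff.1 h3 x
    rw [← hGf, inner_add_left (E := P.H), ih (by omega), h2, inner_add_left, add_right_inj,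
      ← inner_kernelVec hf ha, kernelSum_apply, inner_sum]
    refine Finset.sum_eq_single_of_mem m (Finset.mem_range.2 hmN) fun n _ hn => ?_
    exact inner_band_eq_zero hn.symm hf (kernelVec_mem n a v)

theorem kernelSum_mem (N : ℕ) (a : Fin 3 → ℂ) (v : P.V) : P.kernelSum N a v ∈ P.hlevel N := by
  rw [kernelSum_apply]
  exact sum_mem fun n hn => band_le_hlevel (Finset.mem_range.1 hn) (kernelVec_mem n a v)

variable (P) in
/-- The failure of a partial sum of the kernels to be an eigenvector of the position. -/
def kernelDefect (N : ℕ) (j : Fin 3) (a : Fin 3 → ℂ) (v : P.V) : P.H :=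
  P.X j (P.kernelSum N a v) - a j • P.kernelSum N a v

theorem kernelDefect_mem (N : ℕ) (j : Fin 3) (a : Fin 3 → ℂ) (v : P.V) :
    P.kernelDefect N j a v ∈ P.hlevel (N + 1) :=
  sub_mem (X_mem_hlevel (kernelSum_mem N a v) j)
    (Submodule.smul_mem _ _ (hlevel_mono N.le_succ (kernelSum_mem N a v)))

/-- Moving `X_j` onto `f` costs one level, which the partial sum still reproduces; evaluating `x_j
F` at `ā` gives `ā_j`, whose conjugate cancels `a_j`. -/
theorem inner_kernelDefect (N : ℕ) (j : Fin 3) {a : Fin 3 → ℂ} (ha : a ∈ P.sphereC) (v : P.V)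
    {f : P.H} (hf : f ∈ P.hlevel N) : ⟪f, P.kernelDefect (N + 1) j a v⟫_ℂ = 0 := by
  obtain ⟨F, rfl⟩ := hf
  have h1 : P.X j (P.embLevel N F) = P.embLevel (N + 1) ⟨P.cmul j F, cmul_mem_level F.2 j⟩ :=
    X_emb j (Submodule.inclusion (level_le_entireSections N) F)
  rw [kernelDefect, inner_sub_right (E := P.H), hinner_smul_right, ← inner_X_left, h1,
    inner_kernelSum le_rfl _ ha, inner_kernelSum N.le_succ _ ha]
  change ⟪(star a) j • (F : P.CFun) (star a), v⟫_ℂ - _ = _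
  rw [inner_smul_left]
  simp

theorem norm_kernelDefect_le (N : ℕ) (j : Fin 3) (a : Fin 3 → ℂ) (v : P.V) :
    ‖P.kernelDefect N j a v‖ ≤ (P.r + ‖a‖) * ‖P.kernelSum N a v‖ := by
  rw [add_mul]
  refine (norm_sub_le _ _).trans (add_le_add (norm_X_le _ _) ?_)
  rw [norm_smul]
  gcongr
  exact norm_le_pi_norm a j

/-! ### The operators `exp (t Ĵ²)` on the levels -/

theorem proj_of_mem {n : ℕ} {f : P.H} (hf : f ∈ P.band n) : P.proj n f = f :=
  Submodule.starProjection_eq_self_iff.2 hf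

theorem proj_of_mem_ne {m n : ℕ} (h : m ≠ n) {f : P.H} (hf : f ∈ P.band n) : P.proj m f = 0 :=
  (Submodule.starProjection_apply_eq_zero_iff _).2
    ((Submodule.isOrtho_iff_le.1 (band_orthogonal h.symm)) hf)

theorem inner_proj {n : ℕ} {f : P.H} (hf : f ∈ P.band n) (g : P.H) :
    ⟪f, P.proj n g⟫_ℂ = ⟪f, g⟫_ℂ := by
  have h := (P.band n).inner_starProjection_left_eq_right f g
  rw [← proj, proj_of_mem hf] at h
  exact h.symm

theorem inner_proj_ne {m n : ℕ} (h : m ≠ n) {f : P.H} (hf : f ∈ P.band n) (g : P.H) :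
    ⟪f, P.proj m g⟫_ℂ = 0 :=
  inner_band_eq_zero h.symm hf (Submodule.starProjection_apply_mem _ _)

theorem hasSum_of_mem_band {n : ℕ} {f : P.H} (hf : f ∈ P.band n) (t : ℝ) :
    HasSum (fun m => ((Real.exp (t * P.eig m) : ℝ) : ℂ) • P.proj m f)
      (((Real.exp (t * P.eig n) : ℝ) : ℂ) • f) := by
  have h := hasSum_single (f := fun m => ((Real.exp (t * P.eig m) : ℝ) : ℂ) • P.proj m f) n
    fun m hm => by rw [proj_of_mem_ne hm hf, smul_zero]
  rwa [proj_of_mem hf] at h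

theorem band_le_domain (n : ℕ) (t : ℝ) : P.band n ≤ (P.expAngMomSq t).domain := fun _ hf =>
  mem_domain_iff.2 (hasSum_of_mem_band hf t).summable

theorem expAngMomSq_of_mem_band {n : ℕ} {f : P.H} (hf : f ∈ P.band n) (t : ℝ) :
    P.expAngMomSq t ⟨f, band_le_domain n t hf⟩ = ((Real.exp (t * P.eig n) : ℝ) : ℂ) • f := by
  rw [expAngMomSq_apply]
  exact (hasSum_of_mem_band hf t).tsum_eq

theorem hlevel_le_domain (n : ℕ) (t : ℝ) : P.hlevel n ≤ (P.expAngMomSq t).domain := by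
  induction n with
  | zero => rw [hlevel_zero]; exact bot_le
  | succ n ih => rw [hlevel_succ_eq]; exact sup_le ih (band_le_domain n t)

theorem inner_expAngMomSq {n : ℕ} {f : P.H} (hf : f ∈ P.band n) {t : ℝ}
    (g : (P.expAngMomSq t).domain) :
    ⟪f, P.expAngMomSq t g⟫_ℂ = ((Real.exp (t * P.eig n) : ℝ) : ℂ) * ⟪f, (g : P.H)⟫_ℂ := by
  rw [expAngMomSq_apply]
  have h := (mem_domain_iff.1 g.2).hasSum.mapL (innerSL ℂ f)
  have h2 := hasSum_single (f := fun m => innerSL ℂ f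
    (((Real.exp (t * P.eig m) : ℝ) : ℂ) • P.proj m g)) n fun m hm => by
      rw [map_smul, innerSL_apply_apply, inner_proj_ne hm hf, smul_zero]
  rw [map_smul, innerSL_apply_apply, inner_proj hf] at h2
  exact h.unique h2

/-- The levels lie in the domain of the adjoint of `exp(t Ĵ²)` for either sign of `t`; this is the
source of closability. -/
theorem exists_adjoint_of_mem_hlevel {n : ℕ} {f : P.H} (hf : f ∈ P.hlevel n) (t : ℝ) :
    ∃ f' : P.H, ∀ g : (P.expAngMomSq t).domain,
      ⟪f, P.expAngMomSq t g⟫_ℂ = ⟪f', (g : P.H)⟫_ℂ := by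
  induction n generalizing f with
  | zero =>
    rw [hlevel_zero] at hf
    exact ⟨0, fun g => by
      rw [(Submodule.mem_bot ℂ).1 hf, inner_zero_left (E := P.H), inner_zero_left (E := P.H)]⟩
  | succ n ih =>
    rw [hlevel_succ_eq] at hf
    obtain ⟨f₁, h1, f₂, h2, rfl⟩ := Submodule.mem_sup.1 hf
    obtain ⟨f', h'⟩ := ih h1
    refine ⟨f' + ((Real.exp (t * P.eig n) : ℝ) : ℂ) • f₂, fun g => ?_⟩
    rw [inner_add_left (E := P.H), inner_add_left (E := P.H), h', inner_expAngMomSq h2,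
      hinner_smul_left, Complex.conj_ofReal]

theorem norm_proj_le (n : ℕ) (ψ : P.H) : ‖P.proj n ψ‖ ≤ ‖ψ‖ :=
  Submodule.norm_starProjection_apply_le _ _

/-- The eigenvalues grow at least like `ħ² n²`. Completing the square with slope `C + 1` leaves a
factor `e^{-n}` to sum. -/
theorem summable_exp_eig {t : ℝ} (ht : 0 < t) (C D : ℝ) :
    Summable fun n : ℕ => Real.exp (-t * P.eig n) * Real.exp (C * n + D) := by
  have hh := P.hbar_pos
  set A := t * P.hbar ^ 2 with hA
  have hA0 : 0 < A := by positivity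
  have h1 : Summable fun n : ℕ => Real.exp (D + (C + 1) ^ 2 / (4 * A)) * Real.exp (-n) :=
    Real.summable_exp_neg_nat.mul_left _
  refine Summable.of_nonneg_of_le (fun n => by positivity) (fun n => ?_) h1
  rw [← Real.exp_add, ← Real.exp_add]
  refine Real.exp_le_exp.2 ?_
  have h2 : A * (n : ℝ) ^ 2 ≤ t * P.eig n := by
    rw [hA, eig, mul_assoc]
    have : (0 : ℝ) ≤ P.spin / 2 := by positivity
    have : (n : ℝ) ^ 2 ≤ (P.spin / 2 + n) * (P.spin / 2 + n + 1) := by nlinarith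
    gcongr
  have h3 : (C + 1) * n - A * (n : ℝ) ^ 2 ≤ (C + 1) ^ 2 / (4 * A) := by
    rw [le_div_iff₀ (by positivity)]
    nlinarith [sq_nonneg (2 * A * n - (C + 1))]
  linarith

theorem norm_exp_smul (c : ℝ) (f : P.H) : ‖((Real.exp c : ℝ) : ℂ) • f‖ = Real.exp c * ‖f‖ := by
  rw [norm_smul, Complex.norm_real, Real.norm_of_nonneg (Real.exp_pos _).le]

theorem mem_domain_neg {t : ℝ} (ht : 0 < t) (ψ : P.H) : ψ ∈ (P.expAngMomSq (-t)).domain := by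
  refine mem_domain_iff.2 (Summable.of_norm_bounded
    ((summable_exp_eig (P := P) ht 0 0).mul_right ‖ψ‖) fun n => ?_)
  rw [norm_exp_smul]
  simp only [zero_mul, add_zero, Real.exp_zero, mul_one]
  gcongr
  exact norm_proj_le n ψ

/-- Such an `f` has components in the bands `N` and `N + 1` only, and on both the operator is at
most `e^{-t c_N}`. -/
theorem norm_expAngMomSq_le_of_orthogonal {N : ℕ} {f : P.H} (h1 : f ∈ P.hlevel (N + 2))
    (h2 : ∀ g ∈ P.hlevel N, ⟪g, f⟫_ℂ = 0) {t : ℝ} (ht : 0 < t) :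
    ‖P.expAngMomSq (-t) ⟨f, hlevel_le_domain _ _ h1⟩‖ ≤
      2 * (Real.exp (-t * P.eig N) * ‖f‖) := by
  have h3 := h1
  rw [hlevel_succ_eq, hlevel_succ_eq] at h3
  obtain ⟨f', hf', f₂, hf2, hs⟩ := Submodule.mem_sup.1 h3
  obtain ⟨f₀, hf0, f₁, hf1, rfl⟩ := Submodule.mem_sup.1 hf'
  have hz : f₀ = 0 := by
    have h4 := h2 f₀ hf0
    have e1 : ⟪f₀, f₁⟫_ℂ = 0 := (Submodule.mem_orthogonal _ _).1 hf1.2 _ hf0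
    have e2 : ⟪f₀, f₂⟫_ℂ = 0 :=
      (Submodule.mem_orthogonal _ _).1 hf2.2 _ (hlevel_mono N.le_succ hf0)
    rw [← hs, inner_add_right (E := P.H), inner_add_right (E := P.H), e1, e2, add_zero,
      add_zero] at h4
    exact (inner_self_eq_zero (𝕜 := ℂ) (E := P.H)).1 h4
  rw [hz, zero_add] at hs
  have p1 : P.proj N f = f₁ := by
    rw [← hs, map_add, proj_of_mem hf1, proj_of_mem_ne (by omega) hf2, add_zero]
  have p2 : P.proj (N + 1) f = f₂ := by
    rw [← hs, map_add, proj_of_mem hf2, proj_of_mem_ne (by omega) hf1, zero_add]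
  have h4 : P.expAngMomSq (-t) ⟨f, hlevel_le_domain _ _ h1⟩ =
      ((Real.exp (-t * P.eig N) : ℝ) : ℂ) • f₁ +
        ((Real.exp (-t * P.eig (N + 1)) : ℝ) : ℂ) • f₂ := by
    rw [← expAngMomSq_of_mem_band hf1, ← expAngMomSq_of_mem_band hf2, ← LinearPMap.map_add]
    congr 1
    exact Subtype.ext hs.symm
  have h5 : Real.exp (-t * P.eig (N + 1)) ≤ Real.exp (-t * P.eig N) := by
    have := (eig_strictMono (P := P)).monotone N.le_succ
    refine Real.exp_le_exp.2 ?_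
    nlinarith
  rw [h4, two_mul]
  refine (norm_add_le _ _).trans (add_le_add ?_ ?_)
  · rw [norm_exp_smul, ← p1]
    gcongr
    exact norm_proj_le _ _
  · rw [norm_exp_smul, ← p2]
    gcongr
    exact norm_proj_le _ _

end Params

theorem naturalComp_mem {W : Type*} [AddCommGroup W] [Module ℂ W] {g f : W →ₗ.[ℂ] W}
    (x : f.domain) (h : f x ∈ g.domain) : (x : W) ∈ (Params.naturalComp g f).domain :=
  ⟨x, h, rfl⟩

theorem hasSum_smul_clm_apply {E F : Type*} [NormedAddCommGroup E] [NormedSpace ℂ E]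
    [NormedAddCommGroup F] [NormedSpace ℂ F] [CompleteSpace F] {T : ℕ → E →L[ℂ] F} {c d : ℕ → ℝ}
    (hc : ∀ n, 0 ≤ c n) (hT : ∀ n, ‖T n‖ ≤ d n) (hcd : Summable fun n => c n * d n) (v : E) :
    HasSum (fun n => ((c n : ℝ) : ℂ) • T n v) ((∑' n, ((c n : ℝ) : ℂ) • T n) v) := by
  have hs : Summable fun n => ((c n : ℝ) : ℂ) • T n := by
    refine Summable.of_norm_bounded hcd fun n => ?_
    rw [norm_smul, Complex.norm_real, Real.norm_of_nonneg (hc n)]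
    exact mul_le_mul_of_nonneg_left (hT n) (hc n)
  exact hs.hasSum.mapL (ContinuousLinearMap.apply ℂ F v)

namespace Params
variable (P : Params)

/-! ### The annihilation operators -/

/-- The product of which the annihilation operator is the closure. -/
def preA (j : Fin 3) : P.H →ₗ.[ℂ] P.H :=
  naturalComp (P.expAngMomSq (-P.s)) ((P.X j).compPMap (P.expAngMomSq P.s))

variable {P}

theorem s_pos : 0 < P.s := by
  have := P.r_pos
  have := P.hbar_pos
  have := P.m_pos
  have := P.α_pos
  unfold s
  positivity

/-- `exp(-s Ĵ²)` is defined everywhere, so the natural domain of the product is that of `exp(s Ĵ²)`.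
-/
theorem mem_graph_preA (j : Fin 3) (x : (P.expAngMomSq P.s).domain) :
    ((x : P.H), P.expAngMomSq (-P.s) ⟨P.X j (P.expAngMomSq P.s x), mem_domain_neg s_pos _⟩) ∈
      (P.preA j).graph :=
  (LinearPMap.mem_graph_iff _).2 ⟨⟨x, naturalComp_mem (f := (P.X j).compPMap (P.expAngMomSq P.s))
    x (mem_domain_neg s_pos _)⟩, rfl, rfl⟩

theorem exists_of_mem_graph_preA {j : Fin 3} {p : P.H × P.H} (hp : p ∈ (P.preA j).graph) :
    ∃ x : (P.expAngMomSq P.s).domain, p.1 = x ∧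
      p.2 = P.expAngMomSq (-P.s) ⟨P.X j (P.expAngMomSq P.s x), mem_domain_neg s_pos _⟩ := by
  obtain ⟨⟨_, ⟨x, hx, rfl⟩⟩, h1, h2⟩ := (LinearPMap.mem_graph_iff _).1 hp
  exact ⟨x, h1.symm, h2.symm⟩

/-- The formal adjoint `e^{sĴ²} X_j e^{-sĴ²}` is defined on each band, because `X_j f` again lies in
a level. The adjoint relation is a closed condition, so it extends to the closure of the graph. -/
theorem exists_adjoint_preA (j : Fin 3) {n : ℕ} {f : P.H} (hf : f ∈ P.band n) :
    ∃ f' : P.H, ∀ p ∈ (P.preA j).graph.topologicalClosure, ⟪f, p.2⟫_ℂ = ⟪f', p.1⟫_ℂ := by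
  obtain ⟨f', hf'⟩ := exists_adjoint_of_mem_hlevel
    (X_mem_hlevel (band_le_hlevel n.lt_succ_self hf) j) P.s
  refine ⟨((Real.exp (-P.s * P.eig n) : ℝ) : ℂ) • f', fun p hp => ?_⟩
  have hclosed : IsClosed {p : P.H × P.H |
      ⟪f, p.2⟫_ℂ = ⟪((Real.exp (-P.s * P.eig n) : ℝ) : ℂ) • f', p.1⟫_ℂ} :=
    isClosed_eq ((innerSL ℂ f).continuous.comp continuous_snd)
      ((innerSL ℂ (((Real.exp (-P.s * P.eig n) : ℝ) : ℂ) • f')).continuous.comp continuous_fst)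
  refine hclosed.closure_subset_iff.2 (fun q hq => ?_) hp
  obtain ⟨x, h1, h2⟩ := exists_of_mem_graph_preA hq
  rw [Set.mem_ofPred_eq, h1, h2, inner_expAngMomSq hf, hinner_smul_left, ← inner_X_left, hf',
    Complex.conj_ofReal]

/-- If `(0, η)` is in the closure of the graph, the adjoint relation makes `η` orthogonal to every
band. -/
theorem isClosable_preA (j : Fin 3) : (P.preA j).IsClosable := by
  refine ⟨(P.preA j).graph.topologicalClosure.toLinearPMap,
    (Submodule.toLinearPMap_graph_eq _ fun p hp h0 => ?_).symm⟩
  refine eq_zero_of_orthogonal_band fun n f hf => ?_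
  obtain ⟨f', h⟩ := exists_adjoint_preA j hf
  rw [h p hp, h0, inner_zero_right (E := P.H)]

theorem apply_A_of_mem_closure {j : Fin 3} {χ η : P.H}
    (h : (χ, η) ∈ (P.preA j).graph.topologicalClosure) :
    ∃ hχ : χ ∈ (P.A j).domain, P.A j ⟨χ, hχ⟩ = η := by
  have hc := (isClosable_preA (P := P) j).graph_closure_eq_closure_graph
  rw [hc] at h
  obtain ⟨y, h1, h2⟩ := (LinearPMap.mem_graph_iff _).1 h
  obtain ⟨y, hy⟩ := y
  obtain rfl : y = χ := h1
  exact ⟨hy, h2⟩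

/-! ### The heat kernel -/

variable (P) in
/-- The bundle heat kernel and its analytic continuation. -/
def heatKernel (a : Fin 3 → ℂ) : P.V →L[ℂ] P.H :=
  ∑' n, ((Real.exp (-P.s * P.eig n) : ℝ) : ℂ) • P.kernelVec n a

theorem hasSum_heatKernel {a : Fin 3 → ℂ} (ha : a ∈ P.sphereC) (v : P.V) :
    HasSum (fun n => ((Real.exp (-P.s * P.eig n) : ℝ) : ℂ) • P.kernelVec n a v)
      (P.heatKernel a v) := by
  obtain ⟨C, D, h⟩ := exists_kernelVec_le (P := P) ‖a‖
  exact hasSum_smul_clm_apply (fun n => (Real.exp_pos _).le) (fun n => h n a ha le_rfl)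
    (summable_exp_eig s_pos C D) v

theorem expAngMomSq_sum {f : ℕ → P.H} (hf : ∀ n, f n ∈ P.band n) (N : ℕ) (t : ℝ)
    (h : ∑ n ∈ Finset.range N, f n ∈ (P.expAngMomSq t).domain) :
    P.expAngMomSq t ⟨∑ n ∈ Finset.range N, f n, h⟩ =
      ∑ n ∈ Finset.range N, ((Real.exp (t * P.eig n) : ℝ) : ℂ) • f n := by
  rw [expAngMomSq_apply]
  have h1 := hasSum_sum fun n (_ : n ∈ Finset.range N) => hasSum_of_mem_band (hf n) t
  simp only [← Finset.smul_sum, ← map_sum] at h1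
  exact h1.tsum_eq

variable (P) in
/-- The partial sums of the heat kernel. -/
def heatSum (N : ℕ) (a : Fin 3 → ℂ) (v : P.V) : P.H :=
  ∑ n ∈ Finset.range N, ((Real.exp (-P.s * P.eig n) : ℝ) : ℂ) • P.kernelVec n a v

theorem heatSum_mem_band (a : Fin 3 → ℂ) (v : P.V) (n : ℕ) :
    ((Real.exp (-P.s * P.eig n) : ℝ) : ℂ) • P.kernelVec n a v ∈ P.band n :=
  Submodule.smul_mem _ _ (kernelVec_mem n a v)

theorem heatSum_mem_domain (N : ℕ) (a : Fin 3 → ℂ) (v : P.V) (t : ℝ) :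
    P.heatSum N a v ∈ (P.expAngMomSq t).domain :=
  hlevel_le_domain N t (sum_mem fun n hn =>
    band_le_hlevel (Finset.mem_range.1 hn) (heatSum_mem_band a v n))

theorem expAngMomSq_heatSum (N : ℕ) (a : Fin 3 → ℂ) (v : P.V) :
    P.expAngMomSq P.s ⟨P.heatSum N a v, heatSum_mem_domain N a v P.s⟩ = P.kernelSum N a v := by
  refine (expAngMomSq_sum (heatSum_mem_band a v) N P.s _).trans ?_
  rw [kernelSum_apply]
  refine Finset.sum_congr rfl fun n _ => ?_
  rw [smul_smul, ← Complex.ofReal_mul, ← Real.exp_add]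
  simp

theorem expAngMomSq_neg_kernelSum (N : ℕ) (a : Fin 3 → ℂ) (v : P.V) :
    P.expAngMomSq (-P.s) ⟨P.kernelSum N a v, mem_domain_neg s_pos _⟩ = P.heatSum N a v := by
  have h := expAngMomSq_sum (fun n => kernelVec_mem n a v) N (-P.s) (mem_domain_neg s_pos _)
  refine Eq.trans ?_ h
  congr 1
  exact Subtype.ext (kernelSum_apply N a v)

/-- `exp(s Ĵ²)` undoes the heat factors of the finite sum; then `X_j S_N` is the defect plus `a_j
S_N`, and the heat operator is applied again. -/
theorem mem_graph_heatSum (N : ℕ) (j : Fin 3) (a : Fin 3 → ℂ) (v : P.V) :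
    (P.heatSum N a v, P.expAngMomSq (-P.s) ⟨P.kernelDefect N j a v, mem_domain_neg s_pos _⟩ +
      a j • P.heatSum N a v) ∈ (P.preA j).graph := by
  have h := mem_graph_preA j ⟨P.heatSum N a v, heatSum_mem_domain N a v P.s⟩
  rw [← expAngMomSq_neg_kernelSum, ← LinearPMap.map_smul, ← LinearPMap.map_add]
  refine Eq.mp ?_ h
  congr 2
  · rw [expAngMomSq_neg_kernelSum]
  · congr 1
    apply Subtype.ext
    rw [expAngMomSq_heatSum]
    simp [kernelDefect]

theorem tendsto_defect (j : Fin 3) {a : Fin 3 → ℂ} (ha : a ∈ P.sphereC) (v : P.V) :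
    Filter.Tendsto (fun N => P.expAngMomSq (-P.s)
      ⟨P.kernelDefect (N + 1) j a v, mem_domain_neg s_pos _⟩) Filter.atTop (nhds 0) := by
  obtain ⟨C, D, h⟩ := exists_kernelVec_le (P := P) ‖a‖
  have hr := P.r_pos
  -- The number of terms is absorbed by `N + 1 ≤ e^N`, which accounts for the rate `|C| + 1`.
  have hsum : ∀ N : ℕ, ‖P.kernelSum (N + 1) a v‖ ≤ Real.exp ((|C| + 1) * N + D) * ‖v‖ := by
    intro N
    have h1 : ‖P.kernelSum (N + 1) a v‖ ≤
        ∑ n ∈ Finset.range (N + 1), Real.exp (|C| * N + D) * ‖v‖ := by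
      rw [kernelSum_apply]
      refine norm_sum_le_of_le _ fun n hn => ((P.kernelVec n a).le_opNorm v).trans ?_
      gcongr
      refine (h n a ha le_rfl).trans (Real.exp_le_exp.2 ?_)
      have h2 : (n : ℝ) ≤ N := by exact_mod_cast Nat.lt_succ_iff.1 (Finset.mem_range.1 hn)
      have h3 : C * n ≤ |C| * N :=
        mul_le_mul (le_abs_self C) h2 (Nat.cast_nonneg n) (abs_nonneg C)
      linarith
    refine h1.trans ?_
    rw [Finset.sum_const, Finset.card_range, nsmul_eq_mul, ← mul_assoc]
    gcongr
    rw [show (|C| + 1) * N + D = N + (|C| * N + D) by ring, Real.exp_add (N : ℝ)]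
    gcongr
    push_cast
    exact Real.add_one_le_exp _
  have hlim := ((summable_exp_eig (P := P) (s_pos (P := P)) (|C| + 1) D).mul_right
    (2 * (P.r + ‖a‖) * ‖v‖)).tendsto_atTop_zero
  refine squeeze_zero_norm (fun N => ?_) hlim
  refine (norm_expAngMomSq_le_of_orthogonal (kernelDefect_mem (N + 1) j a v)
    (fun g hg => inner_kernelDefect N j ha v hg) s_pos).trans ?_
  have h1 := (norm_kernelDefect_le (N + 1) j a v).trans
    (mul_le_mul_of_nonneg_left (hsum N) (by positivity))
  calc _ ≤ 2 * (Real.exp (-P.s * P.eig N) *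
        ((P.r + ‖a‖) * (Real.exp ((|C| + 1) * N + D) * ‖v‖))) :=
        mul_le_mul_of_nonneg_left (mul_le_mul_of_nonneg_left h1 (Real.exp_pos _).le) (by norm_num)
    _ = _ := by ring

theorem mem_closure_heatKernel (j : Fin 3) {a : Fin 3 → ℂ} (ha : a ∈ P.sphereC) (v : P.V) :
    (P.heatKernel a v, a j • P.heatKernel a v) ∈ (P.preA j).graph.topologicalClosure := by
  have h1 : Filter.Tendsto (fun N => P.heatSum (N + 1) a v) Filter.atTop
      (nhds (P.heatKernel a v)) :=
    (Filter.tendsto_add_atTop_iff_nat 1).2 (hasSum_heatKernel ha v).tendsto_sum_nat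
  have h2 := (tendsto_defect j ha v).add (h1.const_smul (a j))
  rw [zero_add] at h2
  exact mem_closure_of_tendsto (h1.prodMk_nhds h2)
    (Filter.Eventually.of_forall fun N => mem_graph_heatSum (N + 1) j a v)

/-- Pairing with the lowest section `Π v` leaves only the term `n = 0`, equal to a positive multiple
of `⟨Π_ā v, v⟩ = ⟨v, Π_a v⟩ = ‖v‖²`. -/
theorem heatKernel_ne_zero {a : Fin 3 → ℂ} (ha : a ∈ P.sphereC) {v : P.V} (hv : v ∈ P.fibre a)
    (hv0 : v ≠ 0) : P.heatKernel a v ≠ 0 := by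
  intro h0
  set F : P.level 1 := ⟨P.lowest v, lowest_mem_level v 0⟩ with hF
  have hband : P.embLevel 1 F ∈ P.band 0 := by
    refine ⟨embLevel_mem F, ?_⟩
    rw [hlevel_zero, Submodule.bot_orthogonal_eq_top]
    trivial
  have h1 := (hasSum_heatKernel ha v).mapL (innerSL ℂ (P.embLevel 1 F))
  have h2 := hasSum_single (f := fun n => innerSL ℂ (P.embLevel 1 F)
    (((Real.exp (-P.s * P.eig n) : ℝ) : ℂ) • P.kernelVec n a v)) 0 fun n hn => by
      rw [map_smul, innerSL_apply_apply, inner_band_eq_zero hn.symm hband (kernelVec_mem n a v),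
        smul_zero]
  have h3 := h1.unique h2
  rw [h0, map_zero, map_smul, innerSL_apply_apply, inner_kernelVec hband ha] at h3
  have h4 : ⟪(F : P.CFun) (star a), v⟫_ℂ = ⟪v, v⟫_ℂ := by
    change ⟪P.lowest v (star a), v⟫_ℂ = _
    rw [lowest_apply, inner_fibreProj, P.fibreProj_of_mem hv]
  rw [h4, smul_eq_mul, eq_comm, mul_eq_zero, inner_self_eq_zero] at h3
  rcases h3 with h3 | h3
  · exact (Real.exp_pos _).ne' (Complex.ofReal_eq_zero.1 h3)
  · exact hv0 h3

theorem isCoherentState_heatKernel {a : Fin 3 → ℂ} (ha : a ∈ P.sphereC) {v : P.V}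
    (hv : v ∈ P.fibre a) (hv0 : v ≠ 0) : P.IsCoherentState a (P.heatKernel a v) :=
  ⟨heatKernel_ne_zero ha hv hv0, fun j => apply_A_of_mem_closure (mem_closure_heatKernel j ha v)⟩

end Params

/-! ### Series of holomorphic functions -/

/-- Induction on the order of differentiability: Cauchy estimates on half the radius make the
derivatives summable. The target space is quantified inside, since it becomes a space of linear maps
at each step. -/
theorem contDiffAt_tsum_of_ball {E : Type} [NormedAddCommGroup E] [NormedSpace ℂ E] {R : ℝ}
    (hR : 0 < R) {c : E} {u : ℕ → ℝ} (hu : Summable u) (k : ℕ) :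
    ∀ {F : Type} [NormedAddCommGroup F] [NormedSpace ℂ F] [CompleteSpace F] {f : ℕ → E → F},
      (∀ n, ContDiffOn ℂ ∞ (f n) (ball c R)) → (∀ n, ∀ x ∈ ball c R, ‖f n x‖ ≤ u n) →
      ContDiffAt ℂ k (fun x => ∑' n, f n x) c := by
  induction k generalizing R u with
  | zero =>
    intro F _ _ _ f hf hfu
    have h1 : ContinuousOn (fun x => ∑' n, f n x) (ball c R) :=
      continuousOn_tsum (fun n => (hf n).continuousOn) hu hfu
    refine contDiffAt_zero.2 ⟨ball c R, ball_mem_nhds c hR, h1⟩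
  | succ k ih =>
    intro F _ _ _ f hf hfu
    have hd : ∀ n, DifferentiableOn ℂ (f n) (ball c R) := fun n =>
      (hf n).differentiableOn (by simp)
    have hsub : ball c (R / 2) ⊆ ball c R := ball_subset_ball (by linarith)
    have hbound : ∀ n, ∀ x ∈ ball c (R / 2), ‖fderiv ℂ (f n) x‖ ≤ 2 * u n / (R / 2) := by
      intro n x hx
      have hsub2 : ball x (R / 2) ⊆ ball c R := by
        refine ball_subset_ball' ?_
        have := mem_ball.1 hx
        linarith
      refine Complex.norm_fderiv_le_div_of_mapsTo_ball ((hd n).mono hsub2) (fun y hy => ?_)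
        (by positivity)
      rw [mem_closedBall, dist_eq_norm, two_mul]
      exact (norm_sub_le _ _).trans (add_le_add (hfu n y (hsub2 hy)) (hfu n x (hsub hx)))
    have hu2 : Summable fun n => 2 * u n / (R / 2) := (hu.mul_left 2).div_const _
    refine (contDiffAt_succ_iff_hasFDerivAt (n := (k : ℕ))).2
      ⟨fun x => ∑' n, fderiv ℂ (f n) x, ⟨ball c (R / 2), ball_mem_nhds c (by positivity), ?_⟩,
        ih (by positivity : 0 < R / 2) hu2 (fun n => ?_) hbound⟩
    · intro x hx
      -- The real structure is needed only to speak of the convexity of the ball.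
      let _ : NormedSpace ℝ E := NormedSpace.restrictScalars ℝ ℂ E
      refine hasFDerivAt_tsum_of_isPreconnected hu2 isOpen_ball
        (convex_ball c (R / 2)).isPreconnected (fun n y hy => ?_) hbound hx ?_ hx
      · exact ((hd n).differentiableAt (isOpen_ball.mem_nhds (hsub hy))).hasFDerivAt
      · exact Summable.of_norm_bounded hu fun n => hfu n x (hsub hx)
    · exact ((hf n).fderiv_of_isOpen isOpen_ball (m := ∞) le_rfl).mono hsub

namespace Params
variable (P : Params)

/-! ### A holomorphic retraction onto the complex sphere -/

/-- The quadratic form whose level set is the complex sphere. -/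
def quad (b : Fin 3 → ℂ) : ℂ := ∑ j, b j ^ 2

/-- The radial retraction of a neighbourhood onto the complex sphere. -/
def retract (b : Fin 3 → ℂ) : Fin 3 → ℂ := (P.r * Complex.exp (-(Complex.log (quad b) / 2))) • b

variable {P}

theorem quad_of_mem {a : Fin 3 → ℂ} (ha : a ∈ P.sphereC) : quad a = (P.r : ℂ) ^ 2 := ha

theorem contDiff_quad : ContDiff ℂ ∞ quad := by
  unfold quad
  fun_prop

theorem retract_mem {b : Fin 3 → ℂ} (hb : quad b ∈ Complex.slitPlane) :
    P.retract b ∈ P.sphereC := by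
  change ∑ j, P.retract b j ^ 2 = (P.r : ℂ) ^ 2
  have h0 := Complex.slitPlane_ne_zero hb
  have h1 : Complex.exp (-(Complex.log (quad b) / 2)) ^ 2 * quad b = 1 := by
    rw [← Complex.exp_nat_mul]
    nth_rewrite 2 [← Complex.exp_log h0]
    rw [← Complex.exp_add]
    push_cast
    ring_nf
    exact Complex.exp_zero
  simp only [retract, Pi.smul_apply, smul_eq_mul, mul_pow]
  rw [← Finset.mul_sum, mul_assoc]
  exact (congrArg _ h1).trans (mul_one _)

theorem slitPlane_of_mem {a : Fin 3 → ℂ} (ha : a ∈ P.sphereC) : quad a ∈ Complex.slitPlane := by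
  rw [quad_of_mem ha, ← Complex.ofReal_pow]
  exact Complex.ofReal_mem_slitPlane.2 (pow_pos P.r_pos 2)

theorem retract_of_mem {a : Fin 3 → ℂ} (ha : a ∈ P.sphereC) : P.retract a = a := by
  have hr := P.r_pos
  have h : Complex.exp (-(Complex.log ((P.r : ℂ) ^ 2) / 2)) = (P.r : ℂ)⁻¹ := by
    rw [← Complex.ofReal_pow, ← Complex.ofReal_log (by positivity), Real.log_pow, ← Complex.ofReal_inv]
    have : -(((2 : ℕ) * Real.log P.r : ℝ) : ℂ) / 2 = ((-Real.log P.r : ℝ) : ℂ) := by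
      push_cast; ring
    rw [← neg_div, this, ← Complex.ofReal_exp, Real.exp_neg, Real.exp_log hr]
  rw [retract, quad_of_mem ha, h, mul_inv_cancel₀ (Complex.ofReal_ne_zero.2 hr.ne'), one_smul]

theorem contDiffAt_retract {b : Fin 3 → ℂ} (hb : quad b ∈ Complex.slitPlane) :
    ContDiffAt ℂ ∞ P.retract b := by
  unfold retract
  have h1 : ContDiffAt ℂ ∞ (fun b => Complex.log (quad b)) b :=
    (Complex.contDiffAt_log hb).comp b contDiff_quad.contDiffAt
  exact (contDiffAt_const.mul (h1.div_const 2).neg.cexp).smul contDiffAt_id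

theorem isOpen_quad : IsOpen {b | quad b ∈ Complex.slitPlane} :=
  Complex.isOpen_slitPlane.preimage contDiff_quad.continuous

/-- A series of entire functions which converges locally uniformly on the complex sphere has a
holomorphic sum. -/
theorem contDiffAt_tsum_retract {F : Type} [NormedAddCommGroup F] [NormedSpace ℂ F]
    [CompleteSpace F] {f : ℕ → (Fin 3 → ℂ) → F} (hf : ∀ n, ContDiff ℂ ∞ (f n))
    (hb : ∀ R : ℝ, ∃ u : ℕ → ℝ, Summable u ∧ ∀ n, ∀ a ∈ P.sphereC, ‖a‖ ≤ R → ‖f n a‖ ≤ u n)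
    {b : Fin 3 → ℂ} (hbq : quad b ∈ Complex.slitPlane) :
    ContDiffAt ℂ ∞ (fun b => ∑' n, f n (P.retract b)) b := by
  obtain ⟨u, hu, hfu⟩ := hb (‖P.retract b‖ + 1)
  have hcont := (contDiffAt_retract (P := P) hbq).continuousAt.norm
  have h1 : ∀ᶠ x in nhds b, ‖P.retract x‖ < ‖P.retract b‖ + 1 :=
    hcont.eventually_lt_const (by linarith)
  obtain ⟨R, hR, hball⟩ := Metric.eventually_nhds_iff_ball.1
    (h1.and (isOpen_quad.eventually_mem hbq))
  rw [contDiffAt_infty]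
  intro k
  refine contDiffAt_tsum_of_ball hR hu k (fun n x hx => ?_) fun n x hx => ?_
  · exact ((hf n).contDiffAt.comp x (contDiffAt_retract (hball x hx).2)).contDiffWithinAt
  · exact hfu n _ (retract_mem (hball x hx).2) (hball x hx).1.le

/-- The growth bounds hold on the complex sphere only, so the local holomorphic extension is the
series composed with the radial retraction. -/
theorem isHolomorphic_heatKernel (v : P.V) : P.IsHolomorphic fun a => P.heatKernel a v := by
  intro a ha
  refine ⟨{b | quad b ∈ Complex.slitPlane}, isOpen_quad, slitPlane_of_mem ha, fun b => ∑' n,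
    ((Real.exp (-P.s * P.eig n) : ℝ) : ℂ) • P.kernelVec n (P.retract b) v, fun b hb => ?_,
    fun b hb => ?_⟩
  · refine ((contDiffAt_tsum_retract
      (f := fun n b => ((Real.exp (-P.s * P.eig n) : ℝ) : ℂ) • P.kernelVec n b v)
      (fun n => (contDiff_kernelVec n v).const_smul _) (fun R => ?_) hb).differentiableAt
      (by simp)).differentiableWithinAt
    obtain ⟨C, D, h⟩ := exists_kernelVec_le (P := P) R
    refine ⟨_, (summable_exp_eig (P := P) (s_pos (P := P)) C D).mul_right ‖v‖,
      fun n a ha haR => ?_⟩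
    rw [norm_exp_smul, mul_assoc]
    gcongr
    refine ((P.kernelVec n a).le_opNorm v).trans ?_
    gcongr
    exact h n a ha haR
  · change P.heatKernel b v = ∑' n, _
    rw [retract_of_mem hb.2]
    exact (hasSum_heatKernel hb.2 v).tsum_eq.symm

/-! ### The heat operator -/

variable (P) in
/-- The entire function which represents the component of a vector in an eigenspace. -/
def projFun (ψ : P.H) (n : ℕ) : P.level (n + 1) := ∑ i, ⟪(P.bandBasis n i : P.H), ψ⟫_ℂ • P.bandFun n i

theorem embLevel_projFun (ψ : P.H) (n : ℕ) : P.embLevel (n + 1) (P.projFun ψ n) = P.proj n ψ := by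
  rw [projFun, map_sum]
  simp only [map_smul, embLevel_bandFun]
  have h := congrArg Subtype.val ((P.bandBasis n).sum_repr' ((P.band n).orthogonalProjectionOnto ψ))
  refine Eq.trans ?_ h
  rw [AddSubmonoidClass.coe_finsetSum]
  refine Finset.sum_congr rfl fun i _ => ?_
  rw [Submodule.coe_smul, Submodule.coe_inner]
  congr 1
  exact (inner_proj (P.bandBasis n i).2 ψ).symm

theorem inner_projFun (ψ : P.H) (n : ℕ) (a : Fin 3 → ℂ) (v : P.V) :
    ⟪(P.projFun ψ n : P.CFun) a, v⟫_ℂ = ⟪ψ, P.kernelVec n (star a) v⟫_ℂ := by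
  rw [kernelVec_apply, star_star, inner_sum]
  simp only [projFun, AddSubmonoidClass.coe_finsetSum, Finset.sum_apply, sum_inner]
  refine Finset.sum_congr rfl fun i _ => ?_
  change ⟪⟪(P.bandBasis n i : P.H), ψ⟫_ℂ • (P.bandFun n i : P.CFun) a, v⟫_ℂ = _
  rw [inner_smul_left, inner_conj_symm (E := P.H), hinner_smul_right, mul_comm]

theorem norm_projFun_le (ψ : P.H) (n : ℕ) (a : Fin 3 → ℂ) :
    ‖(P.projFun ψ n : P.CFun) a‖ ≤ ‖ψ‖ * ‖P.kernelVec n (star a)‖ := by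
  have h := inner_projFun ψ n a ((P.projFun ψ n : P.CFun) a)
  have h1 : ‖(P.projFun ψ n : P.CFun) a‖ * ‖(P.projFun ψ n : P.CFun) a‖ ≤
      (‖ψ‖ * ‖P.kernelVec n (star a)‖) * ‖(P.projFun ψ n : P.CFun) a‖ := by
    have h2 := congrArg norm h
    rw [inner_self_eq_norm_sq_to_K, norm_pow, RCLike.norm_ofReal, abs_norm, sq] at h2
    rw [h2, mul_assoc]
    refine (norm_inner_le_norm (E := P.H) _ _).trans ?_
    gcongr
    exact (P.kernelVec n (star a)).le_opNorm _
  rcases (norm_nonneg ((P.projFun ψ n : P.CFun) a)).eq_or_lt with h0 | h0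
  · rw [← h0]; positivity
  · exact le_of_mul_le_mul_right h1 h0

variable (P) in
/-- The holomorphic function which represents `exp (-s Ĵ²) ψ`. -/
def heatFun (ψ : P.H) (b : Fin 3 → ℂ) : P.V :=
  ∑' n, ((Real.exp (-P.s * P.eig n) : ℝ) : ℂ) • (P.projFun ψ n : P.CFun) (P.retract b)

theorem exists_heatFun_bound (ψ : P.H) (R : ℝ) : ∃ u : ℕ → ℝ, Summable u ∧ ∀ n, ∀ a ∈ P.sphereC,
    ‖a‖ ≤ R → ‖((Real.exp (-P.s * P.eig n) : ℝ) : ℂ) • (P.projFun ψ n : P.CFun) a‖ ≤ u n := by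
  obtain ⟨C, D, h⟩ := exists_kernelVec_le (P := P) R
  refine ⟨_, (summable_exp_eig (P := P) (s_pos (P := P)) C D).mul_left ‖ψ‖, fun n a ha haR => ?_⟩
  rw [norm_smul, Complex.norm_real, Real.norm_of_nonneg (Real.exp_pos _).le]
  have h1 := (norm_projFun_le ψ n a).trans (mul_le_mul_of_nonneg_left
    (h n (star a) (star_mem_sphereC ha) (by rwa [norm_star])) (norm_nonneg ψ))
  calc _ ≤ Real.exp (-P.s * P.eig n) * (‖ψ‖ * Real.exp (C * n + D)) := by gcongr
    _ = _ := by ring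

theorem contDiffAt_heatFun (ψ : P.H) {b : Fin 3 → ℂ} (hb : quad b ∈ Complex.slitPlane) :
    ContDiffAt ℂ ∞ (P.heatFun ψ) b :=
  contDiffAt_tsum_retract
    (f := fun n b => ((Real.exp (-P.s * P.eig n) : ℝ) : ℂ) • (P.projFun ψ n : P.CFun) b)
    (fun _ => (contDiff_level _).const_smul _) (exists_heatFun_bound ψ) hb

theorem hasSum_heatFun (ψ : P.H) {a : Fin 3 → ℂ} (ha : a ∈ P.sphereC) :
    HasSum (fun n => ((Real.exp (-P.s * P.eig n) : ℝ) : ℂ) • (P.projFun ψ n : P.CFun) a)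
      (P.heatFun ψ a) := by
  obtain ⟨u, hu, h⟩ := exists_heatFun_bound ψ ‖a‖
  have := (Summable.of_norm_bounded hu fun n => h n a ha le_rfl).hasSum
  rwa [heatFun, retract_of_mem ha]

theorem quad_complexify (x : E3) : quad (complexify x) = ((‖x‖ ^ 2 : ℝ) : ℂ) := by
  rw [EuclideanSpace.norm_sq_eq, quad]
  simp [complexify_apply]

/-- On real vectors the quadratic form is `‖x‖²`, so the restriction is smooth away from the origin;
the bump function removes a ball that does not meet the sphere. -/
theorem exists_smooth_extension {F : (Fin 3 → ℂ) → P.V}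
    (hF : ∀ b, quad b ∈ Complex.slitPlane → ContDiffAt ℂ ∞ F b) :
    ∃ G : E3 → P.V, ContDiff ℝ ∞ G ∧ ∀ x : P.Sphere, F (P.toC x) = G x := by
  have hr := P.r_pos
  let φ : ContDiffBump (0 : E3) := ⟨P.r / 3, P.r / 2, by positivity, by linarith⟩
  refine ⟨fun x => (1 - φ x) • F (complexify x), contDiff_iff_contDiffAt.2 fun x => ?_,
    fun x => ?_⟩
  · by_cases hx : x = 0
    · subst hx
      refine (contDiffAt_const (c := (0 : P.V))).congr_of_eventuallyEq ?_
      filter_upwards [closedBall_mem_nhds (0 : E3) (show 0 < P.r / 3 by positivity)] with y hy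
      rw [φ.one_of_mem_closedBall hy, sub_self, zero_smul]
    · have h1 : quad (complexify x) ∈ Complex.slitPlane := by
        rw [quad_complexify]
        exact Complex.ofReal_mem_slitPlane.2 (pow_pos (norm_pos_iff.2 hx) 2)
      exact (contDiffAt_const.sub φ.contDiff.contDiffAt).smul
        (((hF _ h1).restrict_scalars ℝ).comp x complexify.contDiff.contDiffAt)
  · have h1 : φ (x : E3) = 0 := φ.zero_of_le_dist (by
      have : ‖(x : E3)‖ = P.r := by simp
      rw [dist_zero_right, this]
      change P.r / 2 ≤ P.r
      linarith)
    change _ = (1 - φ (x : E3)) • F (complexify (x : E3))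
    rw [h1, sub_zero, one_smul, toC_eq]

variable (P) in
/-- The smooth section `exp (-s Ĵ²) ψ`. -/
def heatSection (ψ : P.H) : P.smoothSections :=
  ⟨fun x => P.heatFun ψ (P.toC x), exists_smooth_extension fun _ hb => contDiffAt_heatFun ψ hb,
    fun x => (Submodule.closed_of_finiteDimensional (P.fibre (P.toC x))).mem_of_tendsto
      (hasSum_heatFun ψ (P.toC_mem_sphereC x)) (Filter.Eventually.of_forall fun _ =>
        sum_mem fun n _ => Submodule.smul_mem _ _ (mem_fibre_of_mem_level (P.projFun ψ n).2 x))⟩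

theorem norm_toC_le (x : P.Sphere) : ‖P.toC x‖ ≤ P.r := by
  refine (pi_norm_le_iff_of_nonneg P.r_pos.le).2 fun j => ?_
  have h1 : ‖(x : E3) j‖ ≤ ‖(x : E3)‖ := PiLp.norm_apply_le _ j
  have h2 : ‖(x : E3)‖ = P.r := by simp
  rw [toC, Complex.norm_real]
  exact h1.trans h2.le

/-- The series converges uniformly on the sphere, so it may be integrated term by term against `f`;
only the term of band `m` survives. -/
theorem inner_band_heatSection {m : ℕ} {f : P.H} (hf : f ∈ P.band m) (ψ : P.H) :
    ⟪f, P.ofSmooth (P.heatSection ψ)⟫_ℂ = ((Real.exp (-P.s * P.eig m) : ℝ) : ℂ) * ⟪f, ψ⟫_ℂ := by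
  obtain ⟨F, rfl⟩ := hf.1
  obtain ⟨u, hu, hub⟩ := exists_heatFun_bound ψ P.r
  have hFc : Continuous fun x : P.Sphere => (F : P.CFun) (P.toC x) :=
    (contDiff_level F).comp_complexify.continuous.comp continuous_subtype_val
  obtain ⟨M, hM⟩ := isCompact_univ.exists_bound_of_continuousOn hFc.continuousOn
  have hcont : ∀ n, Continuous fun x : P.Sphere =>
      ((Real.exp (-P.s * P.eig n) : ℝ) : ℂ) • (P.projFun ψ n : P.CFun) (P.toC x) := fun n =>
    (((contDiff_level (P.projFun ψ n)).csmul
      ((Real.exp (-P.s * P.eig n) : ℝ) : ℂ)).comp_complexify.continuous.comp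
      continuous_subtype_val)
  have hsum := hasSum_integral_of_dominated_convergence (μ := P.area)
    (F := fun n x => ⟪(F : P.CFun) (P.toC x),
      ((Real.exp (-P.s * P.eig n) : ℝ) : ℂ) • (P.projFun ψ n : P.CFun) (P.toC x)⟫_ℂ)
    (f := fun x => ⟪(F : P.CFun) (P.toC x), P.heatFun ψ (P.toC x)⟫_ℂ)
    (fun n _ => M * u n) (fun n => (hFc.inner (hcont n)).aestronglyMeasurable)
    (fun n => Filter.Eventually.of_forall fun x => (norm_inner_le_norm _ _).trans
      (mul_le_mul (hM x (Set.mem_univ x)) (hub n _ (P.toC_mem_sphereC x) (norm_toC_le x))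
        (norm_nonneg _) ((norm_nonneg _).trans (hM x (Set.mem_univ x)))))
    (Filter.Eventually.of_forall fun x => hu.mul_left M) (integrable_const _)
    (Filter.Eventually.of_forall fun x =>
      (hasSum_heatFun ψ (P.toC_mem_sphereC x)).mapL (innerSL ℂ ((F : P.CFun) (P.toC x))))
  have hterm : ∀ n, ∫ x, ⟪(F : P.CFun) (P.toC x),
      ((Real.exp (-P.s * P.eig n) : ℝ) : ℂ) • (P.projFun ψ n : P.CFun) (P.toC x)⟫_ℂ ∂P.area =
      ((Real.exp (-P.s * P.eig n) : ℝ) : ℂ) * ⟪P.embLevel (m + 1) F, P.proj n ψ⟫_ℂ := by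
    intro n
    rw [← embLevel_projFun, inner_eq_integral_of_ae (embLevel_coe F) (embLevel_coe _),
      ← integral_const_mul]
    simp only [inner_smul_right]
  simp only [hterm] at hsum
  have h2 := hasSum_single (f := fun n => ((Real.exp (-P.s * P.eig n) : ℝ) : ℂ) *
    ⟪P.embLevel (m + 1) F, P.proj n ψ⟫_ℂ) m fun n hn => by
      rw [inner_proj_ne hn hf, mul_zero]
  rw [inner_proj hf] at h2
  rw [inner_eq_integral_of_ae (embLevel_coe F) (ofSmooth_coe _)]
  exact hsum.unique h2

theorem ofSmooth_heatSection (ψ : P.H) :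
    P.ofSmooth (P.heatSection ψ) = P.expAngMomSq (-P.s) ⟨ψ, mem_domain_neg s_pos ψ⟩ := by
  refine sub_eq_zero.1 (eq_zero_of_orthogonal_band fun n f hf => ?_)
  rw [inner_sub_right (E := P.H), inner_band_heatSection hf, inner_expAngMomSq hf, sub_self]

/-- Both sides expand into the terms `e^{-s c_n} ⟨ψ, κ_n(x) v⟩`: one as a series in the Hilbert
space, the other as a pointwise series at the self-conjugate point `x`. -/
theorem isHeatApplied_heatKernel (x : P.Sphere) (v : P.V) :
    P.IsHeatApplied P.s (P.delta x v) (P.heatKernel (P.toC x) v) := by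
  intro ψ
  refine ⟨mem_domain_neg s_pos ψ, P.heatSection ψ, ofSmooth_heatSection ψ, ?_⟩
  have hx := P.toC_mem_sphereC x
  have h1 := (hasSum_heatKernel hx v).mapL (innerSL ℂ ψ)
  have h2 := ((hasSum_heatFun ψ hx).mapL (innerSL ℂ v)).star
  simp only [innerSL_apply_apply] at h1 h2
  change _ = ⟪P.heatFun ψ (P.toC x), v⟫_ℂ
  refine h1.unique ?_
  rw [← inner_conj_symm]
  refine Eq.mp (congrArg (HasSum · _) (funext fun n => ?_)) h2
  rw [← starRingEnd_apply, inner_conj_symm, inner_smul_left, Complex.conj_ofReal, inner_projFun,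
    P.star_toC_eq, hinner_smul_right]

end Params

namespace Params
variable {P : Params}

/-! ### Delta vectors -/

variable (P) in
/-- The entire function whose powers concentrate on the real sphere at a given point. -/
def peak (x : P.Sphere) (a : Fin 3 → ℂ) : ℂ :=
  (P.r ^ 2 + ∑ j, P.toC x j * a j) / (2 * P.r ^ 2)

theorem contDiff_peak (x : P.Sphere) : ContDiff ℂ ∞ (P.peak x) := by
  unfold peak
  fun_prop

theorem peak_toC (x y : P.Sphere) :
    P.peak x (P.toC y) = ((1 - ‖(x : E3) - y‖ ^ 2 / (4 * P.r ^ 2) : ℝ) : ℂ) := by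
  have hr := P.r_pos
  have hx : ‖(x : E3)‖ = P.r := by simp
  have hy : ‖(y : E3)‖ = P.r := by simp
  have h1 : ∑ j, P.toC x j * P.toC y j = ((⟪(x : E3), y⟫_ℝ : ℝ) : ℂ) := by
    rw [inner_eq_coord, Fin.sum_univ_three]
    simp [toC]
  have h2 : (1 - ‖(x : E3) - y‖ ^ 2 / (4 * P.r ^ 2) : ℝ) =
      (P.r ^ 2 + ⟪(x : E3), y⟫_ℝ) / (2 * P.r ^ 2) := by
    rw [norm_sub_sq_real, hx, hy]
    field_simp
    ring
  rw [peak, h1, h2]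
  push_cast
  ring

theorem norm_peak_le (x y : P.Sphere) : ‖P.peak x (P.toC y)‖ ≤ 1 := by
  have hr := P.r_pos
  have hx : ‖(x : E3)‖ = P.r := by simp
  have hy : ‖(y : E3)‖ = P.r := by simp
  have h1 : ‖(x : E3) - y‖ ≤ 2 * P.r := (norm_sub_le _ _).trans (by rw [hx, hy, two_mul])
  have h2 : ‖(x : E3) - y‖ ^ 2 / (4 * P.r ^ 2) ≤ 1 := by
    rw [div_le_one (by positivity)]
    nlinarith [norm_nonneg ((x : E3) - y)]
  have h3 : 0 ≤ ‖(x : E3) - y‖ ^ 2 / (4 * P.r ^ 2) := by positivity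
  rw [peak_toC, Complex.norm_real, Real.norm_eq_abs, abs_le]
  constructor <;> linarith

theorem norm_peak_lt {x y : P.Sphere} (h : y ≠ x) : ‖P.peak x (P.toC y)‖ < 1 := by
  have hr := P.r_pos
  have h0 : 0 < ‖(x : E3) - y‖ := norm_pos_iff.2 (sub_ne_zero.2 fun e => h (Subtype.ext e.symm))
  refine (norm_peak_le x y).lt_of_ne fun h1 => ?_
  have hx : ‖(x : E3)‖ = P.r := by simp
  have hy : ‖(y : E3)‖ = P.r := by simp
  have h2 : ‖(x : E3) - y‖ ≤ 2 * P.r := (norm_sub_le _ _).trans (by rw [hx, hy, two_mul])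
  have h3 : ‖(x : E3) - y‖ ^ 2 / (4 * P.r ^ 2) ≤ 1 := by
    rw [div_le_one (by positivity)]
    nlinarith [norm_nonneg ((x : E3) - y)]
  have h4 : 0 < ‖(x : E3) - y‖ ^ 2 / (4 * P.r ^ 2) := by positivity
  rw [peak_toC, Complex.norm_real, Real.norm_of_nonneg (by linarith)] at h1
  linarith

theorem peak_self (x : P.Sphere) : P.peak x (P.toC x) = 1 := by
  rw [peak_toC]; simp

variable (P) in
/-- Entire sections which concentrate on the real sphere at a given point. -/
def peakSection (x : P.Sphere) (v : P.V) (n : ℕ) : P.entireSections :=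
  ⟨fun a => P.peak x a ^ n • P.lowest v a, ((contDiff_peak x).pow n).smul (contDiff_lowest v),
    fun y => Submodule.smul_mem _ _ (P.fibreProj_mem y v)⟩

theorem delta_peakSection {x : P.Sphere} {v : P.V} (hv : v ∈ P.fibre (P.toC x)) (n : ℕ) :
    P.delta x v (P.restrictSphere (P.peakSection x v n)) = ⟪v, v⟫_ℂ := by
  change ⟪P.peak x (P.toC x) ^ n • P.fibreProj (P.toC x) v, v⟫_ℂ = _
  rw [peak_self, one_pow, one_smul, P.fibreProj_of_mem hv]

theorem isPositionEigenvector_delta {x : P.Sphere} {v : P.V} (hv : v ∈ P.fibre (P.toC x))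
    (hv0 : v ≠ 0) : P.IsPositionEigenvector (P.toC x) (P.delta x v) := by
  refine ⟨fun h => ?_, fun j f => ?_⟩
  · have h1 := delta_peakSection hv 0
    rw [h, LinearMap.zero_apply, eq_comm, inner_self_eq_zero] at h1
    exact hv0 h1
  · change ⟪P.toC x j • (f : P.Sphere → P.V) x, v⟫_ℂ = P.toC x j * ⟪(f : P.Sphere → P.V) x, v⟫_ℂ
    rw [inner_smul_left]
    congr 1
    exact Complex.conj_ofReal _

/-- The peak function has modulus at most one on the real sphere, with equality at `x` alone, a null
set; dominated convergence applies to its powers. -/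
theorem tendsto_inner_peakSection (x : P.Sphere) (v : P.V) (ψ : P.H) :
    Filter.Tendsto (fun n => ⟪P.emb (P.peakSection x v n), ψ⟫_ℂ) Filter.atTop (nhds 0) := by
  have hc : Continuous fun y : P.Sphere => P.fibreProj (P.toC y) v :=
    (contDiff_lowest (P := P) v).comp_complexify.continuous.comp continuous_subtype_val
  have hp : Continuous fun y : P.Sphere => P.peak x (P.toC y) :=
    (contDiff_peak x).continuous.comp (complexify.continuous.comp continuous_subtype_val)
  obtain ⟨M, hM⟩ := isCompact_univ.exists_bound_of_continuousOn hc.continuousOn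
  have hψ : MemLp (ψ : P.L2V) 2 P.area := Lp.memLp _
  have h1 := tendsto_integral_of_dominated_convergence (μ := P.area)
    (F := fun n y => ⟪P.peak x (P.toC y) ^ n • P.fibreProj (P.toC y) v, (ψ : P.L2V) y⟫_ℂ)
    (f := fun _ => (0 : ℂ)) (fun y => M * ‖(ψ : P.L2V) y‖)
    (fun n => ((hp.pow n).smul hc).aestronglyMeasurable.inner hψ.1)
    ((hψ.integrable (by norm_num)).norm.const_mul M)
    (fun n => Filter.Eventually.of_forall fun y => ?_) ?_
  · rw [integral_zero] at h1
    refine h1.congr fun n => ?_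
    exact (inner_eq_integral_of_ae (emb_coe (P.peakSection x v n)) Filter.EventuallyEq.rfl).symm
  · refine (norm_inner_le_norm _ _).trans ?_
    gcongr
    rw [norm_smul, norm_pow]
    calc _ ≤ 1 * M := by
          gcongr
          · exact pow_le_one₀ (norm_nonneg _) (norm_peak_le x y)
          · exact hM y (Set.mem_univ y)
      _ = M := one_mul M
  · have hne : ∀ᵐ y ∂P.area, y ≠ x := by
      rw [ae_iff]
      simpa using P.area_singleton x
    filter_upwards [hne] with y hy
    have h2 := tendsto_pow_atTop_nhds_zero_of_norm_lt_one (norm_peak_lt hy)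
    have h3 := (h2.smul_const (P.fibreProj (P.toC y) v)).inner
      (tendsto_const_nhds (x := (ψ : P.L2V) y)) (𝕜 := ℂ)
    simpa only [zero_smul, inner_zero_left] using h3

/-- The delta vector takes the constant value `‖v‖²` on the peak sections, whereas their pairing
with any vector of the Hilbert space tends to zero. -/
theorem not_isNormalizable_delta {x : P.Sphere} {v : P.V} (hv : v ∈ P.fibre (P.toC x))
    (hv0 : v ≠ 0) : ¬ P.IsNormalizable (P.delta x v) := by
  rintro ⟨ψ, hψ⟩
  have h1 := tendsto_inner_peakSection x v ψ
  have h2 : ∀ n, ⟪P.emb (P.peakSection x v n), ψ⟫_ℂ = ⟪v, v⟫_ℂ := fun n =>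
    (hψ _).symm.trans (delta_peakSection hv n)
  simp only [h2] at h1
  exact hv0 (inner_self_eq_zero.1 (tendsto_nhds_unique tendsto_const_nhds h1))

end Params

end MonopoleSphere

end

/-! ### Coherent states from the continued heat kernel. -/

theorem mainTheorem4 (P : MonopoleSphere.Params) :
    (∀ a ∈ P.sphereC, ∃ χ : P.H, P.IsCoherentState a χ) ∧
    ∃ K : (Fin 3 → ℂ) → P.V →ₗ[ℂ] P.H,
      (∀ v : P.V, P.IsHolomorphic fun a => K a v) ∧
      (∀ (x : P.Sphere) (v : P.V), P.IsHeatApplied P.s (P.delta x v) (K (P.toC x) v)) ∧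
      (∀ (x : P.Sphere) (v : P.V), v ∈ P.fibre (P.toC x) → v ≠ 0 →
        P.IsPositionEigenvector (P.toC x) (P.delta x v) ∧ ¬ P.IsNormalizable (P.delta x v)) ∧
      (∀ a ∈ P.sphereC, (∃ v ∈ P.fibre a, v ≠ 0) ∧
        ∀ v ∈ P.fibre a, v ≠ 0 → P.IsCoherentState a (K a v)) := by
  have hcoh : ∀ a ∈ P.sphereC, ∀ v ∈ P.fibre a, v ≠ 0 → P.IsCoherentState a (P.heatKernel a v) :=
    fun a ha v hv hv0 => MonopoleSphere.Params.isCoherentState_heatKernel ha hv hv0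
  refine ⟨fun a ha => ?_, fun a => (P.heatKernel a : P.V →ₗ[ℂ] P.H),
    MonopoleSphere.Params.isHolomorphic_heatKernel,
    MonopoleSphere.Params.isHeatApplied_heatKernel, fun x v hv hv0 =>
    ⟨MonopoleSphere.Params.isPositionEigenvector_delta hv hv0,
      MonopoleSphere.Params.not_isNormalizable_delta hv hv0⟩,
    fun a ha => ⟨P.exists_mem_fibre_ne_zero ha, hcoh a ha⟩⟩
  obtain ⟨v, hv, hv0⟩ := P.exists_mem_fibre_ne_zero ha
  exact ⟨_, hcoh a ha v hv hv0⟩
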